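/- **Setting.** All vectors are real with the Euclidean norm $|\cdot|$. A function $\sigma:[0,\infty)\to[0,\infty)$ is of class $\mathcal K$ if it is continuous, strictly increasing and $\sigma(0)=0$; $|x|_M^2:=x^\top Mx$. The plant is $x_P^+=f_P(x_P,u,w_P)$, $y=h_P(x_P,u,w_P)$; the model is $x^+=f(x,u,d)$, $y=h(x,u,d)$; the reference is $r=g(u,y)$. Setpoints are $s=(r_{sp},u_{sp},y_{sp})$, and $\beta=(s,d)$, $\alpha=(s,w_P)$. **Assumptions.** 1. *(Continuity)* $g:\mathbb U\times\mathbb Y\to\mathbb R^{n_r}$, $(f_P,h_P):\mathbb X\times\mathbb U\times\mathbb W\to\mathbb X\times\mathbb Y$ and $(f,h):\mathbb X\times\mathbb U\times\mathbb D\to\mathbb X\times\mathbb Y$ are continuous, $f,h,g$ vanish at the origin, and $f(x,u,0)=f_P(x,u,0)$, $h(x,u,0)=h_P(x,u,0)$ on $\mathbb X\times\mathbb U$. 2. *(Constraints)* $\mathbb X,\mathbb Y$ are closed, $\mathbb U,\mathbb W,\mathbb D$ are compact, and all contain the origin; $\bar c:\mathbb U\times\mathbb Y\to\mathbb R^{n_c}$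 is continuous, $\bar b>0$ and $\bar c(0,0)+\bar b<0$ componentwise. 3. *(Steady-state target problem, SSTP)* Let $\bar{\mathbb Z}_y:=\{(u,y)\in\mathbb U\times\mathbb Y:\bar c(u,y)+\bar b\le 0\}$, let $\mathcal Z_O(r_{sp},d)$ be the set of $(x,u)\in\mathbb X\times\mathbb U$ with $x=f(x,u,d)$, $(u,h(x,u,d))\in\bar{\mathbb Z}_y$ and $r_{sp}=g(u,h(x,u,d))$, and let $\mathcal B$ be the set of $\beta$ with $(u_{sp},y_{sp})\in\bar{\mathbb Z}_y$, $d\in\mathbb D$, $\mathcal Z_O(r_{sp},d)\ne\varnothing$. The function $\ell_s\ge0$ is continuous, and for each $\beta\in\mathcal B$ either $\mathcal Z_O(r_{sp},d)$ is compact or $(x,u)\mapsto\ell_s(u-u_{sp},h(x,u,d)-y_{sp})$ is coercive on it. For each $\beta\in\mathcal B$, $z_s(\beta)=(x_s(\beta),u_s(\beta))$ is a (selected) minimizer of this function on $\mathcal Z_O(r_{sp},d)$. 4. *(Regulator)* Let $N\ge1$, $c_f>0$, let $\phi(k;x,\mathbf u,d)$ be the model solution, $\mathbb X_f(\beta):=\{x\in\mathbb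 X:V_f(x,\beta)\le c_f\}$, $\mathcal U_N(x,\beta):=\{\mathbf u\in\mathbb U^N:\phi(N;x,\mathbf u,d)\in\mathbb X_f(\beta)\}$, $\mathcal S_N:=\{(x,\beta)\in\mathbb X\times\mathcal B:\mathcal U_N(x,\beta)\neq\varnothing\}$, $V_N(x,\mathbf u,\beta):=V_f(\phi(N;x,\mathbf u,d),\beta)+\sum_{k<N}\ell(\phi(k;x,\mathbf u,d),u(k),\beta)$, and $V_N^0(x,\beta):=\min_{\mathbf u\in\mathcal U_N(x,\beta)}V_N(x,\mathbf u,\beta)$. Let $\mathbf u^0(x,\beta)$ be a (selected) minimizer for each $(x,\beta)\in\mathcal S_N$ and $\kappa_N(x,\beta):=u^0(0;x,\beta)$. 5. *(Terminal control law)* There is $\kappa_f:\mathbb X\times\mathcal B\to\mathbb U$ with $V_f(f(x,\kappa_f(x,\beta),d),\beta)-V_f(x,\beta)\le-\ell(x,\kappa_f(x,\beta),\beta)$ for $\beta\in\mathcal B$, $x\in\mathbb X_f(\beta)$. 6. *(Quadratic costs)* There are positive definite $Q,R$, weights $w_i>0$, and positive definite $P_f(\beta)$, $\beta\in\mathcal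 B$, depending continuously on $\beta\in\hat{\mathcal B}_c$ (defined in 8), such that $\ell(x,u,\beta)=|x-x_s(\beta)|_Q^2+|u-u_s(\beta)|_R^2+\sum_i w_i\max\{0,\bar c_i(u,h(x,u,d))\}$ and $V_f(x,\beta)=|x-x_s(\beta)|^2_{P_f(\beta)}$ on $\mathbb X\times\mathbb U\times\mathcal B$. 7. *(Estimator)* The estimator is a sequence $\Phi_k:\mathbb X\times\mathbb D\times\mathbb U^k\times\mathbb Y^k\to\mathbb X\times\mathbb D$, $(\hat x(k),\hat d(k)):=\Phi_k(\bar x,\bar d,\mathbf u_{0:k-1},\mathbf y_{0:k-1})$, with $\Phi_0$ the identity. There are $V_e:\mathbb X\times\mathbb D\times\mathbb X\times\mathbb D\to[0,\infty)$ and $c_1,\dots,c_4>0$ such that, with $e:=(x-\hat x,d-\hat d)$ and $V_e(k):=V_e(x(k),d(k),\hat x(k),\hat d(k))$, one has $c_1|e(k)|^2\le V_e(k)\le c_2|e(k)|^2$ and $V_e(k+1)\le V_e(k)-c_3|e(k)|^2+c_4|(w,w_d,v)(k)|^2$ for all $k\ge0$, all priors $(\bar x,\bar d)\in\mathbb X\times\mathbb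 D$, and all sequences in $\mathbb X,\mathbb U,\mathbb D,\mathbb Y$ satisfying $x^+=f(x,u,d)+w$, $d^+=d+w_d$, $y=h(x,u,d)+v$. 8. *(SSTP continuity and mismatch corrections)* There are compact sets $\mathcal A_c\subseteq\mathbb R^{n_r}\times\bar{\mathbb Z}_y\times\mathbb W$ and $\mathcal B_c\subseteq\mathcal B$ containing the origin, continuous $(x_{P,s},d_s):\mathcal A_c\to\mathbb X\times\mathbb D$ and $\delta_0>0$ such that: $\hat{\mathcal B}_c:=\{(s,\hat d):\hat d\in\mathbb D,\ \exists d,\ (s,d)\in\mathcal B_c,\ |d-\hat d|\le\delta_0\}\subseteq\mathcal B$; $z_s$ is Lipschitz on $\hat{\mathcal B}_c$; for each $\alpha=(s,w_P)\in\mathcal A_c$, $(x_{P,s}(\alpha),d_s(\alpha))$ is the unique $(x',d')\in\mathbb X\times\mathbb D$ with $(s,d')\in\mathcal B$, $x'=f_P(x',u_s(s,d'),w_P)$ and $h(x_s(s,d'),u_s(s,d'),d')=h_P(x',u_s(s,d'),w_P)$; $(s,d_s(\alpha))\in\mathcal B_c$ and $(s,0)\in\mathcal A_c$ for all $\alpha=(s,w_P)\in\mathcal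 A_c$. 9. *(Differentiability)* $g$, $f$, $h$ are restrictions to $\mathbb U\times\mathbb Y$, $\mathbb X\times\mathbb U\times\mathbb D$, $\mathbb X\times\mathbb U\times\mathbb D$ of continuously differentiable functions on the whole space, and $f_P,h_P$ are restrictions to $\mathbb X\times\mathbb U\times\mathbb W$ of functions on $\mathbb R^n\times\mathbb R^{n_u}\times\mathbb W$ whose derivative in $(x,u)$ exists and is continuous in $(x,u,w_P)$. **Closed loop.** Let $\Delta x_s(\alpha):=x_{P,s}(\alpha)-x_s(s,d_s(\alpha))$ and $\mathcal A_c(\delta_w):=\{(s,w_P)\in\mathcal A_c:|w_P|\le\delta_w\}$. For $\delta_w,\delta_\alpha>0$, a closed-loop trajectory consists of a prior $(\bar x,\bar d)\in\mathbb X\times\mathbb D$ and sequences of corrected states $x(k)=x_P(k)-\Delta x_s(\alpha(k))$, parameters $\alpha(k)=(s(k),w_P(k))$ and estimates $(\hat x(k),\hat d(k))=\Phi_k(\bar x,\bar d,\mathbf u_{0:k-1},\mathbf y_{0:k-1})$ such that, with $\hat\beta=(s,\hat d)$, $u=\kappa_N(\hat x,\hat\beta)$, $y=h_P(x_P,u,w_P)$,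 one has for all $k\ge0$: $x_P(k)\in\mathbb X$ and $x(k)\in\mathbb X$ (the trajectory stays in the physical state space; no condition if $\mathbb X=\mathbb R^n$); $x_P^+=f_P(x_P,u,w_P)$; $\alpha^+=\alpha+\Delta\alpha$ with $\alpha^+\in\mathcal A_c(\delta_w)$ and $|\Delta\alpha|\le\delta_\alpha$. Let $$\mathcal S_N^{\rho,\tau}:=\{(x,\alpha,\hat x,\hat\beta): x\in\mathbb X,\ \alpha=(s,w_P)\in\mathcal A_c,\ \hat\beta=(s,\hat d)\in\hat{\mathcal B}_c,\ (\hat x,\hat\beta)\in\mathcal S_N,\ V_N^0(\hat x,\hat\beta)\le\rho,\ V_e(x,d_s(\alpha),\hat x,\hat d)\le\tau\}.$$ Put $e:=(x-\hat x,\,d_s(\alpha)-\hat d)$, $\bar e:=(x(0)-\bar x,\,d_s(\alpha(0))-\bar d)$, $\delta\hat x:=\hat x-x_s(\hat\beta)$, $\delta r:=g(u,y)-r_{sp}$. The closed loop is *robustly exponentially stable (RES) on a set $S$ w.r.t. $(\zeta_1,\zeta_2)$* if there are $c>0$, $\lambda\in(0,1)$ and $\sigma\in\mathcal K$ such that every closed-loop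 trajectory with $(x(0),\alpha(0),\bar x,(s(0),\bar d))\in S$ satisfies $$|(\zeta_1(k),e(k))|\le c\lambda^k|(\zeta_2(0),\bar e)|+\sum_{i=0}^k\lambda^i\sigma(|\Delta\alpha(k-i)|)\qquad\text{for all }k\ge0.$$ **Theorem (Offset-free stability).** Under assumptions 1–9, for every $\rho>0$ there exist $\tau,\delta_w,\delta_\alpha>0$ such that: (a) $\mathcal S_N^{\rho,\tau}$ is robustly positive invariant: every closed-loop trajectory with $(x(0),\alpha(0),\bar x,(s(0),\bar d))\in\mathcal S_N^{\rho,\tau}$ satisfies $(x(k),\alpha(k),\hat x(k),\hat\beta(k))\in\mathcal S_N^{\rho,\tau}$ for all $k\ge0$; moreover, if $V_e$ is lower semicontinuous, then $\mathcal S_N^{\rho,\tau}$ is closed; (b) the closed loop is RES on $\mathcal S_N^{\rho,\tau}$ w.r.t. $(\delta\hat x,\delta\hat x)$; (c) the closed loop is RES on $\mathcal S_N^{\rho,\tau}$ w.r.t. $(\delta r,\delta\hat x)$. -/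

import Mathlib

noncomputable section

namespace OffsetFree

/-- `ℝᵏ` with the Euclidean norm. -/
abbrev Vec (k : ℕ) := EuclideanSpace ℝ (Fin k)

/-- Setpoints `s_sp = (r_sp, u_sp, y_sp)`. -/
abbrev Setpoint (nr nu ny : ℕ) := Vec nr × Vec nu × Vec ny

/-- Parameters `β = (s_sp, d)` of the steady-state target problem (SSTP). -/
abbrev Beta (nr nu ny nd : ℕ) := Setpoint nr nu ny × Vec nd

/-- Parameters `α = (s_sp, w_P)` of the plant. -/
abbrev Alpha (nr nu ny nw : ℕ) := Setpoint nr nu ny × Vec nw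

/-- Euclidean norm of `α = ((r, u, y), w)`, seen as one long vector. -/
def alphaNorm {nr nu ny nw : ℕ} (a : Alpha nr nu ny nw) : ℝ :=
  Real.sqrt (‖a.1.1‖ ^ 2 + ‖a.1.2.1‖ ^ 2 + ‖a.1.2.2‖ ^ 2 + ‖a.2‖ ^ 2)

/-- The weighted square `|x|_Q² = xᵀ Q x`. -/
def wsq {k : ℕ} (Q : Matrix (Fin k) (Fin k) ℝ) (x : Vec k) : ℝ :=
  x.ofLp ⬝ᵥ (Q.mulVec x.ofLp)

/-- Comparison functions of class `𝒦` (only the values on `[0, ∞)` matter). -/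
def ClassK (σ : ℝ → ℝ) : Prop :=
  ContinuousOn σ (Set.Ici 0) ∧ StrictMonoOn σ (Set.Ici 0) ∧ σ 0 = 0

end OffsetFree

open OffsetFree

/-- The data of an offset-free MPC loop: plant, model, constraints, costs, the selected solutions of
the two optimization problems, the estimator and its Lyapunov function, and the mismatch
corrections. Functions that are only meaningful on constraint sets are taken as functions on the
whole space; all conditions below concern only their values on these sets. -/
structure OffsetFreeMPC (n nu ny nd nw nr nc : ℕ) where
  /-- physical and input constraint sets -/
  X : Set (Vec n)
  U : Set (Vec nu)
  Y : Set (Vec ny)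
  D : Set (Vec nd)
  W : Set (Vec nw)
  /-- plant `x_P⁺ = f_P(x_P, u, w_P)`, `y = h_P(x_P, u, w_P)` -/
  fP : Vec n → Vec nu → Vec nw → Vec n
  hP : Vec n → Vec nu → Vec nw → Vec ny
  /-- model `x⁺ = f(x, u, d)`, `y = h(x, u, d)` -/
  f : Vec n → Vec nu → Vec nd → Vec n
  h : Vec n → Vec nu → Vec nd → Vec ny
  /-- reference `r = g(u, y)` -/
  g : Vec nu → Vec ny → Vec nr
  /-- soft constraint function `c̄` and back-off constants `b̄` -/
  cbar : Vec nu → Vec ny → Fin nc → ℝ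
  bbar : Fin nc → ℝ
  /-- steady-state cost -/
  ls : Vec nu → Vec ny → ℝ
  /-- selected SSTP solution `z_s(β) = (x_s(β), u_s(β))` -/
  xs : Beta nr nu ny nd → Vec n
  us : Beta nr nu ny nd → Vec nu
  /-- horizon, stage cost, terminal cost, terminal level -/
  N : ℕ
  N_pos : 0 < N
  stage : Vec n → Vec nu → Beta nr nu ny nd → ℝ
  Vf : Vec n → Beta nr nu ny nd → ℝ
  cf : ℝ
  cf_pos : 0 < cf
  /-- selected solution `𝐮⁰(x, β)` of the finite horizon optimal control problem -/
  u0 : Vec n → Beta nr nu ny nd → Fin N → Vec nu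
  /-- estimator functions `Φ_k(x̄, d̄, 𝐮_{0:k-1}, 𝐲_{0:k-1})` -/
  Φ : (k : ℕ) → Vec n → Vec nd → (Fin k → Vec nu) → (Fin k → Vec ny) → Vec n × Vec nd
  /-- Lyapunov function of the estimator, `V_e(x, d, x̂, d̂)` -/
  Ve : Vec n → Vec nd → Vec n → Vec nd → ℝ
  /-- the sets `𝒜_c`, `ℬ_c`, the constant `δ₀` and the functions `x_{P,s}`, `d_s` -/
  Ac : Set (Alpha nr nu ny nw)
  Bc : Set (Beta nr nu ny nd)
  δ₀ : ℝ
  xPs : Alpha nr nu ny nw → Vec n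
  ds : Alpha nr nu ny nw → Vec nd

namespace OffsetFreeMPC

variable {n nu ny nd nw nr nc : ℕ} (P : OffsetFreeMPC n nu ny nd nw nr nc)

/-! ### Continuity and constraints -/

/-- Continuity of plant, model and reference functions, equilibrium at the origin, and nominal
consistency of plant and model. -/
structure ContinuityAssumption : Prop where
  g_cont : ContinuousOn (fun p : Vec nu × Vec ny => P.g p.1 p.2) (P.U ×ˢ P.Y)
  fP_cont : ContinuousOn (fun p : Vec n × Vec nu × Vec nw => P.fP p.1 p.2.1 p.2.2)
    (P.X ×ˢ P.U ×ˢ P.W)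
  hP_cont : ContinuousOn (fun p : Vec n × Vec nu × Vec nw => P.hP p.1 p.2.1 p.2.2)
    (P.X ×ˢ P.U ×ˢ P.W)
  f_cont : ContinuousOn (fun p : Vec n × Vec nu × Vec nd => P.f p.1 p.2.1 p.2.2)
    (P.X ×ˢ P.U ×ˢ P.D)
  h_cont : ContinuousOn (fun p : Vec n × Vec nu × Vec nd => P.h p.1 p.2.1 p.2.2)
    (P.X ×ˢ P.U ×ˢ P.D)
  fP_mem : ∀ x ∈ P.X, ∀ u ∈ P.U, ∀ w ∈ P.W, P.fP x u w ∈ P.X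
  hP_mem : ∀ x ∈ P.X, ∀ u ∈ P.U, ∀ w ∈ P.W, P.hP x u w ∈ P.Y
  f_mem : ∀ x ∈ P.X, ∀ u ∈ P.U, ∀ d ∈ P.D, P.f x u d ∈ P.X
  h_mem : ∀ x ∈ P.X, ∀ u ∈ P.U, ∀ d ∈ P.D, P.h x u d ∈ P.Y
  f_zero : P.f 0 0 0 = 0
  h_zero : P.h 0 0 0 = 0
  g_zero : P.g 0 0 = 0
  nominal_f : ∀ x ∈ P.X, ∀ u ∈ P.U, P.f x u 0 = P.fP x u 0
  nominal_h : ∀ x ∈ P.X, ∀ u ∈ P.U, P.h x u 0 = P.hP x u 0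

structure ConstraintAssumption : Prop where
  X_closed : IsClosed P.X
  Y_closed : IsClosed P.Y
  U_compact : IsCompact P.U
  W_compact : IsCompact P.W
  D_compact : IsCompact P.D
  X_zero : (0 : Vec n) ∈ P.X
  Y_zero : (0 : Vec ny) ∈ P.Y
  U_zero : (0 : Vec nu) ∈ P.U
  W_zero : (0 : Vec nw) ∈ P.W
  D_zero : (0 : Vec nd) ∈ P.D
  cbar_cont : ContinuousOn (fun p : Vec nu × Vec ny => P.cbar p.1 p.2) (P.U ×ˢ P.Y)
  bbar_pos : ∀ i, 0 < P.bbar i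
  backoff : ∀ i, P.cbar 0 0 i + P.bbar i < 0

/-! ### The steady-state target problem -/

/-- Tightened input-output constraints `Z̄_y`. -/
def Zbar : Set (Vec nu × Vec ny) :=
  {p | p.1 ∈ P.U ∧ p.2 ∈ P.Y ∧ ∀ i, P.cbar p.1 p.2 i + P.bbar i ≤ 0}

/-- Offset-free steady-state pairs `𝒵_O(r_sp, d)`. -/
def ZO (r : Vec nr) (d : Vec nd) : Set (Vec n × Vec nu) :=
  {z | z.1 ∈ P.X ∧ z.2 ∈ P.U ∧ z.1 = P.f z.1 z.2 d ∧
    (z.2, P.h z.1 z.2 d) ∈ P.Zbar ∧ r = P.g z.2 (P.h z.1 z.2 d)}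

/-- Feasible SSTP parameters `ℬ`. -/
def B : Set (Beta nr nu ny nd) :=
  {β | β.1.2 ∈ P.Zbar ∧ β.2 ∈ P.D ∧ (P.ZO β.1.1 β.2).Nonempty}

/-- SSTP objective `V_s(x, u, β) = ℓ_s(u - u_sp, h(x, u, d) - y_sp)`. -/
def Vs (z : Vec n × Vec nu) (β : Beta nr nu ny nd) : ℝ :=
  P.ls (z.2 - β.1.2.1) (P.h z.1 z.2 β.2 - β.1.2.2)

structure SSTPExistence : Prop where
  ls_nonneg : ∀ u y, 0 ≤ P.ls u y
  ls_cont : Continuous (fun p : Vec nu × Vec ny => P.ls p.1 p.2)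
  compact_or_coercive : ∀ β ∈ P.B, IsCompact (P.ZO β.1.1 β.2) ∨
    ∀ z : ℕ → Vec n × Vec nu, (∀ k, z k ∈ P.ZO β.1.1 β.2) →
      Filter.Tendsto (fun k => ‖z k‖) Filter.atTop Filter.atTop →
      Filter.Tendsto (fun k => P.Vs (z k) β) Filter.atTop Filter.atTop

/-- `z_s = (x_s, u_s)` selects a solution of the SSTP for every feasible parameter. -/
def IsSSTPSelection : Prop :=
  ∀ β ∈ P.B, (P.xs β, P.us β) ∈ P.ZO β.1.1 β.2 ∧
    ∀ z ∈ P.ZO β.1.1 β.2, P.Vs (P.xs β, P.us β) β ≤ P.Vs z β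

/-! ### The regulator -/

/-- `φ(k; x, 𝐮, d)` for `k ≤ N`. -/
def phi (x : Vec n) (u : Fin P.N → Vec nu) (d : Vec nd) : ℕ → Vec n
  | 0 => x
  | k + 1 => P.f (phi x u d k) (if hk : k < P.N then u ⟨k, hk⟩ else 0) d

/-- Terminal set `𝕏_f(β)`. -/
def Xf (β : Beta nr nu ny nd) : Set (Vec n) := {x | x ∈ P.X ∧ P.Vf x β ≤ P.cf}

/-- Feasible input sequences `𝒰_N(x, β)`. -/
def UN (x : Vec n) (β : Beta nr nu ny nd) : Set (Fin P.N → Vec nu) :=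
  {u | (∀ k, u k ∈ P.U) ∧ P.phi x u β.2 P.N ∈ P.Xf β}

/-- Feasible state-parameter pairs `𝒮_N`. -/
def SN : Set (Vec n × Beta nr nu ny nd) :=
  {p | p.1 ∈ P.X ∧ p.2 ∈ P.B ∧ (P.UN p.1 p.2).Nonempty}

/-- Objective `V_N(x, 𝐮, β)`. -/
def VN (x : Vec n) (u : Fin P.N → Vec nu) (β : Beta nr nu ny nd) : ℝ :=
  P.Vf (P.phi x u β.2 P.N) β + ∑ k : Fin P.N, P.stage (P.phi x u β.2 k) (u k) β

/-- Optimal value `V_N⁰(x, β)`; it is only used for feasible `(x, β) ∈ 𝒮_N`. -/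
def VN0 (x : Vec n) (β : Beta nr nu ny nd) : ℝ :=
  sInf ((fun u => P.VN x u β) '' P.UN x β)

/-- `𝐮⁰` selects a solution of the optimal control problem for every feasible `(x, β)`. -/
def IsFHOCPSelection : Prop :=
  ∀ x β, (x, β) ∈ P.SN → P.u0 x β ∈ P.UN x β ∧
    ∀ u ∈ P.UN x β, P.VN x (P.u0 x β) β ≤ P.VN x u β

/-- MPC control law `κ_N(x, β) = u⁰(0; x, β)`. -/
def kappaN (x : Vec n) (β : Beta nr nu ny nd) : Vec nu := P.u0 x β ⟨0, P.N_pos⟩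

/-- Existence of a terminal control law `κ_f`. -/
def TerminalControlLaw : Prop :=
  ∃ κf : Vec n → Beta nr nu ny nd → Vec nu,
    (∀ x ∈ P.X, ∀ β ∈ P.B, κf x β ∈ P.U) ∧
    ∀ β ∈ P.B, ∀ x ∈ P.Xf β,
      P.Vf (P.f x (κf x β) β.2) β - P.Vf x β ≤ - P.stage x (κf x β) β

/-- `ℬ̂_c`: the parameters of `ℬ_c` with disturbance perturbed by at most `δ₀` inside `𝔻`. -/
def Bhat : Set (Beta nr nu ny nd) :=
  {β | β.2 ∈ P.D ∧ ∃ d, (β.1, d) ∈ P.Bc ∧ ‖d - β.2‖ ≤ P.δ₀}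

/-- Quadratic costs with soft constraint penalties; the terminal weight `P_f` depends continuously
on the parameter. -/
def QuadraticCosts : Prop :=
  ∃ (Q : Matrix (Fin n) (Fin n) ℝ) (R : Matrix (Fin nu) (Fin nu) ℝ)
    (Pf : Beta nr nu ny nd → Matrix (Fin n) (Fin n) ℝ) (w : Fin nc → ℝ),
    Q.PosDef ∧ R.PosDef ∧ (∀ β ∈ P.B, (Pf β).PosDef) ∧ ContinuousOn Pf P.Bhat ∧
    (∀ i, 0 < w i) ∧
    (∀ x ∈ P.X, ∀ u ∈ P.U, ∀ β ∈ P.B, P.stage x u β =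
      wsq Q (x - P.xs β) + wsq R (u - P.us β) +
        ∑ i, w i * max 0 (P.cbar u (P.h x u β.2) i)) ∧
    (∀ x ∈ P.X, ∀ β ∈ P.B, P.Vf x β = wsq (Pf β) (x - P.xs β))

/-! ### The estimator -/

/-- Trajectories of the noisy model `x⁺ = f(x,u,d) + w`, `d⁺ = d + w_d`, `y = h(x,u,d) + v` whose
noise keeps `(x, d, y)` in `𝕏 × 𝔻 × 𝕐`. -/
structure NoisyTrajectory (x : ℕ → Vec n) (u : ℕ → Vec nu) (d : ℕ → Vec nd) (y : ℕ → Vec ny)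
    (w : ℕ → Vec n) (wd : ℕ → Vec nd) (v : ℕ → Vec ny) : Prop where
  x_mem : ∀ k, x k ∈ P.X
  u_mem : ∀ k, u k ∈ P.U
  d_mem : ∀ k, d k ∈ P.D
  y_mem : ∀ k, y k ∈ P.Y
  x_step : ∀ k, x (k + 1) = P.f (x k) (u k) (d k) + w k
  d_step : ∀ k, d (k + 1) = d k + wd k
  y_eq : ∀ k, y k = P.h (x k) (u k) (d k) + v k

/-- The estimates `(x̂(k), d̂(k)) = Φ_k(x̄, d̄, 𝐮_{0:k-1}, 𝐲_{0:k-1})`. -/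
def estimate (xbar : Vec n) (dbar : Vec nd) (u : ℕ → Vec nu) (y : ℕ → Vec ny) (k : ℕ) :
    Vec n × Vec nd :=
  P.Φ k xbar dbar (fun i => u i) (fun i => y i)

/-- The estimator takes values in `𝕏 × 𝔻`, starts as the identity, and has the quadratic
Lyapunov function `V_e`. -/
structure EstimatorStability : Prop where
  Φ_mem : ∀ k, ∀ xbar ∈ P.X, ∀ dbar ∈ P.D, ∀ u : Fin k → Vec nu, (∀ i, u i ∈ P.U) →
    ∀ y : Fin k → Vec ny, (∀ i, y i ∈ P.Y) →
      (P.Φ k xbar dbar u y).1 ∈ P.X ∧ (P.Φ k xbar dbar u y).2 ∈ P.D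
  Φ_zero : ∀ xbar ∈ P.X, ∀ dbar ∈ P.D, ∀ (u : Fin 0 → Vec nu) (y : Fin 0 → Vec ny),
    P.Φ 0 xbar dbar u y = (xbar, dbar)
  Ve_nonneg : ∀ x ∈ P.X, ∀ d ∈ P.D, ∀ x' ∈ P.X, ∀ d' ∈ P.D, 0 ≤ P.Ve x d x' d'
  lyapunov : ∃ c₁ > 0, ∃ c₂ > 0, ∃ c₃ > 0, ∃ c₄ > 0,
    ∀ xbar ∈ P.X, ∀ dbar ∈ P.D, ∀ (x : ℕ → Vec n) (u : ℕ → Vec nu) (d : ℕ → Vec nd)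
      (y : ℕ → Vec ny) (w : ℕ → Vec n) (wd : ℕ → Vec nd) (v : ℕ → Vec ny),
    P.NoisyTrajectory x u d y w wd v →
    ∀ (xh : ℕ → Vec n) (dh : ℕ → Vec nd),
      (∀ k, (xh k, dh k) = P.estimate xbar dbar u y k) → ∀ k,
      c₁ * (‖x k - xh k‖ ^ 2 + ‖d k - dh k‖ ^ 2) ≤ P.Ve (x k) (d k) (xh k) (dh k) ∧
      P.Ve (x k) (d k) (xh k) (dh k) ≤ c₂ * (‖x k - xh k‖ ^ 2 + ‖d k - dh k‖ ^ 2) ∧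
      P.Ve (x (k + 1)) (d (k + 1)) (xh (k + 1)) (dh (k + 1)) ≤
        P.Ve (x k) (d k) (xh k) (dh k) - c₃ * (‖x k - xh k‖ ^ 2 + ‖d k - dh k‖ ^ 2) +
          c₄ * (‖w k‖ ^ 2 + ‖wd k‖ ^ 2 + ‖v k‖ ^ 2)

/-! ### Mismatch corrections -/

/-- `(x', d')` solves the steady-state matching equations of plant and model at `α`; the unknown
`d'` ranges over the disturbances for which the targets `z_s(s_sp, d')` are defined. -/
def SolvesMatching (α : Alpha nr nu ny nw) (x' : Vec n) (d' : Vec nd) : Prop :=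
  x' ∈ P.X ∧ d' ∈ P.D ∧ (α.1, d') ∈ P.B ∧
  x' = P.fP x' (P.us (α.1, d')) α.2 ∧
  P.h (P.xs (α.1, d')) (P.us (α.1, d')) d' = P.hP x' (P.us (α.1, d')) α.2

/-- SSTP regularity and existence of mismatch corrections. (Items `Bhat_subset` and `zs_lipschitz`
contain the SSTP continuity assumption for the same `ℬ_c`, `δ₀`.) -/
structure MismatchCorrections : Prop where
  Ac_compact : IsCompact P.Ac
  Bc_compact : IsCompact P.Bc
  Ac_subset : ∀ α ∈ P.Ac, α.1.2 ∈ P.Zbar ∧ α.2 ∈ P.W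
  Bc_subset : P.Bc ⊆ P.B
  Ac_zero : (0 : Alpha nr nu ny nw) ∈ P.Ac
  Bc_zero : (0 : Beta nr nu ny nd) ∈ P.Bc
  δ₀_pos : 0 < P.δ₀
  xPs_cont : ContinuousOn P.xPs P.Ac
  ds_cont : ContinuousOn P.ds P.Ac
  Bhat_subset : P.Bhat ⊆ P.B
  zs_lipschitz : ∃ L, LipschitzOnWith L (fun β => (P.xs β, P.us β)) P.Bhat
  solves : ∀ α ∈ P.Ac, P.SolvesMatching α (P.xPs α) (P.ds α)
  unique : ∀ α ∈ P.Ac, ∀ x' d', P.SolvesMatching α x' d' → x' = P.xPs α ∧ d' = P.ds α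
  ds_mem : ∀ α ∈ P.Ac, (α.1, P.ds α) ∈ P.Bc
  Ac_nominal : ∀ α ∈ P.Ac, (α.1, (0 : Vec nw)) ∈ P.Ac

/-- `𝒜_c(δ_w)`. -/
def AcSmall (δw : ℝ) : Set (Alpha nr nu ny nw) := {α | α ∈ P.Ac ∧ ‖α.2‖ ≤ δw}

/-- `Δx_s(α) = x_{P,s}(α) - x_s(s_sp, d_s(α))`. -/
def Δxs (α : Alpha nr nu ny nw) : Vec n := P.xPs α - P.xs (α.1, P.ds α)

/-! ### Differentiability

As usual on closed sets, a function is continuously differentiable on such a set when it is the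
restriction of a continuously differentiable function on the whole space. For the plant functions
only the derivative in `(x, u)` is required, and it is continuous in `(x, u, w)`. -/

structure Differentiability : Prop where
  g_diff : ∃ G : Vec nu × Vec ny → Vec nr, ContDiff ℝ 1 G ∧
    ∀ u ∈ P.U, ∀ y ∈ P.Y, G (u, y) = P.g u y
  f_diff : ∃ F : Vec n × Vec nu × Vec nd → Vec n, ContDiff ℝ 1 F ∧
    ∀ x ∈ P.X, ∀ u ∈ P.U, ∀ d ∈ P.D, F (x, u, d) = P.f x u d
  h_diff : ∃ H : Vec n × Vec nu × Vec nd → Vec ny, ContDiff ℝ 1 H ∧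
    ∀ x ∈ P.X, ∀ u ∈ P.U, ∀ d ∈ P.D, H (x, u, d) = P.h x u d
  fP_diff : ∃ F : Vec n × Vec nu → Vec nw → Vec n,
    (∀ w ∈ P.W, Differentiable ℝ (fun z => F z w)) ∧
    ContinuousOn (fun p : (Vec n × Vec nu) × Vec nw => fderiv ℝ (fun z => F z p.2) p.1)
      (Set.univ ×ˢ P.W) ∧
    ∀ x ∈ P.X, ∀ u ∈ P.U, ∀ w ∈ P.W, F (x, u) w = P.fP x u w
  hP_diff : ∃ H : Vec n × Vec nu → Vec nw → Vec ny,
    (∀ w ∈ P.W, Differentiable ℝ (fun z => H z w)) ∧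
    ContinuousOn (fun p : (Vec n × Vec nu) × Vec nw => fderiv ℝ (fun z => H z p.2) p.1)
      (Set.univ ×ˢ P.W) ∧
    ∀ x ∈ P.X, ∀ u ∈ P.U, ∀ w ∈ P.W, H (x, u) w = P.hP x u w

/-! ### The closed loop of plant, estimator and MPC -/

/-- Sequences of the closed loop: corrected model state `x = x_P - Δx_s(α)`, plant parameters
`α = (s_sp, w_P)`, prior guess `(x̄, d̄)` and estimates `(x̂, d̂)`. -/
structure Trajectory (n nu ny nd nw nr : ℕ) where
  x : ℕ → Vec n
  α : ℕ → Alpha nr nu ny nw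
  xbar : Vec n
  dbar : Vec nd
  xh : ℕ → Vec n
  dh : ℕ → Vec nd

/-- Joint states `(x, α, x̂, β̂)`. -/
abbrev JointState (n nu ny nd nw nr : ℕ) :=
  Vec n × Alpha nr nu ny nw × Vec n × Beta nr nu ny nd

variable (T : Trajectory n nu ny nd nw nr)

/-- `β̂(k) = (s_sp(k), d̂(k))`. -/
def betaHat (k : ℕ) : Beta nr nu ny nd := ((T.α k).1, T.dh k)

/-- `u(k) = κ_N(x̂(k), β̂(k))`. -/
def input (k : ℕ) : Vec nu := P.kappaN (T.xh k) (betaHat T k)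

/-- The plant state `x_P(k) = x(k) + Δx_s(α(k))`. -/
def plantState (k : ℕ) : Vec n := T.x k + P.Δxs (T.α k)

/-- `y(k) = h_P(x_P(k), u(k), w_P(k))`. -/
def output (k : ℕ) : Vec ny := P.hP (P.plantState T k) (P.input T k) (T.α k).2

/-- `T` is a trajectory of the closed loop with increments
`Δα(k) ∈ 𝔸_c(α(k), δ_w) ∩ δ_α 𝔹`. The plant state and the corrected model state lie in the state
space `𝕏` (for the former this is a condition at time `0` only, and for `𝕏 = ℝⁿ` no condition). -/
structure IsClosedLoop (δw δα : ℝ) : Prop where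
  xbar_mem : T.xbar ∈ P.X
  dbar_mem : T.dbar ∈ P.D
  x_mem : ∀ k, T.x k ∈ P.X
  plant_mem : ∀ k, P.plantState T k ∈ P.X
  x_step : ∀ k, T.x (k + 1) =
    P.fP (P.plantState T k) (P.input T k) (T.α k).2 - P.Δxs (T.α (k + 1))
  α_mem : ∀ k, T.α (k + 1) ∈ P.AcSmall δw
  α_step : ∀ k, alphaNorm (T.α (k + 1) - T.α k) ≤ δα
  est : ∀ k, (T.xh k, T.dh k) = P.estimate T.xbar T.dbar (P.input T) (P.output T) k

/-- Initial condition of the joint system: true initial state and prior guess. -/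
def initState : JointState n nu ny nd nw nr := (T.x 0, T.α 0, T.xbar, ((T.α 0).1, T.dbar))

/-- Joint state at time `k`. -/
def stateAt (k : ℕ) : JointState n nu ny nd nw nr := (T.x k, T.α k, T.xh k, betaHat T k)

/-- Every closed-loop trajectory that starts in `S` stays in `S`. -/
def StaysIn (δw δα : ℝ) (S : Set (JointState n nu ny nd nw nr)) : Prop :=
  ∀ T : Trajectory n nu ny nd nw nr, P.IsClosedLoop T δw δα → initState T ∈ S →
    ∀ k, stateAt T k ∈ S

/-- Robust positive invariance of a closed set for the joint system. -/
def IsRPI (δw δα : ℝ) (S : Set (JointState n nu ny nd nw nr)) : Prop :=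
  IsClosed S ∧ P.StaysIn δw δα S

/-- Robust exponential stability on `S` with respect to two outputs `(ζ₁, ζ₂)`:
`|(ζ₁(k), ε(k))| ≤ c λᵏ |(ζ₂(0), ε̄)| + ∑_{i ≤ k} λⁱ σ(|Δα(k - i)|)`, where
`ε = (x - x̂, d_s(α) - d̂)` is the estimate error and `ε̄` is the error of the prior guess. -/
def IsRES (δw δα : ℝ) (S : Set (JointState n nu ny nd nw nr)) {p q : ℕ}
    (ζ₁ : Trajectory n nu ny nd nw nr → ℕ → Vec p)
    (ζ₂ : Trajectory n nu ny nd nw nr → ℕ → Vec q) : Prop :=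
  ∃ c > 0, ∃ lam ∈ Set.Ioo (0 : ℝ) 1, ∃ σ : ℝ → ℝ, ClassK σ ∧
    ∀ T : Trajectory n nu ny nd nw nr, P.IsClosedLoop T δw δα → initState T ∈ S → ∀ k,
      Real.sqrt (‖ζ₁ T k‖ ^ 2 + ‖T.x k - T.xh k‖ ^ 2 + ‖P.ds (T.α k) - T.dh k‖ ^ 2) ≤
        c * lam ^ k *
          Real.sqrt (‖ζ₂ T 0‖ ^ 2 + ‖T.x 0 - T.xbar‖ ^ 2 + ‖P.ds (T.α 0) - T.dbar‖ ^ 2) +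
        ∑ i ∈ Finset.range (k + 1),
          lam ^ i * σ (alphaNorm (T.α (k - i + 1) - T.α (k - i)))

/-- Target-tracking error `δx̂ = x̂ - x_s(β̂)`. -/
def targetError (k : ℕ) : Vec n := T.xh k - P.xs (betaHat T k)

/-- Setpoint-tracking error `δr = r - r_sp`, `r = g(u, y)`. -/
def setpointError (k : ℕ) : Vec nr := P.g (P.input T k) (P.output T k) - (T.α k).1.1

/-- `Ŝ_N^ρ`: feasible pairs with `β̂ ∈ ℬ̂_c` and `V_N⁰(x̂, β̂) ≤ ρ`. -/
def ShatN (ρ : ℝ) : Set (Vec n × Beta nr nu ny nd) :=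
  {p | p ∈ P.SN ∧ p.2 ∈ P.Bhat ∧ P.VN0 p.1 p.2 ≤ ρ}

/-- `S_N^{ρ,τ}`. -/
def SNset (ρ τ : ℝ) : Set (JointState n nu ny nd nw nr) :=
  {q | q.1 ∈ P.X ∧ q.2.1 ∈ P.Ac ∧ (q.2.2.1, q.2.2.2) ∈ P.ShatN ρ ∧ q.2.2.2.1 = q.2.1.1 ∧
    P.Ve q.1 (P.ds q.2.1) q.2.2.1 q.2.2.2.2 ≤ τ}

/-- `V_e` is lower semicontinuous on `𝕏 × 𝔻 × 𝕏 × 𝔻`. -/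
def VeLowerSemicontinuous : Prop :=
  LowerSemicontinuousOn (fun p : Vec n × Vec nd × Vec n × Vec nd => P.Ve p.1 p.2.1 p.2.2.1 p.2.2.2)
    (P.X ×ˢ P.D ×ˢ P.X ×ˢ P.D)

end OffsetFreeMPC

end

noncomputable section

namespace OffsetFree

/-! ### Comparison functions -/

/-! The function `V = V_N⁰(x̂, β̂) + M V_e`, with a large constant `M`, is a Lyapunov function of
the joint system: it is squeezed between multiples of `|δx̂|² + |e|²` and satisfies `V⁺ ≤ γ V + C
σ(|Δα|)²` with `γ < 1` (`exists_lyapunov`). Taking square roots and iterating yields both RES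
estimates (`isRES_of_lyapunov`). For the second one, `|δr|²` is at most a multiple of `|δx̂|² +
|e|²`, because `g(u_s, y_s) = r_sp` at the target (`exists_setpoint_bound`).

Estimator. In the corrected coordinate `x = x_P - Δx_s(α)` the closed loop is a noisy model
trajectory with disturbance `d_s(α)`. The matching equations make the plant-model mismatch vanish at
the target, and nominal consistency makes its Lipschitz constant in `(x, u)` tend to zero with `w_P`
(`exists_small_increment`, `exists_mismatch_bound`). Hence the noise is at most `ε(|δx̂| + |e|)`
plus a modulus of `|Δα|`, and `V_e` decreases up to a term `ε|δx̂|²` and the modulus squared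
(`exists_VeAt_decrease`).

Regulator. The shifted input sequence (`exists_shift`) is a candidate at the predicted state; the
actual next estimate differs from this state by some `p` controlled by the estimate errors, the
noise and the modulus. Such a shift changes the cost by a small relative error plus `C p²`
(`exists_VN_perturbation`). For the quadratic terms this is Young's inequality. The penalties are
merely continuous in the constraints, but the back-off makes them vanish near the target, and away
from it the stage cost is bounded below (`exists_penalty_perturbation`). The terminal constraint
survives because the terminal cost contracts by a fixed factor `θ < 1`. Thus `V_N⁰` drops by a
multiple of `|δx̂|²`, up to `C(|e|² + σ²)` (`exists_value_decrease`).

The two decreases form a small-gain pair: `M` is chosen so that `V_e` pays for the `|e|²` term, and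
then `w_P` so small that `M ε` takes at most half of the decrease in `|δx̂|²`. The same estimates
keep the levels `ρ` and `τ` invariant. -/

theorem ClassK.nonneg {σ : ℝ → ℝ} (hσ : ClassK σ) {t : ℝ} (ht : 0 ≤ t) : 0 ≤ σ t := by
  have := hσ.2.1.monotoneOn (Set.mem_Ici.2 le_rfl) (Set.mem_Ici.2 ht) ht
  rwa [hσ.2.2] at this

theorem ClassK.mono {σ : ℝ → ℝ} (hσ : ClassK σ) {s t : ℝ} (hs : 0 ≤ s) (hst : s ≤ t) :
    σ s ≤ σ t :=
  hσ.2.1.monotoneOn (Set.mem_Ici.2 hs) (Set.mem_Ici.2 (hs.trans hst)) hst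

theorem ClassK.const_mul {σ : ℝ → ℝ} (hσ : ClassK σ) {c : ℝ} (hc : 0 < c) :
    ClassK (fun t => c * σ t) :=
  ⟨continuousOn_const.mul hσ.1, fun _ ha _ hb hab => mul_lt_mul_of_pos_left (hσ.2.1 ha hb hab) hc,
    by simp [hσ.2.2]⟩

theorem ClassK.exists_le {σ : ℝ → ℝ} (hσ : ClassK σ) {ε : ℝ} (hε : 0 < ε) :
    ∃ δ > 0, ∀ t, 0 ≤ t → t ≤ δ → σ t ≤ ε := by
  have h := Metric.continuousWithinAt_iff.1 (hσ.1 0 (Set.mem_Ici.2 le_rfl)) ε hε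
  obtain ⟨δ, hδ, h⟩ := h
  refine ⟨δ / 2, by positivity, fun t ht htδ => ?_⟩
  have := h (Set.mem_Ici.2 ht) (by rw [Real.dist_eq, sub_zero, abs_of_nonneg ht]; linarith)
  rw [hσ.2.2, Real.dist_eq, sub_zero] at this
  exact (le_abs_self _).trans this.le

/-- The identity plus an infimum of affine functions with nonnegative slopes and arbitrarily small
positive values at zero is of class `𝒦`. -/
theorem classK_iInf_affine {K : ℕ → ℝ} (hK : ∀ n, 0 ≤ K n) :
    ClassK (fun t => t + ⨅ n : ℕ, (1 / ((n : ℝ) + 1) + K n * t)) := by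
  set φ : ℝ → ℝ := fun t => ⨅ n : ℕ, (1 / ((n : ℝ) + 1) + K n * t) with hφ
  have hbdd : ∀ t, 0 ≤ t → BddBelow (Set.range fun n : ℕ => 1 / ((n : ℝ) + 1) + K n * t) :=
    fun t ht => ⟨0, by
      rintro _ ⟨n, rfl⟩
      have := mul_nonneg (hK n) ht
      positivity⟩
  have hle : ∀ t, 0 ≤ t → ∀ n : ℕ, φ t ≤ 1 / ((n : ℝ) + 1) + K n * t :=
    fun t ht n => ciInf_le (hbdd t ht) n
  have hnn : ∀ t, 0 ≤ t → 0 ≤ φ t := fun t ht => le_ciInf fun n => by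
    have := mul_nonneg (hK n) ht
    positivity
  have hmono : ∀ s t, 0 ≤ s → s ≤ t → φ s ≤ φ t := fun s t hs hst => le_ciInf fun n =>
    (hle s hs n).trans (by have := mul_le_mul_of_nonneg_left hst (hK n); linarith)
  have hsmall : ∀ ε > 0, ∃ δ > 0, ∀ t, 0 ≤ t → t < δ → φ t < ε := by
    intro ε hε
    obtain ⟨n, hn⟩ := exists_nat_one_div_lt (half_pos hε)
    have hp : 0 < K n + 1 := by linarith [hK n]
    refine ⟨ε / 2 / (K n + 1), by positivity, fun t ht htd => (hle t ht n).trans_lt ?_⟩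
    have h1 : (K n + 1) * t < ε / 2 := by rwa [lt_div_iff₀ hp, mul_comm] at htd
    nlinarith
  have h0 : φ 0 = 0 := by
    refine le_antisymm (le_of_forall_pos_le_add fun ε hε => ?_) (hnn 0 le_rfl)
    obtain ⟨δ, hδ, h⟩ := hsmall ε hε
    linarith [h 0 le_rfl hδ]
  -- Concavity supplies continuity at positive arguments; at zero it comes from the intercepts,
  -- which tend to zero.
  have hconc : ConcaveOn ℝ (Set.Ici 0) φ := by
    refine ⟨convex_Ici 0, fun x hx y hy a b ha hb hab => le_ciInf fun n => ?_⟩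
    have h1 := mul_le_mul_of_nonneg_left (hle x hx n) ha
    have h2 := mul_le_mul_of_nonneg_left (hle y hy n) hb
    simp only [smul_eq_mul]
    have h3 : 1 / ((n : ℝ) + 1) = (a + b) * (1 / ((n : ℝ) + 1)) := by rw [hab, one_mul]
    rw [h3]
    linarith
  refine ⟨continuousOn_id.add ?_, ?_, ?_⟩
  · intro t ht
    rcases eq_or_lt_of_le (Set.mem_Ici.1 ht) with rfl | ht
    · rw [Metric.continuousWithinAt_iff]
      intro ε hε
      obtain ⟨δ, hδ, h⟩ := hsmall ε hε
      refine ⟨δ, hδ, fun {t} ht htd => ?_⟩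
      have ht' : 0 ≤ t := ht
      rw [Real.dist_eq, sub_zero, abs_of_nonneg ht'] at htd
      change dist (φ t) (φ 0) < ε
      rw [h0, Real.dist_eq, sub_zero, abs_of_nonneg (hnn t ht')]
      exact h t ht' htd
    · have := hconc.continuousOn_interior
      rw [interior_Ici] at this
      exact (this.continuousAt (Ioi_mem_nhds ht)).continuousWithinAt
  · intro a ha b hb hab
    exact add_lt_add_of_lt_of_le hab (hmono a b ha hab.le)
  · change 0 + φ 0 = 0
    rw [h0, add_zero]

/-- Uniform continuity at tolerance `1/(n+1)` gives `δ n`, and the affine function with this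
intercept and slope `|M| / δ n` dominates all increments: the intercept covers distances below `δ
n`, and beyond them the slope already exceeds the diameter bound. The infimum over `n` still
dominates. -/
theorem exists_classK_modulus {E F : Type*} [PseudoMetricSpace E] [PseudoMetricSpace F]
    {f : E → F} {K : Set E} (hK : IsCompact K) (hf : ContinuousOn f K) :
    ∃ σ, ClassK σ ∧ ∀ a ∈ K, ∀ b ∈ K, dist (f a) (f b) ≤ σ (dist a b) := by
  obtain ⟨M, hM⟩ := Metric.isBounded_iff.1 (hK.image_of_continuousOn hf).isBounded
  have hM' : ∀ a ∈ K, ∀ b ∈ K, dist (f a) (f b) ≤ M := fun a ha b hb =>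
    hM (Set.mem_image_of_mem f ha) (Set.mem_image_of_mem f hb)
  have huc := Metric.uniformContinuousOn_iff.1 (hK.uniformContinuousOn_of_continuous hf)
  choose δ hδ h using fun n : ℕ => huc (1 / ((n : ℝ) + 1)) (by positivity)
  have hKn : ∀ n, 0 ≤ |M| / δ n := fun n => div_nonneg (abs_nonneg _) (hδ n).le
  refine ⟨_, classK_iInf_affine hKn, fun a ha b hb => ?_⟩
  refine le_add_of_nonneg_of_le dist_nonneg (le_ciInf fun n => ?_)
  by_cases hd : dist a b < δ n
  · have h1 := (h n a ha b hb hd).le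
    have h2 := mul_nonneg (hKn n) (dist_nonneg (x := a) (y := b))
    linarith
  · have h1 : |M| ≤ |M| / δ n * dist a b := by
      rw [div_mul_eq_mul_div, le_div_iff₀ (hδ n)]
      exact mul_le_mul_of_nonneg_left (not_lt.1 hd) (abs_nonneg _)
    have h2 : (0 : ℝ) ≤ 1 / ((n : ℝ) + 1) := by positivity
    linarith [hM' a ha b hb, le_abs_self M]

/-! ### Iteration of a perturbed contraction. -/

/-- Since `√(γW + b²) ≤ √γ √W + b`, the square root obeys a linear recursion, which is then
unrolled. -/
theorem sqrt_le_of_contraction {W b : ℕ → ℝ} {γ : ℝ} (hγ : 0 < γ) (hW : ∀ k, 0 ≤ W k)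
    (hb : ∀ k, 0 ≤ b k) (h : ∀ k, W (k + 1) ≤ γ * W k + b k ^ 2) (k : ℕ) :
    √(W k) ≤ √γ ^ k * √(W 0) + ∑ i ∈ Finset.range (k + 1), √γ ^ i * (b (k - i) / √γ) := by
  have hμ : 0 < √γ := Real.sqrt_pos.2 hγ
  -- The stronger claim includes the current `b k`, which `W k` does not involve yet: one factor
  -- `√γ` turns `b k / √γ` into exactly the `b k` entering `W (k + 1)`.
  suffices hs : √(W k) + b k / √γ ≤
      √γ ^ k * √(W 0) + ∑ i ∈ Finset.range (k + 1), √γ ^ i * (b (k - i) / √γ) by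
    have := div_nonneg (hb k) hμ.le
    linarith
  induction k with
  | zero => simp
  | succ k ih =>
    have h1 : √(W (k + 1)) ≤ √γ * √(W k) + b k := by
      apply Real.sqrt_le_iff.2
      refine ⟨add_nonneg (by positivity) (hb k), (h k).trans ?_⟩
      have h2 : 0 ≤ √γ * √(W k) * b k := mul_nonneg (by positivity) (hb k)
      nlinarith [Real.sq_sqrt hγ.le, Real.sq_sqrt (hW k), mul_pow (√γ) (√(W k)) 2]
    rw [Finset.sum_range_succ']
    have h3 : ∑ i ∈ Finset.range (k + 1), √γ ^ (i + 1) * (b (k + 1 - (i + 1)) / √γ) =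
        √γ * ∑ i ∈ Finset.range (k + 1), √γ ^ i * (b (k - i) / √γ) := by
      rw [Finset.mul_sum]
      refine Finset.sum_congr rfl fun i _ => ?_
      rw [Nat.add_sub_add_right]
      ring
    have h4 : √γ * (√(W k) + b k / √γ) = √γ * √(W k) + b k := by
      field_simp
    have h5 := mul_le_mul_of_nonneg_left ih hμ.le
    rw [h3]
    simp only [pow_zero, one_mul, Nat.sub_zero]
    rw [pow_succ]
    linarith

/-! ### Weighted squares -/

theorem wsq_eq_sum {k : ℕ} (M : Matrix (Fin k) (Fin k) ℝ) (z : Vec k) :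
    wsq M z = ∑ i, z i * ∑ j, M i j * z j := rfl

theorem wsq_smul {k : ℕ} (M : Matrix (Fin k) (Fin k) ℝ) (c : ℝ) (z : Vec k) :
    wsq M (c • z) = c ^ 2 * wsq M z := by
  simp only [wsq, WithLp.ofLp_smul, Matrix.mulVec_smul, dotProduct_smul, smul_dotProduct,
    smul_eq_mul]
  ring

theorem wsq_nonneg {k : ℕ} {M : Matrix (Fin k) (Fin k) ℝ} (hM : M.PosDef) (z : Vec k) :
    0 ≤ wsq M z := by
  simpa [wsq] using hM.posSemidef.dotProduct_mulVec_nonneg z.ofLp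

theorem wsq_pos {k : ℕ} {M : Matrix (Fin k) (Fin k) ℝ} (hM : M.PosDef) {z : Vec k} (hz : z ≠ 0) :
    0 < wsq M z := by
  have : z.ofLp ≠ 0 := fun h => hz (by ext i; simp [h])
  simpa [wsq] using hM.dotProduct_mulVec_pos this

/-- Young's inequality; the gap between the two sides is `1/ε` times the weighted square of `ε a -
b`. -/
theorem wsq_add_le {k : ℕ} {M : Matrix (Fin k) (Fin k) ℝ} (hM : M.PosDef) {ε : ℝ} (hε : 0 < ε)
    (a b : Vec k) : wsq M (a + b) ≤ (1 + ε) * wsq M a + (1 + 1 / ε) * wsq M b := by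
  have h := wsq_nonneg hM (ε • a - b)
  have key : wsq M (a + b) =
      (1 + ε) * wsq M a + (1 + 1 / ε) * wsq M b - 1 / ε * wsq M (ε • a - b) := by
    simp only [wsq, WithLp.ofLp_add, WithLp.ofLp_sub, WithLp.ofLp_smul, Matrix.mulVec_add,
      Matrix.mulVec_sub, Matrix.mulVec_smul, dotProduct_smul, smul_dotProduct, smul_eq_mul,
      add_dotProduct, dotProduct_add, sub_dotProduct, dotProduct_sub]
    field_simp
    ring
  have : 0 ≤ 1 / ε * wsq M (ε • a - b) := by positivity
  linarith

theorem continuousOn_wsq {ι : Type*} [TopologicalSpace ι] {k : ℕ} {K : Set ι}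
    {M : ι → Matrix (Fin k) (Fin k) ℝ} (hM : ContinuousOn M K) {z : ι → Vec k}
    (hz : ContinuousOn z K) : ContinuousOn (fun b => wsq (M b) (z b)) K := by
  simp only [wsq_eq_sum]
  have hz' : ∀ i, ContinuousOn (fun b => z b i) K := fun i =>
    (EuclideanSpace.proj (𝕜 := ℝ) i).continuous.comp_continuousOn hz
  have hM' : ∀ i j, ContinuousOn (fun b => M b i j) K := fun i j =>
    (continuous_apply_apply i j).comp_continuousOn hM
  exact continuousOn_finsetSum _ fun i _ => (hz' i).mul
    (continuousOn_finsetSum _ fun j _ => (hM' i j).mul (hz' j))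

/-- By homogeneity it suffices to take extreme values on the compact set `K × sphere`. -/
theorem exists_wsq_bounds {ι : Type*} [TopologicalSpace ι] {k : ℕ} {K : Set ι} (hK : IsCompact K)
    {M : ι → Matrix (Fin k) (Fin k) ℝ} (hM : ContinuousOn M K) (hpos : ∀ b ∈ K, (M b).PosDef) :
    ∃ l > 0, ∃ L > 0, ∀ b ∈ K, ∀ z : Vec k, l * ‖z‖ ^ 2 ≤ wsq (M b) z ∧
      wsq (M b) z ≤ L * ‖z‖ ^ 2 := by
  have hc : ContinuousOn (fun p : ι × Vec k => wsq (M p.1) p.2)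
      (K ×ˢ Metric.sphere (0 : Vec k) 1) :=
    continuousOn_wsq (hM.comp continuousOn_fst fun p hp => hp.1) continuousOn_snd
  have hcp : IsCompact (K ×ˢ Metric.sphere (0 : Vec k) 1) := hK.prod (isCompact_sphere 0 1)
  have hl : ∃ l > 0, ∀ b ∈ K, ∀ z : Vec k, ‖z‖ = 1 → l ≤ wsq (M b) z := by
    rcases (K ×ˢ Metric.sphere (0 : Vec k) 1).eq_empty_or_nonempty with he | hne
    · refine ⟨1, one_pos, fun b hb z hz => ?_⟩
      have : (b, z) ∈ K ×ˢ Metric.sphere (0 : Vec k) 1 := ⟨hb, by simpa using hz⟩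
      rw [he] at this
      exact this.elim
    · obtain ⟨p, hp, hmin⟩ := hcp.exists_isMinOn hne hc
      refine ⟨_, wsq_pos (hpos p.1 hp.1) (z := p.2) ?_, fun b hb z hz =>
        hmin (a := (b, z)) ⟨hb, by simpa using hz⟩⟩
      intro h0
      have := hp.2
      simp [h0] at this
  obtain ⟨l, hl0, hl⟩ := hl
  obtain ⟨L, hL⟩ := hcp.exists_bound_of_continuousOn hc
  have hL' : ∀ b ∈ K, ∀ z : Vec k, ‖z‖ = 1 → wsq (M b) z ≤ |L| + 1 := fun b hb z hz => by
    have := hL (b, z) ⟨hb, by simpa using hz⟩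
    rw [Real.norm_eq_abs] at this
    linarith [le_abs_self (wsq (M b) z), le_abs_self L]
  refine ⟨l, hl0, |L| + 1, by positivity, fun b hb z => ?_⟩
  rcases eq_or_ne z 0 with rfl | hz
  · simp [wsq]
  · have hn : 0 < ‖z‖ := norm_pos_iff.2 hz
    have hz1 : ‖(‖z‖⁻¹ • z)‖ = 1 := by rw [norm_smul, norm_inv, norm_norm]; field_simp
    have heq : wsq (M b) z = ‖z‖ ^ 2 * wsq (M b) (‖z‖⁻¹ • z) := by
      rw [wsq_smul]
      field_simp
    rw [heq]
    constructor
    · nlinarith [hl b hb _ hz1, sq_nonneg ‖z‖]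
    · nlinarith [hL' b hb _ hz1, sq_nonneg ‖z‖]

/-- On the unit sphere the forms are at least `l`, so an additive error `ε * l` from uniform
continuity is a relative error `ε`. -/
theorem exists_wsq_le_of_dist_lt {ι : Type*} [PseudoMetricSpace ι] {k : ℕ} {K : Set ι}
    (hK : IsCompact K) {M : ι → Matrix (Fin k) (Fin k) ℝ} (hM : ContinuousOn M K)
    (hpos : ∀ b ∈ K, (M b).PosDef) {ε : ℝ} (hε : 0 < ε) :
    ∃ δ > 0, ∀ b ∈ K, ∀ b' ∈ K, dist b b' ≤ δ → ∀ z : Vec k,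
      wsq (M b') z ≤ (1 + ε) * wsq (M b) z := by
  obtain ⟨l, hl, L, -, hlL⟩ := exists_wsq_bounds hK hM hpos
  have hc : ContinuousOn (fun p : ι × Vec k => wsq (M p.1) p.2)
      (K ×ˢ Metric.sphere (0 : Vec k) 1) :=
    continuousOn_wsq (hM.comp continuousOn_fst fun p hp => hp.1) continuousOn_snd
  have hcp : IsCompact (K ×ˢ Metric.sphere (0 : Vec k) 1) := hK.prod (isCompact_sphere 0 1)
  obtain ⟨δ, hδ, h⟩ := Metric.uniformContinuousOn_iff.1
    (hcp.uniformContinuousOn_of_continuous hc) (ε * l) (by positivity)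
  refine ⟨δ / 2, by positivity, fun b hb b' hb' hbb z => ?_⟩
  rcases eq_or_ne z 0 with rfl | hz
  · simp [wsq]
  · have hn : 0 < ‖z‖ := norm_pos_iff.2 hz
    have hz1 : ‖(‖z‖⁻¹ • z)‖ = 1 := by rw [norm_smul, norm_inv, norm_norm]; field_simp
    have heq : ∀ c, wsq (M c) z = ‖z‖ ^ 2 * wsq (M c) (‖z‖⁻¹ • z) := fun c => by
      rw [wsq_smul]
      field_simp
    have h1 := h (b, ‖z‖⁻¹ • z) ⟨hb, by simpa using hz1⟩ (b', ‖z‖⁻¹ • z) ⟨hb', by simpa using hz1⟩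
      (by rw [Prod.dist_eq, dist_self]; exact max_lt (by linarith) hδ)
    rw [Real.dist_eq] at h1
    have h2 := (hlL b hb (‖z‖⁻¹ • z)).1
    rw [hz1] at h2
    have h3 := (abs_lt.1 h1).1
    rw [heq b, heq b', mul_left_comm]
    refine mul_le_mul_of_nonneg_left ?_ (sq_nonneg _)
    nlinarith

/-! ### Differentiable functions on bounded sets -/

theorem exists_lipschitz_of_contDiff {E G : Type*} [NormedAddCommGroup E] [NormedSpace ℝ E]
    [ProperSpace E] [NormedAddCommGroup G] [NormedSpace ℝ G] {F : E → G} (hF : ContDiff ℝ 1 F)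
    (R : ℝ) : ∃ L > 0, ∀ z z', ‖z‖ ≤ R → ‖z'‖ ≤ R → ‖F z - F z'‖ ≤ L * ‖z - z'‖ := by
  obtain ⟨L, hL⟩ := (hF.locallyLipschitz.locallyLipschitzOn
    (s := Metric.closedBall 0 R)).exists_lipschitzOnWith_of_compact (isCompact_closedBall 0 R)
  refine ⟨L + 1, by positivity, fun z z' hz hz' => ?_⟩
  have := hL.dist_le_mul z (by simpa using hz) z' (by simpa using hz')
  rw [dist_eq_norm, dist_eq_norm] at this
  linarith [norm_nonneg (z - z')]

/-- Mean value inequality for `z ↦ F (z + D) w - F z 0`: its derivative is a difference of values of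
one uniformly continuous map at nearby points. No derivative in `w` is needed. -/
theorem exists_small_increment {E V G : Type*} [NormedAddCommGroup E] [NormedSpace ℝ E]
    [ProperSpace E] [NormedAddCommGroup V] [NormedAddCommGroup G] [NormedSpace ℝ G]
    {F : E → V → G} {W : Set V} (hW : IsCompact W) (h0 : 0 ∈ W)
    (hd : ∀ w ∈ W, Differentiable ℝ (fun z => F z w))
    (hc : ContinuousOn (fun p : E × V => fderiv ℝ (fun z => F z p.2) p.1) (Set.univ ×ˢ W))
    (R : ℝ) {ε : ℝ} (hε : 0 < ε) :
    ∃ δ > 0, ∀ w ∈ W, ‖w‖ ≤ δ → ∀ D : E, ‖D‖ ≤ δ → ∀ z z', ‖z‖ ≤ R → ‖z'‖ ≤ R →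
      ‖(F (z + D) w - F z 0) - (F (z' + D) w - F z' 0)‖ ≤ ε * ‖z - z'‖ := by
  have hcp : IsCompact (Metric.closedBall (0 : E) (R + 1) ×ˢ W) :=
    (isCompact_closedBall 0 (R + 1)).prod hW
  obtain ⟨δ, hδ, h⟩ := Metric.uniformContinuousOn_iff.1 (hcp.uniformContinuousOn_of_continuous
    (hc.mono (Set.prod_mono (Set.subset_univ _) subset_rfl))) ε hε
  -- The cap `1` keeps `z + D` inside the ball of radius `R + 1` on which uniform continuity was
  -- taken.
  refine ⟨min (δ / 2) 1, by positivity, fun w hw hwδ D hD z z' hz hz' => ?_⟩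
  have hder : ∀ x ∈ Metric.closedBall (0 : E) R,
      HasFDerivWithinAt (fun z => F (z + D) w - F z 0)
        (fderiv ℝ (fun z => F z w) (x + D) - fderiv ℝ (fun z => F z 0) x)
        (Metric.closedBall (0 : E) R) x := fun x _ => by
    have h1 : HasFDerivAt (fun z => F (z + D) w) (fderiv ℝ (fun z => F z w) (x + D)) x := by
      have := ((hd w hw) (x + D)).hasFDerivAt.comp x ((hasFDerivAt_id x).add_const D)
      rwa [ContinuousLinearMap.comp_id] at this
    exact (h1.sub ((hd 0 h0) x).hasFDerivAt).hasFDerivWithinAt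
  refine (convex_closedBall (0 : E) R).norm_image_sub_le_of_norm_hasFDerivWithin_le hder
    (fun x hx => ?_) (by simpa using hz') (by simpa using hz)
  have hx' : ‖x‖ ≤ R := by simpa using hx
  have h2 := h (x + D, w) ⟨by
      have := norm_add_le x D
      have h3 := hD.trans (min_le_right _ _)
      simpa using (by linarith : ‖x + D‖ ≤ R + 1), hw⟩ (x, 0)
    ⟨by simpa using (by linarith : ‖x‖ ≤ R + 1), h0⟩ (by
      rw [Prod.dist_eq, dist_eq_norm, dist_eq_norm, add_sub_cancel_left, sub_zero]
      exact max_lt (by linarith [hD.trans (min_le_left _ _)])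
        (by linarith [hwδ.trans (min_le_left _ _)]))
  rw [dist_eq_norm] at h2
  exact h2.le

theorem exists_small_increment_of_contDiff {E₁ E₂ V G : Type*} [NormedAddCommGroup E₁]
    [NormedSpace ℝ E₁] [ProperSpace E₁] [NormedAddCommGroup E₂] [NormedSpace ℝ E₂] [ProperSpace E₂]
    [NormedAddCommGroup V] [NormedSpace ℝ V] [NormedAddCommGroup G] [NormedSpace ℝ G]
    {F : E₁ × E₂ × V → G} (hF : ContDiff ℝ 1 F) {W : Set V} (hW : IsCompact W) (h0 : 0 ∈ W)
    (R : ℝ) {ε : ℝ} (hε : 0 < ε) :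
    ∃ δ > 0, ∀ w ∈ W, ‖w‖ ≤ δ → ∀ z z' : E₁ × E₂, ‖z‖ ≤ R → ‖z'‖ ≤ R →
      ‖(F (z.1, z.2, w) - F (z.1, z.2, 0)) - (F (z'.1, z'.2, w) - F (z'.1, z'.2, 0))‖ ≤
        ε * ‖z - z'‖ := by
  have h1 : ∀ w ∈ W, Differentiable ℝ (fun z : E₁ × E₂ => F (z.1, z.2, w)) := fun w _ =>
    (hF.differentiable one_ne_zero).comp (by fun_prop)
  have h2 : ContDiff ℝ 0
      (fun p : (E₁ × E₂) × V => fderiv ℝ (fun z : E₁ × E₂ => F (z.1, z.2, p.2)) p.1) :=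
    ContDiff.fderiv (m := 1) (f := fun (p : (E₁ × E₂) × V) (z : E₁ × E₂) => F (z.1, z.2, p.2))
      (hF.comp (by fun_prop)) contDiff_fst (by simp)
  obtain ⟨δ, hδ, h⟩ := exists_small_increment (F := fun (z : E₁ × E₂) w => F (z.1, z.2, w)) hW h0 h1
    h2.continuous.continuousOn R hε
  refine ⟨δ, hδ, fun w hw hwδ z z' hz hz' => ?_⟩
  simpa using h w hw hwδ 0 (by simpa using hδ.le) z z' hz hz'

end OffsetFree
end

noncomputable section

open OffsetFree

namespace OffsetFreeMPC

variable {n nu ny nd nw nr nc : ℕ} {P : OffsetFreeMPC n nu ny nd nw nr nc}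

/-- All the assumptions on the loop. -/
structure Assumptions (P : OffsetFreeMPC n nu ny nd nw nr nc) : Prop where
  cont : P.ContinuityAssumption
  cons : P.ConstraintAssumption
  target : P.IsSSTPSelection
  term : P.TerminalControlLaw
  quad : P.QuadraticCosts
  fhocp : P.IsFHOCPSelection
  est : P.EstimatorStability
  mis : P.MismatchCorrections
  diff : P.Differentiability

/-! ### Targets and the set `ℬ̂_c` -/

theorem snd_mem_D {β : Beta nr nu ny nd} (hβ : β ∈ P.B) : β.2 ∈ P.D := hβ.2.1

theorem Assumptions.xs_mem (H : P.Assumptions) {β : Beta nr nu ny nd} (hβ : β ∈ P.B) :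
    P.xs β ∈ P.X := (H.target β hβ).1.1

theorem Assumptions.us_mem (H : P.Assumptions) {β : Beta nr nu ny nd} (hβ : β ∈ P.B) :
    P.us β ∈ P.U := (H.target β hβ).1.2.1

theorem Assumptions.mem_B (H : P.Assumptions) {β : Beta nr nu ny nd} (hβ : β ∈ P.Bhat) :
    β ∈ P.B := H.mis.Bhat_subset hβ

/-- A closed subset of the compact `Bc × D`, projected by forgetting the unperturbed disturbance.
This compactness makes all later constants uniform in the parameter. -/
theorem Assumptions.isCompact_Bhat (H : P.Assumptions) : IsCompact P.Bhat := by
  have h : P.Bhat = (fun p : Beta nr nu ny nd × Vec nd => (p.1.1, p.2)) ''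
      ((P.Bc ×ˢ P.D) ∩ {p | ‖p.1.2 - p.2‖ ≤ P.δ₀}) := by
    ext β
    constructor
    · rintro ⟨h1, d, h2, h3⟩
      exact ⟨((β.1, d), β.2), ⟨⟨h2, h1⟩, h3⟩, rfl⟩
    · rintro ⟨⟨b, d⟩, ⟨⟨h2, h1⟩, h3⟩, rfl⟩
      exact ⟨h1, b.2, h2, h3⟩
  rw [h]
  refine IsCompact.image (((H.mis.Bc_compact).prod H.cons.D_compact).inter_right ?_) (by fun_prop)
  exact isClosed_le (by fun_prop) continuous_const

theorem Assumptions.matched_mem_Bhat (H : P.Assumptions) {α : Alpha nr nu ny nw} (hα : α ∈ P.Ac) :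
    (α.1, P.ds α) ∈ P.Bhat :=
  ⟨(H.mis.solves α hα).2.1, P.ds α, H.mis.ds_mem α hα, by simpa using H.mis.δ₀_pos.le⟩

theorem Assumptions.exists_target_lipschitz (H : P.Assumptions) :
    ∃ L > 0, ∀ β ∈ P.Bhat, ∀ β' ∈ P.Bhat, ‖P.xs β - P.xs β'‖ ≤ L * ‖β - β'‖ ∧
      ‖P.us β - P.us β'‖ ≤ L * ‖β - β'‖ := by
  obtain ⟨L, hL⟩ := H.mis.zs_lipschitz
  refine ⟨L + 1, by positivity, fun β hβ β' hβ' => ?_⟩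
  have h := hL.dist_le_mul β hβ β' hβ'
  rw [Prod.dist_eq, dist_eq_norm, dist_eq_norm, dist_eq_norm] at h
  have h0 := norm_nonneg (β - β')
  exact ⟨by linarith [(le_max_left _ _).trans h], by linarith [(le_max_right _ _).trans h]⟩

theorem Assumptions.continuousOn_target (H : P.Assumptions) :
    ContinuousOn P.xs P.Bhat ∧ ContinuousOn P.us P.Bhat := by
  obtain ⟨L, hL⟩ := H.mis.zs_lipschitz
  exact ⟨continuous_fst.comp_continuousOn hL.continuousOn,
    continuous_snd.comp_continuousOn hL.continuousOn⟩

theorem Assumptions.exists_target_bound (H : P.Assumptions) :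
    ∃ R > 0, ∀ β ∈ P.Bhat, ‖P.xs β‖ ≤ R := by
  obtain ⟨R, hR⟩ := H.isCompact_Bhat.exists_bound_of_continuousOn H.continuousOn_target.1
  exact ⟨|R| + 1, by positivity, fun β hβ => (hR β hβ).trans (by linarith [le_abs_self R])⟩

/-! ### Bounds on the costs -/

theorem Assumptions.exists_cost_bounds (H : P.Assumptions) : ∃ l > 0, ∃ L, l < L ∧
    (∀ x ∈ P.X, ∀ u ∈ P.U, ∀ β ∈ P.B,
      l * (‖x - P.xs β‖ ^ 2 + ‖u - P.us β‖ ^ 2) ≤ P.stage x u β) ∧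
    (∀ x ∈ P.X, ∀ β ∈ P.Bhat, l * ‖x - P.xs β‖ ^ 2 ≤ P.Vf x β ∧
      P.Vf x β ≤ L * ‖x - P.xs β‖ ^ 2) := by
  obtain ⟨Q, R, Pf, w, hQ, hR, hPf, hPfc, hw, hst, hVf⟩ := H.quad
  have hconst : ∀ {k : ℕ} {M : Matrix (Fin k) (Fin k) ℝ}, M.PosDef →
      ∃ l > 0, ∀ z, l * ‖z‖ ^ 2 ≤ wsq M z := fun {k M} hM => by
    obtain ⟨l, hl, _, _, h⟩ := exists_wsq_bounds (K := ({()} : Set Unit)) isCompact_singleton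
      (M := fun _ => M) continuousOn_const (fun _ _ => hM)
    exact ⟨l, hl, fun z => (h () rfl z).1⟩
  obtain ⟨lQ, hlQ, hQl⟩ := hconst hQ
  obtain ⟨lR, hlR, hRl⟩ := hconst hR
  obtain ⟨lP, hlP, LP, hLP, hP⟩ := exists_wsq_bounds H.isCompact_Bhat hPfc
    (fun β hβ => hPf β (H.mem_B hβ))
  set l := min lQ (min lR lP) with hl
  have h1 : l ≤ lQ := min_le_left _ _
  have h2 : l ≤ lR := (min_le_right _ _).trans (min_le_left _ _)
  have h3 : l ≤ lP := (min_le_right _ _).trans (min_le_right _ _)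
  have hl0 : 0 < l := by positivity
  -- The upper constant is enlarged to make `l < L` strict; `1 - l / L` later becomes the
  -- contraction factor of the terminal cost.
  refine ⟨l, hl0, LP + l + 1, by linarith, fun x hx u hu β hβ => ?_, fun x hx β hβ => ?_⟩
  · rw [hst x hx u hu β hβ]
    have h4 : 0 ≤ ∑ i, w i * max 0 (P.cbar u (P.h x u β.2) i) :=
      Finset.sum_nonneg fun i _ => mul_nonneg (hw i).le (le_max_left _ _)
    nlinarith [hQl (x - P.xs β), hRl (u - P.us β), sq_nonneg ‖x - P.xs β‖,
      sq_nonneg ‖u - P.us β‖]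
  · rw [hVf x hx β (H.mem_B hβ)]
    have := hP β hβ (x - P.xs β)
    have h4 := sq_nonneg ‖x - P.xs β‖
    constructor
    · nlinarith
    · nlinarith

theorem Assumptions.stage_nonneg (H : P.Assumptions) {x : Vec n} (hx : x ∈ P.X) {u : Vec nu}
    (hu : u ∈ P.U) {β : Beta nr nu ny nd} (hβ : β ∈ P.B) : 0 ≤ P.stage x u β := by
  obtain ⟨l, hl, L, -, h, -⟩ := H.exists_cost_bounds
  exact le_trans (by positivity) (h x hx u hu β hβ)

theorem Assumptions.Vf_nonneg (H : P.Assumptions) {x : Vec n} (hx : x ∈ P.X)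
    {β : Beta nr nu ny nd} (hβ : β ∈ P.B) : 0 ≤ P.Vf x β := by
  obtain ⟨Q, R, Pf, w, hQ, hR, hPf, hPfc, hw, hst, hVf⟩ := H.quad
  rw [hVf x hx β hβ]
  exact wsq_nonneg (hPf β hβ) _

/-! ### Open-loop trajectories -/

/-- Extension of a control sequence by zero. -/
def extend (u : Fin P.N → Vec nu) (k : ℕ) : Vec nu := if hk : k < P.N then u ⟨k, hk⟩ else 0

theorem phi_succ (x : Vec n) (u : Fin P.N → Vec nu) (d : Vec nd) (k : ℕ) :
    P.phi x u d (k + 1) = P.f (P.phi x u d k) (extend u k) d := rfl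

theorem VN_eq (x : Vec n) (u : Fin P.N → Vec nu) (β : Beta nr nu ny nd) :
    P.VN x u β = P.Vf (P.phi x u β.2 P.N) β +
      ∑ k ∈ Finset.range P.N, P.stage (P.phi x u β.2 k) (extend u k) β := by
  rw [VN, Finset.sum_range]
  simp [extend]

theorem Assumptions.extend_mem (H : P.Assumptions) {u : Fin P.N → Vec nu} (hu : ∀ k, u k ∈ P.U)
    (k : ℕ) : extend u k ∈ P.U := by
  unfold extend
  split
  · exact hu _
  · exact H.cons.U_zero

theorem Assumptions.phi_mem (H : P.Assumptions) {x : Vec n} (hx : x ∈ P.X)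
    {u : Fin P.N → Vec nu} (hu : ∀ k, u k ∈ P.U) {d : Vec nd} (hd : d ∈ P.D) (k : ℕ) :
    P.phi x u d k ∈ P.X := by
  induction k with
  | zero => exact hx
  | succ k ih => exact H.cont.f_mem _ ih _ (H.extend_mem hu k) _ hd

theorem Assumptions.stage_le_VN (H : P.Assumptions) {x : Vec n} (hx : x ∈ P.X)
    {u : Fin P.N → Vec nu} (hu : ∀ k, u k ∈ P.U) {β : Beta nr nu ny nd} (hβ : β ∈ P.B) {k : ℕ}
    (hk : k < P.N) : P.stage (P.phi x u β.2 k) (extend u k) β ≤ P.VN x u β := by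
  rw [VN_eq]
  have h1 := H.Vf_nonneg (H.phi_mem hx hu (snd_mem_D hβ) P.N) hβ
  have h2 := Finset.single_le_sum (f := fun k => P.stage (P.phi x u β.2 k) (extend u k) β)
    (fun k _ => H.stage_nonneg (H.phi_mem hx hu (snd_mem_D hβ) k) (H.extend_mem hu k) hβ)
    (Finset.mem_range.2 hk)
  linarith

/-! ### The optimal value -/

theorem Assumptions.isLeast_VN0 (H : P.Assumptions) {x : Vec n} {β : Beta nr nu ny nd}
    (h : (x, β) ∈ P.SN) :
    P.VN0 x β = P.VN x (P.u0 x β) β ∧ ∀ u ∈ P.UN x β, P.VN0 x β ≤ P.VN x u β := by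
  obtain ⟨h1, h2⟩ := H.fhocp x β h
  have : IsLeast ((fun u => P.VN x u β) '' P.UN x β) (P.VN x (P.u0 x β) β) :=
    ⟨⟨_, h1, rfl⟩, by rintro _ ⟨u, hu, rfl⟩; exact h2 u hu⟩
  have heq : P.VN0 x β = P.VN x (P.u0 x β) β := this.csInf_eq
  exact ⟨heq, fun u hu => heq ▸ h2 u hu⟩

theorem Assumptions.kappaN_mem (H : P.Assumptions) {x : Vec n} {β : Beta nr nu ny nd}
    (h : (x, β) ∈ P.SN) : P.kappaN x β ∈ P.U :=
  (H.fhocp x β h).1.1 _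

theorem Assumptions.stage_kappaN_le (H : P.Assumptions) {x : Vec n} {β : Beta nr nu ny nd}
    (h : (x, β) ∈ P.SN) : P.stage x (P.kappaN x β) β ≤ P.VN0 x β := by
  have h1 := H.stage_le_VN h.1 (H.fhocp x β h).1.1 h.2.1 P.N_pos
  rw [(H.isLeast_VN0 h).1]
  simpa [extend, P.N_pos, kappaN, phi] using h1

/-- Iterating the terminal law `N` times never leaves the terminal set, and its stage costs
telescope against the drops of the terminal cost. -/
theorem Assumptions.mem_SN_of_mem_Xf (H : P.Assumptions) {x : Vec n} {β : Beta nr nu ny nd}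
    (hβ : β ∈ P.B) (hx : x ∈ P.Xf β) : (x, β) ∈ P.SN ∧ P.VN0 x β ≤ P.Vf x β := by
  obtain ⟨κ, hκ, hdec⟩ := H.term
  set z : ℕ → Vec n := fun k => (fun y => P.f y (κ y β) β.2)^[k] x with hz
  have hzs : ∀ k, z (k + 1) = P.f (z k) (κ (z k) β) β.2 := fun k => by
    simp only [hz, Function.iterate_succ_apply']
  have hzX : ∀ k, z k ∈ P.Xf β := by
    intro k
    induction k with
    | zero => exact hx
    | succ k ih =>
      have hu := hκ _ ih.1 β hβ
      have h0 := H.stage_nonneg ih.1 hu hβ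
      refine ⟨?_, ?_⟩
      · rw [hzs]
        exact H.cont.f_mem _ ih.1 _ hu _ (snd_mem_D hβ)
      · rw [hzs]
        linarith [hdec β hβ _ ih, ih.2]
  set u : Fin P.N → Vec nu := fun k => κ (z k) β with hu
  have huU : ∀ k, u k ∈ P.U := fun k => hκ _ (hzX k).1 β hβ
  have hext : ∀ k < P.N, extend u k = κ (z k) β := fun k hk => by simp [extend, hk, hu]
  have hphi : ∀ k ≤ P.N, P.phi x u β.2 k = z k := by
    intro k
    induction k with
    | zero => intro _; rfl
    | succ k ih =>
      intro hk
      rw [phi_succ, ih (by omega), hext k (by omega), hzs]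
  have hUN : u ∈ P.UN x β := ⟨huU, by rw [hphi _ le_rfl]; exact hzX _⟩
  have hSN : (x, β) ∈ P.SN := ⟨hx.1, hβ, u, hUN⟩
  refine ⟨hSN, ((H.isLeast_VN0 hSN).2 u hUN).trans ?_⟩
  have hsum : ∀ k ≤ P.N, P.Vf (P.phi x u β.2 k) β +
      ∑ j ∈ Finset.range k, P.stage (P.phi x u β.2 j) (extend u j) β ≤ P.Vf x β := by
    intro k
    induction k with
    | zero => intro _; simp [phi]
    | succ k ih =>
      intro hk
      have h1 := ih (by omega)
      have h2 := hdec β hβ _ (hzX k)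
      rw [Finset.sum_range_succ, hphi (k + 1) hk, hzs, hext k (by omega), hphi k (by omega)]
      rw [hphi k (by omega)] at h1
      linarith
  rw [VN_eq]
  exact hsum _ le_rfl

/-- For the quadratic upper bound: inside the terminal set the value is at most `V_f`; outside, it
is at most `ρ` while the distance to the target is bounded below. -/
theorem Assumptions.exists_VN0_bounds (H : P.Assumptions) {ρ : ℝ} (hρ : 0 < ρ) :
    ∃ l > 0, ∃ C, l < C ∧ ∀ x β, (x, β) ∈ P.ShatN ρ →
      l * (‖x - P.xs β‖ ^ 2 + ‖P.kappaN x β - P.us β‖ ^ 2) ≤ P.stage x (P.kappaN x β) β ∧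
      P.stage x (P.kappaN x β) β ≤ P.VN0 x β ∧ P.VN0 x β ≤ C * ‖x - P.xs β‖ ^ 2 := by
  obtain ⟨l, hl, L, hlL, hst, hVf⟩ := H.exists_cost_bounds
  have hcf := P.cf_pos
  have hL : 0 < L := hl.trans hlL
  refine ⟨l, hl, L + ρ * L / P.cf, by have : 0 < ρ * L / P.cf := by positivity
                                      linarith, fun x β h => ?_⟩
  obtain ⟨hSN, hB, hV⟩ := h
  refine ⟨hst x hSN.1 _ (H.kappaN_mem hSN) β hSN.2.1, H.stage_kappaN_le hSN, ?_⟩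
  have hb := (hVf x hSN.1 β hB).2
  have hq := sq_nonneg ‖x - P.xs β‖
  have h1 : 0 ≤ ρ * L / P.cf * ‖x - P.xs β‖ ^ 2 := by positivity
  rw [add_mul]
  by_cases hc : P.Vf x β ≤ P.cf
  · linarith [(H.mem_SN_of_mem_Xf hSN.2.1 ⟨hSN.1, hc⟩).2]
  · have h2 : ρ ≤ ρ * L / P.cf * ‖x - P.xs β‖ ^ 2 := by
      rw [div_mul_eq_mul_div, le_div_iff₀ hcf, mul_assoc]
      exact mul_le_mul_of_nonneg_left (by linarith) hρ.le
    have h3 : 0 ≤ L * ‖x - P.xs β‖ ^ 2 := by positivity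
    have hV' : P.VN0 x β ≤ ρ := hV
    linarith

/-! ### The shifted control sequence -/

/-- Drop the first input and append the terminal law at the old terminal state. The factor `θ < 1`
leaves a margin `(1 - θ) c_f` in the terminal constraint, which later absorbs estimation error and
mismatch; this replaces inherent robustness arguments for the terminal set. -/
theorem Assumptions.exists_shift (H : P.Assumptions) : ∃ θ, 0 < θ ∧ θ < 1 ∧
    ∀ x β, (x, β) ∈ P.SN → β ∈ P.Bhat → ∃ u : Fin P.N → Vec nu, (∀ k, u k ∈ P.U) ∧
      P.VN (P.f x (P.kappaN x β) β.2) u β ≤ P.VN0 x β - P.stage x (P.kappaN x β) β ∧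
      P.Vf (P.phi (P.f x (P.kappaN x β) β.2) u β.2 P.N) β ≤ θ * P.cf := by
  obtain ⟨κ, hκ, hdec⟩ := H.term
  obtain ⟨l, hl, L, hlL, hst, hVf⟩ := H.exists_cost_bounds
  have hL : 0 < L := hl.trans hlL
  refine ⟨1 - l / L, by rw [sub_pos, div_lt_one hL]; exact hlL, by
    have : 0 < l / L := by positivity
    linarith, fun x β hSN hβ => ?_⟩
  obtain ⟨⟨hvU, hvT⟩, -⟩ := H.fhocp x β hSN
  have hB := hSN.2.1
  set v := P.u0 x β with hv
  set z := P.phi x v β.2 P.N with hz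
  have hκU := hκ z hvT.1 β hB
  set u : Fin P.N → Vec nu := fun k => if h : (k : ℕ) + 1 < P.N then v ⟨k + 1, h⟩ else κ z β with hu
  have hext : ∀ k, k + 1 < P.N → extend u k = extend v (k + 1) := fun k hk => by
    have : k < P.N := by omega
    simp [extend, hk, hu, this]
  have hlast : extend u (P.N - 1) = κ z β := by
    have := P.N_pos
    have h2 : P.N - 1 < P.N := by omega
    have h3 : ¬ (P.N - 1 + 1 < P.N) := by omega
    simp only [extend, h2, h3, hu, dif_pos, dif_neg, not_false_iff]
  have hk0 : extend v 0 = P.kappaN x β := by simp [extend, P.N_pos, kappaN, hv]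
  set x₁ := P.f x (P.kappaN x β) β.2 with hx₁
  have hphi : ∀ k < P.N, P.phi x₁ u β.2 k = P.phi x v β.2 (k + 1) := by
    intro k
    induction k with
    | zero => intro _; rw [phi_succ, hk0]; rfl
    | succ k ih =>
      intro hk
      rw [phi_succ, ih (by omega), hext k hk, ← phi_succ]
  have hphiN : P.phi x₁ u β.2 P.N = P.f z (κ z β) β.2 := by
    obtain ⟨m, hm⟩ := Nat.exists_eq_succ_of_ne_zero P.N_pos.ne'
    have h1 : P.phi x₁ u β.2 (m + 1) = P.f (P.phi x₁ u β.2 m) (extend u m) β.2 := rfl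
    have h2 : extend u m = κ z β := by rw [← hlast, hm]; rfl
    have h3 : P.phi x v β.2 (m + 1) = z := by rw [hz, hm]
    rw [hphi m (by omega), h2, h3] at h1
    rw [hm]
    exact h1
  have hd := hdec β hB z hvT
  refine ⟨u, fun k => ?_, ?_, ?_⟩
  · simp only [hu]
    split
    · exact hvU _
    · exact hκU
  · rw [(H.isLeast_VN0 hSN).1, VN_eq, VN_eq, hphiN, ← hv, ← hz]
    obtain ⟨m, hm⟩ := Nat.exists_eq_succ_of_ne_zero P.N_pos.ne'
    have h2 : extend u m = κ z β := by rw [← hlast, hm]; rfl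
    have h3 : P.phi x₁ u β.2 m = z := by rw [hphi m (by omega), hz, hm]
    have h4 : ∑ k ∈ Finset.range P.N, P.stage (P.phi x₁ u β.2 k) (extend u k) β =
        ∑ k ∈ Finset.range m, P.stage (P.phi x v β.2 (k + 1)) (extend v (k + 1)) β +
          P.stage z (κ z β) β := by
      rw [hm, Finset.sum_range_succ, h2, h3]
      congr 1
      refine Finset.sum_congr rfl fun k hk => ?_
      have := Finset.mem_range.1 hk
      rw [hphi k (by omega), hext k (by omega)]
    have h5 : ∑ k ∈ Finset.range P.N, P.stage (P.phi x v β.2 k) (extend v k) β =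
        ∑ k ∈ Finset.range m, P.stage (P.phi x v β.2 (k + 1)) (extend v (k + 1)) β +
          P.stage x (P.kappaN x β) β := by
      rw [hm, Finset.sum_range_succ', hk0]
      rfl
    rw [h4, h5]
    linarith
  · rw [hphiN]
    have h1 := hst z hvT.1 _ hκU β hB
    have h2 := (hVf z hvT.1 β hβ).2
    -- One step of the terminal law costs at least `l |z - x_s|²`, hence at least the fraction `l /
    -- L` of the terminal cost.
    have h3 : l / L * P.Vf z β ≤ l * ‖z - P.xs β‖ ^ 2 := by
      rw [div_mul_eq_mul_div, div_le_iff₀ hL]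
      nlinarith
    have h4 : 0 ≤ l * ‖κ z β - P.us β‖ ^ 2 := by positivity
    have h5 : P.Vf z β ≤ P.cf := hvT.2
    have h6 : 0 < 1 - l / L := by rw [sub_pos, div_lt_one hL]; exact hlL
    nlinarith

/-! ### Lipschitz bounds for the model on bounded sets -/

theorem Assumptions.exists_input_bound (H : P.Assumptions) :
    ∃ R > 0, (∀ u ∈ P.U, ‖u‖ ≤ R) ∧ (∀ d ∈ P.D, ‖d‖ ≤ R) := by
  obtain ⟨R₁, h₁⟩ := H.cons.U_compact.isBounded.exists_norm_le
  obtain ⟨R₂, h₂⟩ := H.cons.D_compact.isBounded.exists_norm_le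
  exact ⟨max 1 (max R₁ R₂), by positivity,
    fun u hu => (h₁ u hu).trans ((le_max_left _ _).trans (le_max_right _ _)),
    fun d hd => (h₂ d hd).trans ((le_max_right _ _).trans (le_max_right _ _))⟩

theorem Assumptions.exists_model_lipschitz (H : P.Assumptions) {q : ℕ}
    {φ : Vec n → Vec nu → Vec nd → Vec q}
    (hφ : ∃ F : Vec n × Vec nu × Vec nd → Vec q, ContDiff ℝ 1 F ∧
      ∀ x ∈ P.X, ∀ u ∈ P.U, ∀ d ∈ P.D, F (x, u, d) = φ x u d) (R : ℝ) :
    ∃ L > 0, ∀ x ∈ P.X, ∀ x' ∈ P.X, ‖x‖ ≤ R → ‖x'‖ ≤ R → ∀ u ∈ P.U, ∀ u' ∈ P.U, ∀ d ∈ P.D,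
      ∀ d' ∈ P.D, ‖φ x u d - φ x' u' d'‖ ≤ L * (‖x - x'‖ + ‖u - u'‖ + ‖d - d'‖) := by
  obtain ⟨F, hF, hFφ⟩ := hφ
  obtain ⟨R', hR', hU, hD⟩ := H.exists_input_bound
  obtain ⟨L, hL, h⟩ := exists_lipschitz_of_contDiff hF (max R R')
  refine ⟨L, hL, fun x hx x' hx' hxR hxR' u hu u' hu' d hd d' hd' => ?_⟩
  rw [← hFφ x hx u hu d hd, ← hFφ x' hx' u' hu' d' hd']
  have hb : ∀ (a : Vec n) (b : Vec nu) (c : Vec nd), ‖a‖ ≤ R → ‖b‖ ≤ R' → ‖c‖ ≤ R' →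
      ‖(a, b, c)‖ ≤ max R R' := fun a b c ha hb hc => by
    rw [Prod.norm_def, Prod.norm_def]
    exact max_le (ha.trans (le_max_left _ _))
      (max_le (hb.trans (le_max_right _ _)) (hc.trans (le_max_right _ _)))
  refine (h _ _ (hb x u d hxR (hU u hu) (hD d hd)) (hb x' u' d' hxR' (hU u' hu') (hD d' hd'))).trans
    (mul_le_mul_of_nonneg_left ?_ hL.le)
  rw [Prod.mk_sub_mk, Prod.mk_sub_mk, Prod.norm_def, Prod.norm_def]
  have h1 := norm_nonneg (x - x')
  have h2 := norm_nonneg (u - u')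
  have h3 := norm_nonneg (d - d')
  exact max_le (by linarith) (max_le (by linarith) (by linarith))

/-- The bound `R'` is propagated together with the Lipschitz constant, since `f` is Lipschitz only
on bounded sets. -/
theorem Assumptions.exists_phi_lipschitz (H : P.Assumptions) (R : ℝ) (m : ℕ) :
    ∃ R' > 0, ∃ L > 0, ∀ k ≤ m, ∀ x ∈ P.X, ∀ x' ∈ P.X, ‖x‖ ≤ R → ‖x'‖ ≤ R → ∀ d ∈ P.D, ∀ d' ∈ P.D,
      ∀ u : Fin P.N → Vec nu, (∀ i, u i ∈ P.U) →
      ‖P.phi x u d k‖ ≤ R' ∧ ‖P.phi x u d k - P.phi x' u d' k‖ ≤ L * (‖x - x'‖ + ‖d - d'‖) := by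
  induction m with
  | zero =>
    refine ⟨|R| + 1, by positivity, 1, one_pos, fun k hk x hx x' hx' hxR _ d hd d' hd' u hu => ?_⟩
    obtain rfl := Nat.le_zero.1 hk
    simp only [phi]
    exact ⟨by linarith [le_abs_self R], by linarith [norm_nonneg (d - d')]⟩
  | succ m ih =>
    obtain ⟨R₁, hR₁, L₁, hL₁, h₁⟩ := ih
    obtain ⟨L₂, hL₂, h₂⟩ := H.exists_model_lipschitz H.diff.f_diff R₁
    obtain ⟨R₃, hR₃, hU, hD⟩ := H.exists_input_bound
    refine ⟨R₁ + L₂ * (R₁ + R₃ + R₃), by positivity, L₁ + L₂ * (L₁ + 1), by positivity,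
      fun k hk x hx x' hx' hxR hxR' d hd d' hd' u hu => ?_⟩
    have hs : 0 ≤ ‖x - x'‖ + ‖d - d'‖ := by positivity
    rcases Nat.le_succ_iff.1 hk with hk | rfl
    · obtain ⟨h3, h4⟩ := h₁ k hk x hx x' hx' hxR hxR' d hd d' hd' u hu
      refine ⟨h3.trans (le_add_of_nonneg_right (by positivity)), h4.trans ?_⟩
      exact mul_le_mul_of_nonneg_right (le_add_of_nonneg_right (by positivity)) hs
    · obtain ⟨h3, h4⟩ := h₁ m le_rfl x hx x' hx' hxR hxR' d hd d' hd' u hu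
      obtain ⟨h3', -⟩ := h₁ m le_rfl x' hx' x hx hxR' hxR d' hd' d hd u hu
      have hp := H.phi_mem hx hu hd m
      have hp' := H.phi_mem hx' hu hd' m
      have hv := H.extend_mem hu m
      rw [phi_succ, phi_succ]
      constructor
      -- Boundedness comes from comparison with the equilibrium at the origin.
      · have h5 := h₂ _ hp 0 H.cons.X_zero h3 (by simpa using hR₁.le) _ hv 0 H.cons.U_zero
          d hd 0 H.cons.D_zero
        rw [H.cont.f_zero, sub_zero, sub_zero, sub_zero, sub_zero] at h5
        have h6 : L₂ * (‖P.phi x u d m‖ + ‖extend u m‖ + ‖d‖) ≤ L₂ * (R₁ + R₃ + R₃) :=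
          mul_le_mul_of_nonneg_left (by linarith [hU _ hv, hD d hd]) hL₂.le
        linarith
      · have h5 := h₂ _ hp _ hp' h3 h3' _ hv _ hv d hd d' hd'
        rw [sub_self, norm_zero, add_zero] at h5
        have h7 : ‖P.phi x u d m - P.phi x' u d' m‖ + ‖d - d'‖ ≤
            (L₁ + 1) * (‖x - x'‖ + ‖d - d'‖) := by
          linarith [norm_nonneg (x - x')]
        have h8 := mul_le_mul_of_nonneg_left h7 hL₂.le
        have h9 : 0 ≤ L₁ * (‖x - x'‖ + ‖d - d'‖) := by positivity
        linarith

/-! ### Perturbation of the costs -/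

theorem norm_sub_sub_sub_le {E : Type*} [SeminormedAddCommGroup E] {a b a' b' : E} {s t : ℝ}
    (h1 : ‖a - a'‖ ≤ s) (h2 : ‖b - b'‖ ≤ t) : ‖(a' - b') - (a - b)‖ ≤ s + t := by
  have : (a' - b') - (a - b) = (b - b') - (a - a') := by abel
  rw [this]
  linarith [norm_sub_le (b - b') (a - a')]

theorem Assumptions.continuousOn_cbar_model (H : P.Assumptions) :
    ContinuousOn (fun p : Vec n × Vec nu × Vec nd => P.cbar p.2.1 (P.h p.1 p.2.1 p.2.2))
      (P.X ×ˢ P.U ×ˢ P.D) :=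
  H.cons.cbar_cont.comp (f := fun p : Vec n × Vec nu × Vec nd => (p.2.1, P.h p.1 p.2.1 p.2.2))
    ((continuous_fst.comp continuous_snd).continuousOn.prodMk H.cont.h_cont)
    fun _ hp => ⟨hp.2.1, H.cont.h_mem _ hp.1 _ hp.2.1 _ hp.2.2⟩

theorem Assumptions.exists_cbar_modulus (H : P.Assumptions) (R : ℝ) {ε : ℝ} (hε : 0 < ε) :
    ∃ δ > 0, ∀ x ∈ P.X, ∀ x' ∈ P.X, ‖x‖ ≤ R → ‖x'‖ ≤ R → ∀ u ∈ P.U, ∀ u' ∈ P.U,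
      ∀ d ∈ P.D, ∀ d' ∈ P.D, ‖x - x'‖ ≤ δ → ‖u - u'‖ ≤ δ → ‖d - d'‖ ≤ δ → ∀ i,
      |P.cbar u (P.h x u d) i - P.cbar u' (P.h x' u' d') i| ≤ ε := by
  have hcp : IsCompact ((P.X ∩ Metric.closedBall 0 R) ×ˢ P.U ×ˢ P.D) :=
    ((isCompact_closedBall 0 R).inter_left H.cons.X_closed).prod
      (H.cons.U_compact.prod H.cons.D_compact)
  obtain ⟨δ, hδ, h⟩ := Metric.uniformContinuousOn_iff.1 (hcp.uniformContinuousOn_of_continuous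
    (H.continuousOn_cbar_model.mono
      (Set.prod_mono Set.inter_subset_left subset_rfl))) ε hε
  refine ⟨δ / 2, by positivity, fun x hx x' hx' hxR hxR' u hu u' hu' d hd d' hd' h1 h2 h3 i => ?_⟩
  have h4 := h (x, u, d) ⟨⟨hx, by simpa using hxR⟩, hu, hd⟩ (x', u', d')
    ⟨⟨hx', by simpa using hxR'⟩, hu', hd'⟩ (by
      rw [Prod.dist_eq, Prod.dist_eq, dist_eq_norm, dist_eq_norm, dist_eq_norm]
      exact max_lt (by linarith) (max_lt (by linarith) (by linarith)))
  have h5 := (dist_le_pi_dist (P.cbar u (P.h x u d)) (P.cbar u' (P.h x' u' d')) i).trans h4.le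
  rwa [Real.dist_eq] at h5

/-- Near the steady-state targets the soft constraints are inactive. -/
theorem Assumptions.exists_cbar_neg (H : P.Assumptions) : ∃ δ > 0, ∀ β ∈ P.Bhat, ∀ x ∈ P.X,
    ∀ u ∈ P.U, ‖x - P.xs β‖ ≤ δ → ‖u - P.us β‖ ≤ δ → ∀ i, P.cbar u (P.h x u β.2) i ≤ 0 := by
  -- A uniform positive margin below all back-off constants. At the target each constraint is at
  -- most `-bbar i`, so a change of at most `b` cannot activate it.
  obtain ⟨b, hb, hbi⟩ := Pi.exists_forall_pos_add_lt (x := fun _ : Fin nc => (0 : ℝ))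
    H.cons.bbar_pos
  obtain ⟨R, hR, hxs⟩ := H.exists_target_bound
  obtain ⟨δ, hδ, h⟩ := H.exists_cbar_modulus (R + 1) hb
  refine ⟨min δ 1, by positivity, fun β hβ x hx u hu h1 h2 i => ?_⟩
  have hB := H.mem_B hβ
  have hd := snd_mem_D hB
  have hz := (H.target β hB).1.2.2.2.1.2.2 i
  have hxR : ‖x‖ ≤ R + 1 := by
    have h3 := norm_add_le (x - P.xs β) (P.xs β)
    rw [sub_add_cancel] at h3
    linarith [hxs β hβ, h1.trans (min_le_right _ _)]
  have h4 := h x hx _ (H.xs_mem hB) hxR (by linarith [hxs β hβ]) u hu _ (H.us_mem hB) _ hd _ hd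
    (h1.trans (min_le_left _ _)) (h2.trans (min_le_left _ _)) (by simpa using hδ.le) i
  have h5 := (abs_le.1 h4).2
  have h6 := hbi i
  simp only at hz
  linarith

/-- A relative error bound although the penalty is only continuous. If the stage cost is at most
`μ`, the point is so close to its target that the perturbed penalty is zero. Otherwise an additive
error `ε * μ` is at most `ε` times the stage cost. -/
theorem Assumptions.exists_penalty_perturbation (H : P.Assumptions) (R : ℝ) {w : Fin nc → ℝ}
    (hw : ∀ i, 0 < w i) {ε : ℝ} (hε : 0 < ε) :
    ∃ p₀ > 0, ∀ x ∈ P.X, ∀ x' ∈ P.X, ‖x‖ ≤ R → ‖x'‖ ≤ R → ∀ u ∈ P.U, ∀ β ∈ P.Bhat, ∀ β' ∈ P.Bhat,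
      ‖x - x'‖ ≤ p₀ → ‖β - β'‖ ≤ p₀ →
      ∑ i, w i * max 0 (P.cbar u (P.h x' u β'.2) i) ≤
        ∑ i, w i * max 0 (P.cbar u (P.h x u β.2) i) + ε * P.stage x u β := by
  obtain ⟨l, hl, -, -, hst, -⟩ := H.exists_cost_bounds
  obtain ⟨L, hL, hLip⟩ := H.exists_target_lipschitz
  obtain ⟨δ, hδ, hneg⟩ := H.exists_cbar_neg
  set μ := l * (δ / 2) ^ 2 with hμ
  have hμ0 : 0 < μ := by positivity
  have hw0 : 0 ≤ ∑ i, w i := Finset.sum_nonneg fun i _ => (hw i).le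
  -- Divided by the total weight, with `+ 1` against a zero denominator, so that the summed error is
  -- at most `ε * μ`.
  obtain ⟨δ', hδ', hmod⟩ := H.exists_cbar_modulus R (ε := ε * μ / (∑ i, w i + 1)) (by positivity)
  refine ⟨min δ' (δ / (2 * (L + 1))), by positivity,
    fun x hx x' hx' hxR hxR' u hu β hβ β' hβ' h1 h2 => ?_⟩
  have hB := H.mem_B hβ
  have hB' := H.mem_B hβ'
  by_cases hs : P.stage x u β ≤ μ
  · have hq := (hst x hx u hu β hB).trans hs
    have hq1 : ‖x - P.xs β‖ ^ 2 + ‖u - P.us β‖ ^ 2 ≤ (δ / 2) ^ 2 := le_of_mul_le_mul_left hq hl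
    have hx1 : ‖x - P.xs β‖ ≤ δ / 2 :=
      abs_le_of_sq_le_sq' (by nlinarith [sq_nonneg ‖u - P.us β‖]) (by positivity) |>.2
    have hu1 : ‖u - P.us β‖ ≤ δ / 2 :=
      abs_le_of_sq_le_sq' (by nlinarith [sq_nonneg ‖x - P.xs β‖]) (by positivity) |>.2
    have h3 : (L + 1) * (δ / (2 * (L + 1))) = δ / 2 := by field_simp
    have h4 := h1.trans (min_le_right _ _)
    have h5 := h2.trans (min_le_right _ _)
    have h6 := hLip β hβ β' hβ'
    have h7 : L * ‖β - β'‖ ≤ L * (δ / (2 * (L + 1))) := mul_le_mul_of_nonneg_left h5 hL.le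
    have hx2 : ‖x' - P.xs β'‖ ≤ δ := by
      have h8 := norm_sub_sub_sub_le h4 (h6.1.trans h7)
      have h9 := norm_add_le (x - P.xs β) ((x' - P.xs β') - (x - P.xs β))
      rw [add_sub_cancel] at h9
      linarith
    have hu2 : ‖u - P.us β'‖ ≤ δ := by
      have h8 := norm_add_le (u - P.us β) (P.us β - P.us β')
      rw [sub_add_sub_cancel] at h8
      have h9 : 0 ≤ δ / (2 * (L + 1)) := by positivity
      linarith [h6.2]
    have hz : ∑ i, w i * max 0 (P.cbar u (P.h x' u β'.2) i) = 0 :=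
      Finset.sum_eq_zero fun i _ => by
        rw [max_eq_left (hneg β' hβ' x' hx' u hu hx2 hu2 i), mul_zero]
    rw [hz]
    have h10 : 0 ≤ ∑ i, w i * max 0 (P.cbar u (P.h x u β.2) i) :=
      Finset.sum_nonneg fun i _ => mul_nonneg (hw i).le (le_max_left _ _)
    have h11 := mul_nonneg hε.le (H.stage_nonneg hx hu hB)
    linarith
  · have h3 := h1.trans (min_le_left _ _)
    have h4 : ‖β.2 - β'.2‖ ≤ δ' := (norm_snd_le (β - β')).trans (h2.trans (min_le_left _ _))
    have h5 : ∀ i, w i * max 0 (P.cbar u (P.h x' u β'.2) i) ≤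
        w i * max 0 (P.cbar u (P.h x u β.2) i) + w i * (ε * μ / (∑ i, w i + 1)) := fun i => by
      have h6 := (abs_le.1 (hmod x hx x' hx' hxR hxR' u hu u hu _ (snd_mem_D hB) _ (snd_mem_D hB')
        h3 (by simpa using hδ'.le) h4 i)).1
      rw [← mul_add]
      refine mul_le_mul_of_nonneg_left (max_le ?_ ?_) (hw i).le
      · have h7 : 0 ≤ ε * μ / (∑ i, w i + 1) := by positivity
        linarith [le_max_left 0 (P.cbar u (P.h x u β.2) i)]
      · linarith [le_max_right 0 (P.cbar u (P.h x u β.2) i)]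
    refine (Finset.sum_le_sum fun i _ => h5 i).trans ?_
    rw [Finset.sum_add_distrib, ← Finset.sum_mul]
    have h6 : (∑ i, w i) * (ε * μ / (∑ i, w i + 1)) ≤ ε * μ := by
      rw [mul_div_assoc', div_le_iff₀ (by positivity)]
      nlinarith [mul_pos hε hμ0]
    have h7 : ε * μ ≤ ε * P.stage x u β := mul_le_mul_of_nonneg_left (not_le.1 hs).le hε.le
    linarith

/-- Young's inequality with the Lipschitz targets handles the quadratic terms, so the absolute error
is of order `p ^ 2`; an error linear in `p` would not fit a quadratic Lyapunov function. -/
theorem Assumptions.exists_stage_perturbation (H : P.Assumptions) (R : ℝ) {ε : ℝ} (hε : 0 < ε) :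
    ∃ p₀ > 0, ∃ C > 0, ∀ x ∈ P.X, ∀ x' ∈ P.X, ‖x‖ ≤ R → ‖x'‖ ≤ R → ∀ u ∈ P.U, ∀ β ∈ P.Bhat,
      ∀ β' ∈ P.Bhat, ∀ p ≤ p₀, ‖x - x'‖ ≤ p → ‖β - β'‖ ≤ p →
      P.stage x' u β' ≤ (1 + ε) * P.stage x u β + C * p ^ 2 := by
  obtain ⟨Q, S, Pf, w, hQ, hS, hPf, hPfc, hw, hst, hVf⟩ := H.quad
  have hconst : ∀ {k : ℕ} {M : Matrix (Fin k) (Fin k) ℝ}, M.PosDef →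
      ∃ L > 0, ∀ z, wsq M z ≤ L * ‖z‖ ^ 2 := fun {k M} hM => by
    obtain ⟨_, _, L, hL, h⟩ := exists_wsq_bounds (K := ({()} : Set Unit)) isCompact_singleton
      (M := fun _ => M) continuousOn_const (fun _ _ => hM)
    exact ⟨L, hL, fun z => (h () rfl z).2⟩
  obtain ⟨LQ, hLQ, hQ'⟩ := hconst hQ
  obtain ⟨LS, hLS, hS'⟩ := hconst hS
  obtain ⟨L, hL, hLip⟩ := H.exists_target_lipschitz
  have hε2 : 0 < ε / 2 := by positivity
  obtain ⟨p₀, hp₀, hpen⟩ := H.exists_penalty_perturbation R hw hε2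
  refine ⟨p₀, hp₀, (1 + 1 / (ε / 2)) * (LQ * (1 + L) ^ 2 + LS * L ^ 2), by positivity,
    fun x hx x' hx' hxR hxR' u hu β hβ β' hβ' p hp h1 h2 => ?_⟩
  have hB := H.mem_B hβ
  have hpn : 0 ≤ p := (norm_nonneg _).trans h1
  have h3 := hLip β hβ β' hβ'
  have h4 : L * ‖β - β'‖ ≤ L * p := mul_le_mul_of_nonneg_left h2 hL.le
  have hx1 := wsq_add_le hQ hε2 (x - P.xs β) ((x' - P.xs β') - (x - P.xs β))
  rw [add_sub_cancel] at hx1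
  have hu1 := wsq_add_le hS hε2 (u - P.us β) (P.us β - P.us β')
  rw [sub_add_sub_cancel] at hu1
  have hx2 : wsq Q ((x' - P.xs β') - (x - P.xs β)) ≤ LQ * (1 + L) ^ 2 * p ^ 2 := by
    refine (hQ' _).trans ?_
    rw [mul_assoc, ← mul_pow]
    have := norm_sub_sub_sub_le h1 (h3.1.trans h4)
    gcongr
    linarith
  have hu2 : wsq S (P.us β - P.us β') ≤ LS * L ^ 2 * p ^ 2 := by
    refine (hS' _).trans ?_
    rw [mul_assoc, ← mul_pow]
    have := h3.2.trans h4
    gcongr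
  have h5 := hpen x hx x' hx' hxR hxR' u hu β hβ β' hβ' (h1.trans hp) (h2.trans hp)
  have h6 : 0 ≤ ∑ i, w i * max 0 (P.cbar u (P.h x u β.2) i) :=
    Finset.sum_nonneg fun i _ => mul_nonneg (hw i).le (le_max_left _ _)
  have h7 := mul_le_mul_of_nonneg_left (add_le_add hx2 hu2)
    (by positivity : 0 ≤ 1 + 1 / (ε / 2))
  have h8 := mul_nonneg hε2.le h6
  have h9 := hst x hx u hu β hB
  have h10 : ε / 2 * P.stage x u β = ε / 2 * (wsq Q (x - P.xs β) + wsq S (u - P.us β) +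
        ∑ i, w i * max 0 (P.cbar u (P.h x u β.2) i)) := by rw [h9]
  rw [hst x' hx' u hu β' (H.mem_B hβ')]
  linarith

theorem Assumptions.exists_Vf_perturbation (H : P.Assumptions) {ε : ℝ} (hε : 0 < ε) :
    ∃ p₀ > 0, ∃ C > 0, ∀ x ∈ P.X, ∀ x' ∈ P.X, ∀ β ∈ P.Bhat, ∀ β' ∈ P.Bhat, ∀ p ≤ p₀,
      ‖x - x'‖ ≤ p → ‖β - β'‖ ≤ p → P.Vf x' β' ≤ (1 + ε) * P.Vf x β + C * p ^ 2 := by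
  obtain ⟨Q, S, Pf, w, hQ, hS, hPf, hPfc, hw, hst, hVf⟩ := H.quad
  obtain ⟨L, hL, hLip⟩ := H.exists_target_lipschitz
  have hPf' : ∀ β ∈ P.Bhat, (Pf β).PosDef := fun β hβ => hPf β (H.mem_B hβ)
  obtain ⟨_, _, LP, hLP, hP⟩ := exists_wsq_bounds H.isCompact_Bhat hPfc hPf'
  -- Two relative errors occur, from the weight and from Young's inequality; this choice gives `(1 +
  -- e)² ≤ 1 + ε`.
  set e := min 1 (ε / 3) with he
  have he0 : 0 < e := by positivity
  have he1 : e ≤ 1 := min_le_left _ _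
  have he2 : 3 * e ≤ ε := by linarith [min_le_right 1 (ε / 3)]
  obtain ⟨p₀, hp₀, hp⟩ := exists_wsq_le_of_dist_lt H.isCompact_Bhat hPfc hPf' he0
  refine ⟨p₀, hp₀, (1 + 1 / e) * (LP * (1 + L) ^ 2), by positivity,
    fun x hx x' hx' β hβ β' hβ' p hpp h1 h2 => ?_⟩
  have hpn : 0 ≤ p := (norm_nonneg _).trans h1
  have h3 := (hLip β hβ β' hβ').1.trans (mul_le_mul_of_nonneg_left h2 hL.le)
  rw [hVf x hx β (H.mem_B hβ), hVf x' hx' β' (H.mem_B hβ')]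
  have h4 := wsq_add_le (hPf' β' hβ') he0 (x - P.xs β) ((x' - P.xs β') - (x - P.xs β))
  rw [add_sub_cancel] at h4
  have h5 : wsq (Pf β') ((x' - P.xs β') - (x - P.xs β)) ≤ LP * (1 + L) ^ 2 * p ^ 2 := by
    refine (hP β' hβ' _).2.trans ?_
    rw [mul_assoc, ← mul_pow]
    have := norm_sub_sub_sub_le h1 h3
    gcongr
    linarith
  have h6 := hp β hβ β' hβ' (by rw [dist_eq_norm]; exact h2.trans hpp) (x - P.xs β)
  have h7 := wsq_nonneg (hPf' β hβ) (x - P.xs β)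
  have h8 := mul_le_mul_of_nonneg_left h5 (by positivity : 0 ≤ 1 + 1 / e)
  have h9 := mul_le_mul_of_nonneg_left h6 (by positivity : 0 ≤ 1 + e)
  have h10 : (1 + e) * ((1 + e) * wsq (Pf β) (x - P.xs β)) ≤
      (1 + ε) * wsq (Pf β) (x - P.xs β) := by
    rw [← mul_assoc]
    exact mul_le_mul_of_nonneg_right (by nlinarith) h7
  linarith

theorem Assumptions.exists_VN_perturbation (H : P.Assumptions) (R : ℝ) {ε : ℝ} (hε : 0 < ε) :
    ∃ p₀ > 0, ∃ C > 0, ∀ x ∈ P.X, ∀ x' ∈ P.X, ‖x‖ ≤ R → ‖x'‖ ≤ R →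
      ∀ u : Fin P.N → Vec nu, (∀ i, u i ∈ P.U) → ∀ β ∈ P.Bhat, ∀ β' ∈ P.Bhat,
      ∀ p ≤ p₀, ‖x - x'‖ ≤ p → ‖β - β'‖ ≤ p →
      P.Vf (P.phi x' u β'.2 P.N) β' ≤ (1 + ε) * P.Vf (P.phi x u β.2 P.N) β + C * p ^ 2 ∧
      P.VN x' u β' ≤ (1 + ε) * P.VN x u β + C * p ^ 2 := by
  obtain ⟨R', hR', L, hL, hphi⟩ := H.exists_phi_lipschitz R P.N
  obtain ⟨p₁, hp₁, C₁, hC₁, h₁⟩ := H.exists_stage_perturbation R' hε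
  obtain ⟨p₂, hp₂, C₂, hC₂, h₂⟩ := H.exists_Vf_perturbation hε
  -- Along the horizon the states differ by at most `L * (p + p)`; the extra `1` lets the same bound
  -- cover the parameters.
  set M := 2 * L + 1 with hM
  have hM0 : 0 < M := by positivity
  refine ⟨min p₁ p₂ / M, by positivity, (C₂ + P.N * C₁) * M ^ 2, by positivity,
    fun x hx x' hx' hxR hxR' u hu β hβ β' hβ' p hp hxp hβp => ?_⟩
  have hpn : 0 ≤ p := (norm_nonneg _).trans hxp
  have hpM : M * p ≤ min p₁ p₂ := by rwa [le_div_iff₀ hM0, mul_comm] at hp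
  have hd := snd_mem_D (H.mem_B hβ)
  have hd' := snd_mem_D (H.mem_B hβ')
  have hdp : ‖β.2 - β'.2‖ ≤ p := (norm_snd_le (β - β')).trans hβp
  have hβM : ‖β - β'‖ ≤ M * p := hβp.trans (by nlinarith)
  have hk : ∀ k ≤ P.N, ‖P.phi x u β.2 k - P.phi x' u β'.2 k‖ ≤ M * p := fun k hk => by
    have := (hphi k hk x hx x' hx' hxR hxR' _ hd _ hd' u hu).2
    nlinarith
  have hT := h₂ _ (H.phi_mem hx hu hd P.N) _ (H.phi_mem hx' hu hd' P.N) β hβ β' hβ' (M * p)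
    (hpM.trans (min_le_right _ _)) (hk _ le_rfl) hβM
  have hS : ∀ k ∈ Finset.range P.N, P.stage (P.phi x' u β'.2 k) (extend u k) β' ≤
      (1 + ε) * P.stage (P.phi x u β.2 k) (extend u k) β + C₁ * (M * p) ^ 2 := fun k hkr => by
    have hkN := (Finset.mem_range.1 hkr).le
    exact h₁ _ (H.phi_mem hx hu hd k) _ (H.phi_mem hx' hu hd' k)
      (hphi k hkN x hx x' hx' hxR hxR' _ hd _ hd' u hu).1
      (hphi k hkN x' hx' x hx hxR' hxR _ hd' _ hd u hu).1 _ (H.extend_mem hu k) β hβ β' hβ' (M * p)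
      (hpM.trans (min_le_left _ _)) (hk k hkN) hβM
  have hS' := Finset.sum_le_sum hS
  rw [Finset.sum_add_distrib, ← Finset.mul_sum, Finset.sum_const, Finset.card_range,
    nsmul_eq_mul] at hS'
  have h3 : 0 ≤ P.N * C₁ * M ^ 2 * p ^ 2 := by positivity
  rw [VN_eq, VN_eq]
  constructor
  · linarith
  · linarith

/-! ### Mismatch corrections -/

theorem norm_le_alphaNorm (a : Alpha nr nu ny nw) : ‖a‖ ≤ alphaNorm a := by
  have h1 := sq_nonneg ‖a.1.1‖
  have h2 := sq_nonneg ‖a.1.2.1‖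
  have h3 := sq_nonneg ‖a.1.2.2‖
  have h4 := sq_nonneg ‖a.2‖
  simp only [Prod.norm_def, alphaNorm]
  exact max_le (max_le (Real.le_sqrt_of_sq_le (by linarith))
    (max_le (Real.le_sqrt_of_sq_le (by linarith)) (Real.le_sqrt_of_sq_le (by linarith))))
    (Real.le_sqrt_of_sq_le (by linarith))

theorem alphaNorm_nonneg (a : Alpha nr nu ny nw) : 0 ≤ alphaNorm a := Real.sqrt_nonneg _

/-- Without plant disturbance there is nothing to correct. -/
theorem Assumptions.nominal_corrections (H : P.Assumptions) {α : Alpha nr nu ny nw}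
    (hα : α ∈ P.Ac) : P.Δxs (α.1, 0) = 0 ∧ P.ds (α.1, 0) = 0 := by
  have hα' := H.mis.Ac_nominal α hα
  obtain ⟨h1, h2, h3, h4, h5⟩ := H.mis.solves _ hα'
  set d := P.ds (α.1, 0) with hd
  set x := P.xPs (α.1, 0) with hx
  simp only at h3 h4 h5
  have hus := H.us_mem h3
  obtain ⟨-, -, -, hz4, hz5⟩ := (H.target _ h3).1
  simp only at hz4 hz5
  rw [← H.cont.nominal_h x h1 _ hus] at h5
  rw [← H.cont.nominal_f x h1 _ hus] at h4
  -- The matched plant state is, by nominal consistency, a model steady state with zero disturbance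
  -- and the same output, so the target problem is feasible there.
  have hB : (α.1, (0 : Vec nd)) ∈ P.B := by
    refine ⟨h3.1, H.cons.D_zero, (x, P.us (α.1, d)), h1, hus, h4, ?_, ?_⟩
    · rw [h5] at hz4; exact hz4
    · rw [h5] at hz5; exact hz5
  obtain ⟨hx1, hx2, hx3, -, -⟩ := (H.target _ hB).1
  simp only at hx3
  -- The model target for zero disturbance also solves the matching equations, so uniqueness
  -- identifies it with the matched pair.
  have hsol : P.SolvesMatching (α.1, 0) (P.xs (α.1, 0)) 0 := by
    refine ⟨hx1, H.cons.D_zero, hB, ?_, ?_⟩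
    · simp only
      rw [← H.cont.nominal_f _ hx1 _ hx2]
      exact hx3
    · exact H.cont.nominal_h _ hx1 _ hx2
  obtain ⟨h6, h7⟩ := H.mis.unique _ hα' _ _ hsol
  refine ⟨?_, h7.symm⟩
  rw [Δxs, ← h6]
  simp only
  rw [← h7, sub_self]

theorem Assumptions.continuousOn_corrections (H : P.Assumptions) : ContinuousOn P.Δxs P.Ac := by
  refine H.mis.xPs_cont.sub (H.continuousOn_target.1.comp
    (continuous_fst.continuousOn.prodMk H.mis.ds_cont) fun α hα => H.matched_mem_Bhat hα)

theorem Assumptions.exists_corrections_modulus (H : P.Assumptions) : ∃ σ, ClassK σ ∧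
    ∀ α ∈ P.Ac, ∀ α' ∈ P.Ac, ‖P.Δxs α - P.Δxs α'‖ ≤ σ (alphaNorm (α - α')) ∧
      ‖P.ds α - P.ds α'‖ ≤ σ (alphaNorm (α - α')) ∧ ‖α.1 - α'.1‖ ≤ σ (alphaNorm (α - α')) := by
  obtain ⟨σ, hσ, h⟩ := exists_classK_modulus (f := fun α => (P.Δxs α, P.ds α, α.1))
    H.mis.Ac_compact
    (H.continuousOn_corrections.prodMk (H.mis.ds_cont.prodMk continuous_fst.continuousOn))
  refine ⟨σ, hσ, fun α hα α' hα' => ?_⟩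
  have h1 := h α hα α' hα'
  have h2 : σ (dist α α') ≤ σ (alphaNorm (α - α')) :=
    hσ.mono dist_nonneg (by rw [dist_eq_norm]; exact norm_le_alphaNorm _)
  have h3 := h1.trans h2
  rw [Prod.dist_eq, Prod.dist_eq, dist_eq_norm, dist_eq_norm, dist_eq_norm] at h3
  simp only [max_le_iff] at h3
  exact h3

/-- Compare `α` with `(α.1, 0)`, where both corrections vanish. -/
theorem Assumptions.exists_corrections_small (H : P.Assumptions) {ε : ℝ} (hε : 0 < ε) :
    ∃ δ > 0, ∀ α ∈ P.Ac, ‖α.2‖ ≤ δ → ‖P.Δxs α‖ ≤ ε ∧ ‖P.ds α‖ ≤ ε := by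
  obtain ⟨σ, hσ, h⟩ := H.exists_corrections_modulus
  obtain ⟨δ, hδ, hs⟩ := hσ.exists_le hε
  refine ⟨δ, hδ, fun α hα hw => ?_⟩
  have h1 := h α hα _ (H.mis.Ac_nominal α hα)
  have h2 : alphaNorm (α - (α.1, 0)) = ‖α.2‖ := by simp [alphaNorm]
  have h3 := hs ‖α.2‖ (norm_nonneg _) hw
  rw [(H.nominal_corrections hα).1, (H.nominal_corrections hα).2, h2, sub_zero, sub_zero] at h1
  exact ⟨h1.1.trans h3, h1.2.1.trans h3⟩

/-- Plant and model agree at zero disturbance, so their difference splits into the change of the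
plant from `(x, u, 0)` to `(x + Δx_s, u, w_P)` minus the change of the model from zero disturbance
to `d_s`. Each of these is Lipschitz in `(x, u)` with a small constant. -/
theorem Assumptions.exists_mismatch_increment (H : P.Assumptions) {q : ℕ}
    {φ : Vec n → Vec nu → Vec nd → Vec q} {φP : Vec n → Vec nu → Vec nw → Vec q}
    (hφ : ∃ F : Vec n × Vec nu × Vec nd → Vec q, ContDiff ℝ 1 F ∧
      ∀ x ∈ P.X, ∀ u ∈ P.U, ∀ d ∈ P.D, F (x, u, d) = φ x u d)
    (hφP : ∃ F : Vec n × Vec nu → Vec nw → Vec q,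
      (∀ w ∈ P.W, Differentiable ℝ (fun z => F z w)) ∧
      ContinuousOn (fun p : (Vec n × Vec nu) × Vec nw => fderiv ℝ (fun z => F z p.2) p.1)
        (Set.univ ×ˢ P.W) ∧
      ∀ x ∈ P.X, ∀ u ∈ P.U, ∀ w ∈ P.W, F (x, u) w = φP x u w)
    (hnom : ∀ x ∈ P.X, ∀ u ∈ P.U, φ x u 0 = φP x u 0) (R : ℝ) {ε : ℝ} (hε : 0 < ε) :
    ∃ δ > 0, ∀ α ∈ P.Ac, ‖α.2‖ ≤ δ → ∀ x ∈ P.X, ∀ x' ∈ P.X, ‖x‖ ≤ R → ‖x'‖ ≤ R →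
      ∀ u ∈ P.U, ∀ u' ∈ P.U, x + P.Δxs α ∈ P.X → x' + P.Δxs α ∈ P.X →
      ‖(φP (x + P.Δxs α) u α.2 - φ x u (P.ds α)) -
        (φP (x' + P.Δxs α) u' α.2 - φ x' u' (P.ds α))‖ ≤ ε * (‖x - x'‖ + ‖u - u'‖) := by
  obtain ⟨F, hF, hFφ⟩ := hφ
  obtain ⟨G, hG₁, hG₂, hGφ⟩ := hφP
  obtain ⟨R', -, hU, -⟩ := H.exists_input_bound
  have hε2 : 0 < ε / 2 := by positivity
  obtain ⟨δ₁, hδ₁, h₁⟩ := exists_small_increment_of_contDiff hF H.cons.D_compact H.cons.D_zero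
    (max R R') hε2
  obtain ⟨δ₂, hδ₂, h₂⟩ := exists_small_increment H.cons.W_compact H.cons.W_zero hG₁ hG₂
    (max R R') hε2
  obtain ⟨δ₃, hδ₃, h₃⟩ := H.exists_corrections_small (ε := min δ₁ δ₂) (by positivity)
  refine ⟨min δ₂ δ₃, by positivity,
    fun α hα hw x hx x' hx' hxR hxR' u hu u' hu' hxΔ hxΔ' => ?_⟩
  obtain ⟨hΔ, hd⟩ := h₃ α hα (hw.trans (min_le_right _ _))
  have hwW := (H.mis.Ac_subset α hα).2
  have hdD := (H.mis.solves α hα).2.1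
  have hb : ∀ (a : Vec n) (b : Vec nu), ‖a‖ ≤ R → ‖b‖ ≤ R' → ‖(a, b)‖ ≤ max R R' :=
    fun a b ha hb => max_le (ha.trans (le_max_left _ _)) (hb.trans (le_max_right _ _))
  have hz := hb x u hxR (hU u hu)
  have hz' := hb x' u' hxR' (hU u' hu')
  have e₁ := h₁ _ hdD (hd.trans (min_le_left _ _)) _ _ hz hz'
  have e₂ := h₂ _ hwW (hw.trans (min_le_left _ _)) (P.Δxs α, 0)
    (by simpa [Prod.norm_def] using hΔ.trans (min_le_right _ _)) _ _ hz hz'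
  simp only [Prod.mk_add_mk, add_zero] at e₁ e₂
  rw [hFφ x hx u hu _ hdD, hFφ x' hx' u' hu' _ hdD, hFφ x hx u hu _ H.cons.D_zero,
    hFφ x' hx' u' hu' _ H.cons.D_zero] at e₁
  rw [hGφ _ hxΔ u hu _ hwW, hGφ _ hxΔ' u' hu' _ hwW, hGφ x hx u hu _ H.cons.W_zero,
    hGφ x' hx' u' hu' _ H.cons.W_zero, ← hnom x hx u hu, ← hnom x' hx' u' hu'] at e₂
  have hn : ‖(x, u) - (x', u')‖ ≤ ‖x - x'‖ + ‖u - u'‖ := by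
    rw [Prod.mk_sub_mk, Prod.norm_def]
    exact max_le (le_add_of_nonneg_right (norm_nonneg _)) (le_add_of_nonneg_left (norm_nonneg _))
  have heq : (φP (x + P.Δxs α) u α.2 - φ x u (P.ds α)) -
        (φP (x' + P.Δxs α) u' α.2 - φ x' u' (P.ds α)) =
      ((φP (x + P.Δxs α) u α.2 - φ x u 0) - (φP (x' + P.Δxs α) u' α.2 - φ x' u' 0)) -
      ((φ x u (P.ds α) - φ x u 0) - (φ x' u' (P.ds α) - φ x' u' 0)) := by abel
  rw [heq]
  have h5 := mul_le_mul_of_nonneg_left hn hε.le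
  refine (norm_sub_le _ _).trans ?_
  linarith

/-- The mismatch between plant and model is small relative to the distance from the targets. -/
theorem Assumptions.exists_mismatch_bound (H : P.Assumptions) (R : ℝ) {ε : ℝ} (hε : 0 < ε) :
    ∃ δ > 0, ∀ α ∈ P.Ac, ‖α.2‖ ≤ δ → ∀ x ∈ P.X, ‖x‖ ≤ R → ∀ u ∈ P.U, x + P.Δxs α ∈ P.X →
      ‖P.fP (x + P.Δxs α) u α.2 - P.Δxs α - P.f x u (P.ds α)‖ ≤
        ε * (‖x - P.xs (α.1, P.ds α)‖ + ‖u - P.us (α.1, P.ds α)‖) ∧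
      ‖P.hP (x + P.Δxs α) u α.2 - P.h x u (P.ds α)‖ ≤
        ε * (‖x - P.xs (α.1, P.ds α)‖ + ‖u - P.us (α.1, P.ds α)‖) := by
  obtain ⟨R', -, hR'⟩ := H.exists_target_bound
  obtain ⟨δ₁, hδ₁, h₁⟩ := H.exists_mismatch_increment H.diff.f_diff H.diff.fP_diff H.cont.nominal_f
    (max R R') hε
  obtain ⟨δ₂, hδ₂, h₂⟩ := H.exists_mismatch_increment H.diff.h_diff H.diff.hP_diff H.cont.nominal_h
    (max R R') hε
  refine ⟨min δ₁ δ₂, by positivity, fun α hα hw x hx hxR u hu hxΔ => ?_⟩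
  have hβ := H.matched_mem_Bhat hα
  have hB := H.mem_B hβ
  obtain ⟨hP, -, -, hPf, hPh⟩ := H.mis.solves α hα
  have hxs : P.xs (α.1, P.ds α) + P.Δxs α = P.xPs α := by rw [Δxs]; abel
  have hxsf := (H.target _ hB).1.2.2.1
  simp only at hxsf
  have e₁ := h₁ α hα (hw.trans (min_le_left _ _)) x hx _ (H.xs_mem hB)
    (hxR.trans (le_max_left _ _)) ((hR' _ hβ).trans (le_max_right _ _)) u hu _ (H.us_mem hB) hxΔ
    (by rw [hxs]; exact hP)
  have e₂ := h₂ α hα (hw.trans (min_le_right _ _)) x hx _ (H.xs_mem hB)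
    (hxR.trans (le_max_left _ _)) ((hR' _ hβ).trans (le_max_right _ _)) u hu _ (H.us_mem hB) hxΔ
    (by rw [hxs]; exact hP)
  -- At the target the state mismatch is `x_{P,s} - x_s = Δx_s`, which produces the correction in
  -- the claim; the output mismatch there is zero.
  rw [hxs, ← hPf, ← hxsf] at e₁
  rw [hxs, ← hPh, sub_self, sub_zero] at e₂
  refine ⟨?_, e₂⟩
  have : P.xPs α - P.xs (α.1, P.ds α) = P.Δxs α := rfl
  rw [this] at e₁
  rwa [sub_right_comm]

/-! ### The estimator in the closed loop -/

variable {T : Trajectory n nu ny nd nw nr} {δw δα : ℝ}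

theorem IsClosedLoop.alpha_mem (hT : P.IsClosedLoop T δw δα) (h0 : T.α 0 ∈ P.Ac) (k : ℕ) :
    T.α k ∈ P.Ac := by
  cases k with
  | zero => exact h0
  | succ k => exact (hT.α_mem k).1

theorem Assumptions.output_mem (H : P.Assumptions) (hT : P.IsClosedLoop T δw δα)
    (h0 : T.α 0 ∈ P.Ac) {k : ℕ} (hu : P.input T k ∈ P.U) : P.output T k ∈ P.Y :=
  H.cont.hP_mem _ (hT.plant_mem k) _ hu _ (H.mis.Ac_subset _ (hT.alpha_mem h0 k)).2

theorem Assumptions.estimate_mem (H : P.Assumptions) (hT : P.IsClosedLoop T δw δα)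
    (h0 : T.α 0 ∈ P.Ac) {k : ℕ} (hu : ∀ i < k, P.input T i ∈ P.U) :
    T.xh k ∈ P.X ∧ T.dh k ∈ P.D := by
  have h := H.est.Φ_mem k T.xbar hT.xbar_mem T.dbar hT.dbar_mem (fun i => P.input T i)
    (fun i => hu i i.2) (fun i => P.output T i) (fun i => H.output_mem hT h0 (hu i i.2))
  have h1 := hT.est k
  rw [estimate] at h1
  rw [← h1] at h
  exact h

theorem Assumptions.estimate_zero (H : P.Assumptions) (hT : P.IsClosedLoop T δw δα) :
    T.xh 0 = T.xbar ∧ T.dh 0 = T.dbar := by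
  have h1 := hT.est 0
  rw [estimate, H.est.Φ_zero _ hT.xbar_mem _ hT.dbar_mem] at h1
  exact Prod.mk.inj h1

theorem estimate_congr {xbar : Vec n} {dbar : Vec nd} {u u' : ℕ → Vec nu} {y y' : ℕ → Vec ny}
    {k : ℕ} (hu : ∀ i < k, u i = u' i) (hy : ∀ i < k, y i = y' i) :
    P.estimate xbar dbar u y k = P.estimate xbar dbar u' y' k := by
  have h1 : (fun i : Fin k => u i) = fun i : Fin k => u' i := funext fun i => hu i i.2
  have h2 : (fun i : Fin k => y i) = fun i : Fin k => y' i := funext fun i => hy i i.2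
  rw [estimate, estimate, h1, h2]

/-- The estimator hypothesis speaks of infinite admissible trajectories. Suitable artificial ones
turn it into pointwise bounds on `Ve` and a one-step decrease needing admissible inputs only up to
time `k`. -/
theorem Assumptions.exists_estimator_decrease (H : P.Assumptions) :
    ∃ c₁ > 0, ∃ c₂, ∃ c₃ > 0, ∃ c₄ > 0, c₃ < c₂ ∧
    (∀ x ∈ P.X, ∀ d ∈ P.D, ∀ x' ∈ P.X, ∀ d' ∈ P.D,
      c₁ * (‖x - x'‖ ^ 2 + ‖d - d'‖ ^ 2) ≤ P.Ve x d x' d' ∧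
      P.Ve x d x' d' ≤ c₂ * (‖x - x'‖ ^ 2 + ‖d - d'‖ ^ 2)) ∧
    ∀ (T : Trajectory n nu ny nd nw nr) (δw δα : ℝ), P.IsClosedLoop T δw δα → T.α 0 ∈ P.Ac →
      ∀ k, (∀ i ≤ k, P.input T i ∈ P.U) →
      P.Ve (T.x (k + 1)) (P.ds (T.α (k + 1))) (T.xh (k + 1)) (T.dh (k + 1)) ≤
        P.Ve (T.x k) (P.ds (T.α k)) (T.xh k) (T.dh k) -
          c₃ * (‖T.x k - T.xh k‖ ^ 2 + ‖P.ds (T.α k) - T.dh k‖ ^ 2) +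
          c₄ * (‖T.x (k + 1) - P.f (T.x k) (P.input T k) (P.ds (T.α k))‖ ^ 2 +
            ‖P.ds (T.α (k + 1)) - P.ds (T.α k)‖ ^ 2 +
            ‖P.output T k - P.h (T.x k) (P.input T k) (P.ds (T.α k))‖ ^ 2) := by
  obtain ⟨c₁, hc₁, c₂, hc₂, c₃, hc₃, c₄, hc₄, h⟩ := H.est.lyapunov
  -- Adding `c₃` to the upper constant ensures that `1 - c₃ / c₂` is positive later.
  refine ⟨c₁, hc₁, c₂ + c₃, c₃, hc₃, c₄, hc₄, by linarith, ?_, ?_⟩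
  · intro x hx d hd x' hx' d' hd'
    -- The noise holds the state at `x`; since `Φ_0` is the identity, any quadruple occurs at time
    -- zero.
    have hn : P.NoisyTrajectory (fun _ => x) (fun _ => 0) (fun _ => d) (fun _ => P.h x 0 d)
        (fun _ => x - P.f x 0 d) (fun _ => 0) (fun _ => 0) :=
      ⟨fun _ => hx, fun _ => H.cons.U_zero, fun _ => hd,
        fun _ => H.cont.h_mem _ hx _ H.cons.U_zero _ hd, fun _ => by abel, fun _ => by simp,
        fun _ => by simp⟩
    have h0 := h x' hx' d' hd' _ _ _ _ _ _ _ hn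
      (fun k => (P.estimate x' d' (fun _ => 0) (fun _ => P.h x 0 d) k).1)
      (fun k => (P.estimate x' d' (fun _ => 0) (fun _ => P.h x 0 d) k).2) (fun _ => rfl) 0
    have he : P.estimate x' d' (fun _ => 0) (fun _ => P.h x 0 d) 0 = (x', d') :=
      H.est.Φ_zero _ hx' _ hd' _ _
    simp only [he] at h0
    have : 0 ≤ c₃ * (‖x - x'‖ ^ 2 + ‖d - d'‖ ^ 2) := by positivity
    exact ⟨h0.1, by linarith [h0.2.1]⟩
  · intro T δw δα hT hα0 k hu
    -- Freeze state and disturbance after time `k + 1` and set later inputs to zero. The estimates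
    -- up to time `k + 1` use only data up to time `k` and do not change.
    set x : ℕ → Vec n := fun i => T.x (min i (k + 1)) with hx
    set d : ℕ → Vec nd := fun i => P.ds (T.α (min i (k + 1))) with hd
    set u : ℕ → Vec nu := fun i => if i ≤ k then P.input T i else 0 with hud
    set y : ℕ → Vec ny := fun i => if i ≤ k then P.output T i else P.h (x i) (u i) (d i) with hy
    have hxm : ∀ i, x i ∈ P.X := fun i => hT.x_mem _
    have hdm : ∀ i, d i ∈ P.D := fun i => (H.mis.solves _ (hT.alpha_mem hα0 _)).2.1
    have hum : ∀ i, u i ∈ P.U := fun i => by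
      simp only [hud]
      split
      · exact hu i ‹_›
      · exact H.cons.U_zero
    have hn : P.NoisyTrajectory x u d y (fun i => x (i + 1) - P.f (x i) (u i) (d i))
        (fun i => d (i + 1) - d i) (fun i => y i - P.h (x i) (u i) (d i)) := by
      refine ⟨hxm, hum, hdm, fun i => ?_, fun _ => by abel, fun _ => by abel, fun _ => by abel⟩
      by_cases hi : i ≤ k
      · simp only [hy, hi, if_true]
        exact H.output_mem hT hα0 (hu i hi)
      · simp only [hy, hi, if_false]
        exact H.cont.h_mem _ (hxm i) _ (hum i) _ (hdm i)
    have h0 := h _ hT.xbar_mem _ hT.dbar_mem _ _ _ _ _ _ _ hn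
      (fun j => (P.estimate T.xbar T.dbar u y j).1)
      (fun j => (P.estimate T.xbar T.dbar u y j).2) (fun _ => rfl) k
    have he : ∀ j ≤ k + 1, P.estimate T.xbar T.dbar u y j = (T.xh j, T.dh j) := fun j hj => by
      rw [hT.est j]
      exact estimate_congr (fun i hi => by simp [hud, show i ≤ k by omega])
        (fun i hi => by simp [hy, show i ≤ k by omega])
    simp only [he k (by omega), he (k + 1) le_rfl] at h0
    have hxk : x k = T.x k := by simp [hx]
    have hxk1 : x (k + 1) = T.x (k + 1) := by simp [hx]
    have hdk : d k = P.ds (T.α k) := by simp [hd]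
    have hdk1 : d (k + 1) = P.ds (T.α (k + 1)) := by simp [hd]
    have huk : u k = P.input T k := by simp [hud]
    have hyk : y k = P.output T k := by simp [hy]
    rw [hxk, hxk1, hdk, hdk1, huk, hyk] at h0
    exact h0.2.2

/-! ### One step of the closed loop -/

/-- The squared norm of the estimate error at time `k`. -/
def estErr (P : OffsetFreeMPC n nu ny nd nw nr nc) (T : Trajectory n nu ny nd nw nr) (k : ℕ) : ℝ :=
  ‖T.x k - T.xh k‖ ^ 2 + ‖P.ds (T.α k) - T.dh k‖ ^ 2

/-- The value of `V_e` at time `k`. -/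
def VeAt (P : OffsetFreeMPC n nu ny nd nw nr nc) (T : Trajectory n nu ny nd nw nr) (k : ℕ) : ℝ :=
  P.Ve (T.x k) (P.ds (T.α k)) (T.xh k) (T.dh k)

theorem estErr_nonneg (T : Trajectory n nu ny nd nw nr) (k : ℕ) : 0 ≤ P.estErr T k := by
  unfold estErr
  positivity

/-- A modulus of continuity for the corrections, the disturbances and the setpoints on `𝒜_c`. -/
def IsModulus (P : OffsetFreeMPC n nu ny nd nw nr nc) (σ : ℝ → ℝ) : Prop :=
  ClassK σ ∧ ∀ α ∈ P.Ac, ∀ α' ∈ P.Ac, ‖P.Δxs α - P.Δxs α'‖ ≤ σ (alphaNorm (α - α')) ∧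
    ‖P.ds α - P.ds α'‖ ≤ σ (alphaNorm (α - α')) ∧ ‖α.1 - α'.1‖ ≤ σ (alphaNorm (α - α'))

/-- The increment of `α` at time `k`, measured by `σ`. -/
def drift (σ : ℝ → ℝ) (T : Trajectory n nu ny nd nw nr) (k : ℕ) : ℝ :=
  σ (alphaNorm (T.α (k + 1) - T.α k))

theorem IsModulus.drift_nonneg {σ : ℝ → ℝ} (hσ : P.IsModulus σ)
    (T : Trajectory n nu ny nd nw nr) (k : ℕ) : 0 ≤ drift σ T k :=
  hσ.1.nonneg (alphaNorm_nonneg _)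

/-- A closed-loop trajectory with inputs in `𝕌` up to time `k` and joint state at time `k` in
`Ŝ_N^ρ`, with estimate error at most one. -/
structure GoodAt (P : OffsetFreeMPC n nu ny nd nw nr nc) (ρ : ℝ)
    (T : Trajectory n nu ny nd nw nr) (k : ℕ) : Prop where
  loop : ∃ δw δα, P.IsClosedLoop T δw δα
  alpha_mem : ∀ i, T.α i ∈ P.Ac
  input_mem : ∀ i ≤ k, P.input T i ∈ P.U
  mem : (T.xh k, betaHat T k) ∈ P.ShatN ρ
  err : P.estErr T k ≤ 1

variable {k : ℕ} {ρ : ℝ}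

theorem GoodAt.x_mem (hg : P.GoodAt ρ T k) (i : ℕ) : T.x i ∈ P.X := by
  obtain ⟨_, _, h⟩ := hg.loop
  exact h.x_mem i

theorem GoodAt.plant_mem (hg : P.GoodAt ρ T k) (i : ℕ) : P.plantState T i ∈ P.X := by
  obtain ⟨_, _, h⟩ := hg.loop
  exact h.plant_mem i

theorem Assumptions.ds_mem (H : P.Assumptions) {α : Alpha nr nu ny nw} (hα : α ∈ P.Ac) :
    P.ds α ∈ P.D := (H.mis.solves α hα).2.1

/-! ### The mismatch as noise in the estimator inequality. -/

theorem add_sq_le_three {a b c M : ℝ} :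
    (M * (a + b + c)) ^ 2 ≤ 3 * M ^ 2 * (a ^ 2 + (b ^ 2 + c ^ 2)) := by
  have h : (a + b + c) ^ 2 ≤ 3 * (a ^ 2 + (b ^ 2 + c ^ 2)) := by
    nlinarith [sq_nonneg (a - b), sq_nonneg (a - c), sq_nonneg (b - c)]
  rw [mul_pow]
  nlinarith [sq_nonneg M]

/-- The mismatch is measured from the target at `d_s(α)`, the controller uses the target at `d̂`;
Lipschitz targets bridge the two. The input deviation is bounded by the target error because the
stage cost is at most the optimal value. -/
theorem Assumptions.exists_deviation_bound (H : P.Assumptions) (hρ : 0 < ρ) :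
    ∃ K > 0, ∀ T k, P.GoodAt ρ T k →
      (‖T.x k - P.xs ((T.α k).1, P.ds (T.α k))‖ +
        ‖P.input T k - P.us ((T.α k).1, P.ds (T.α k))‖) ^ 2 ≤
      K * (‖P.targetError T k‖ ^ 2 + P.estErr T k) := by
  obtain ⟨l, hl, C, hlC, hb⟩ := H.exists_VN0_bounds hρ
  obtain ⟨L, hL, hLip⟩ := H.exists_target_lipschitz
  have hC : 0 < C := hl.trans hlC
  have hκ := Real.sqrt_nonneg (C / l)
  refine ⟨3 * (1 + √(C / l) + 2 * L) ^ 2, by positivity, fun T k hg => ?_⟩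
  obtain ⟨h1, h2, h3⟩ := hb _ _ hg.mem
  set M := 1 + √(C / l) + 2 * L with hM
  set β : Beta nr nu ny nd := ((T.α k).1, P.ds (T.α k)) with hβ
  have hβm := H.matched_mem_Bhat (hg.alpha_mem k)
  have hβn : ‖betaHat T k - β‖ = ‖P.ds (T.α k) - T.dh k‖ := by
    rw [hβ, betaHat, Prod.mk_sub_mk, sub_self, Prod.norm_def, norm_zero,
      max_eq_right (norm_nonneg _), norm_sub_rev]
  obtain ⟨h4, h5⟩ := hLip _ hg.mem.2.1 _ hβm
  rw [hβn] at h4 h5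
  have hη : ‖P.targetError T k‖ = ‖T.xh k - P.xs (betaHat T k)‖ := rfl
  have hu : P.input T k = P.kappaN (T.xh k) (betaHat T k) := rfl
  have h6 : ‖P.input T k - P.us (betaHat T k)‖ ≤ √(C / l) * ‖P.targetError T k‖ := by
    rw [hu, hη]
    apply le_of_sq_le_sq _ (by positivity)
    rw [mul_pow, Real.sq_sqrt (by positivity), div_mul_eq_mul_div, le_div_iff₀ hl]
    have := mul_nonneg hl.le (sq_nonneg ‖T.xh k - P.xs (betaHat T k)‖)
    linarith
  have h7 : ‖T.x k - P.xs β‖ ≤ ‖T.x k - T.xh k‖ + ‖P.targetError T k‖ +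
      L * ‖P.ds (T.α k) - T.dh k‖ := by
    have e : T.x k - P.xs β = (T.x k - T.xh k) + (T.xh k - P.xs (betaHat T k)) +
        (P.xs (betaHat T k) - P.xs β) := by abel
    rw [e, hη]
    exact (norm_add₃_le).trans (by linarith)
  have h8 : ‖P.input T k - P.us β‖ ≤ √(C / l) * ‖P.targetError T k‖ +
      L * ‖P.ds (T.α k) - T.dh k‖ := by
    have e : P.input T k - P.us β = (P.input T k - P.us (betaHat T k)) +
        (P.us (betaHat T k) - P.us β) := by abel
    rw [e]
    exact (norm_add_le _ _).trans (by linarith)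
  refine le_trans ?_ add_sq_le_three
  have n1 := norm_nonneg (P.targetError T k)
  have n2 := norm_nonneg (T.x k - T.xh k)
  have n3 := norm_nonneg (P.ds (T.α k) - T.dh k)
  have n4 := mul_nonneg hκ n2
  have n5 := mul_nonneg hκ n3
  have n6 := mul_nonneg hL.le n1
  have n7 := mul_nonneg hL.le n2
  refine pow_le_pow_left₀ (by positivity) ?_ 2
  rw [hM]
  linarith

theorem Assumptions.exists_state_bound (H : P.Assumptions) (hρ : 0 < ρ) :
    ∃ R > 0, ∀ T k, P.GoodAt ρ T k → ‖P.targetError T k‖ ^ 2 ≤ R ∧ ‖T.xh k‖ ≤ R ∧ ‖T.x k‖ ≤ R := by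
  obtain ⟨l, hl, C, hlC, hb⟩ := H.exists_VN0_bounds hρ
  obtain ⟨R, hR, hxs⟩ := H.exists_target_bound
  refine ⟨1 + (ρ / l + 1) + R, by positivity, fun T k hg => ?_⟩
  obtain ⟨h1, h2, -⟩ := hb _ _ hg.mem
  have h3 : P.VN0 (T.xh k) (betaHat T k) ≤ ρ := hg.mem.2.2
  have hη : ‖P.targetError T k‖ = ‖T.xh k - P.xs (betaHat T k)‖ := rfl
  have h4 : ‖P.targetError T k‖ ^ 2 ≤ ρ / l := by
    rw [hη, le_div_iff₀ hl]
    have := mul_nonneg hl.le (sq_nonneg ‖P.kappaN (T.xh k) (betaHat T k) - P.us (betaHat T k)‖)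
    linarith
  have h5 : ‖P.targetError T k‖ ≤ ρ / l + 1 := by
    nlinarith [sq_nonneg (‖P.targetError T k‖ - 1)]
  have h6 := hxs _ hg.mem.2.1
  have h7 : ‖T.xh k‖ ≤ ‖P.targetError T k‖ + ‖P.xs (betaHat T k)‖ := by
    have := norm_add_le (T.xh k - P.xs (betaHat T k)) (P.xs (betaHat T k))
    rwa [sub_add_cancel] at this
  have h8 : ‖T.x k - T.xh k‖ ≤ 1 := by
    have := hg.err
    unfold estErr at this
    nlinarith [sq_nonneg ‖P.ds (T.α k) - T.dh k‖, norm_nonneg (T.x k - T.xh k)]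
  have h9 : ‖T.x k‖ ≤ ‖T.x k - T.xh k‖ + ‖T.xh k‖ := by
    have := norm_add_le (T.x k - T.xh k) (T.xh k)
    rwa [sub_add_cancel] at this
  have h10 : 0 < ρ / l := by positivity
  exact ⟨by linarith, by linarith, by linarith⟩

/-- The process noise is the mismatch minus the increment of `Δx_s(α)`, the output noise is the
mismatch alone. -/
theorem Assumptions.exists_disturbance_bound (H : P.Assumptions) (hρ : 0 < ρ) {σ : ℝ → ℝ}
    (hσ : P.IsModulus σ) {ε : ℝ} (hε : 0 < ε) :
    ∃ δ > 0, ∀ T k, P.GoodAt ρ T k → ‖(T.α k).2‖ ≤ δ →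
      ‖T.x (k + 1) - P.f (T.x k) (P.input T k) (P.ds (T.α k))‖ ^ 2 ≤
        ε * (‖P.targetError T k‖ ^ 2 + P.estErr T k) + 2 * drift σ T k ^ 2 ∧
      ‖P.output T k - P.h (T.x k) (P.input T k) (P.ds (T.α k))‖ ^ 2 ≤
        ε * (‖P.targetError T k‖ ^ 2 + P.estErr T k) := by
  obtain ⟨K, hK, hdev⟩ := H.exists_deviation_bound hρ
  obtain ⟨R, hR, hbd⟩ := H.exists_state_bound hρ
  -- Chosen so that `2 (√(ε / (2K)) D)² ≤ ε Z`, where the `2` comes from squaring a sum of two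
  -- terms.
  have he : 0 < √(ε / (2 * K)) := Real.sqrt_pos.2 (by positivity)
  obtain ⟨δ, hδ, hmis⟩ := H.exists_mismatch_bound R he
  refine ⟨δ, hδ, fun T k hg hw => ?_⟩
  have hα := hg.alpha_mem k
  obtain ⟨h1, h2⟩ := hmis _ hα hw _ (hg.x_mem k) (hbd T k hg).2.2 _ (hg.input_mem k le_rfl)
    (hg.plant_mem k)
  have h3 := hdev T k hg
  set D := ‖T.x k - P.xs ((T.α k).1, P.ds (T.α k))‖ +
        ‖P.input T k - P.us ((T.α k).1, P.ds (T.α k))‖ with hD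
  set Z := ‖P.targetError T k‖ ^ 2 + P.estErr T k with hZ
  have h4 : 2 * (√(ε / (2 * K)) * D) ^ 2 ≤ ε * Z := by
    rw [mul_pow, Real.sq_sqrt (by positivity)]
    have : ε / (2 * K) * D ^ 2 ≤ ε / (2 * K) * (K * Z) :=
      mul_le_mul_of_nonneg_left h3 (by positivity)
    have e : ε / (2 * K) * (K * Z) = ε * Z / 2 := by field_simp
    linarith
  have h5 : T.x (k + 1) - P.f (T.x k) (P.input T k) (P.ds (T.α k)) =
      (P.fP (T.x k + P.Δxs (T.α k)) (P.input T k) (T.α k).2 - P.Δxs (T.α k) -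
        P.f (T.x k) (P.input T k) (P.ds (T.α k))) - (P.Δxs (T.α (k + 1)) - P.Δxs (T.α k)) := by
    obtain ⟨_, _, hT⟩ := hg.loop
    rw [hT.x_step k, plantState]
    abel
  have h6 : ‖P.Δxs (T.α (k + 1)) - P.Δxs (T.α k)‖ ≤ drift σ T k :=
    (hσ.2 _ (hg.alpha_mem (k + 1)) _ hα).1
  constructor
  · rw [h5]
    have h7 := (norm_sub_le _ _).trans (add_le_add h1 h6)
    have h8 := pow_le_pow_left₀ (norm_nonneg _) h7 2
    nlinarith [sq_nonneg (√(ε / (2 * K)) * D - drift σ T k)]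
  · have h8 := pow_le_pow_left₀ (norm_nonneg _) h2 2
    have h9 : ‖P.output T k - P.h (T.x k) (P.input T k) (P.ds (T.α k))‖ ^ 2 ≤
      (√(ε / (2 * K)) * D) ^ 2 := h8
    nlinarith [sq_nonneg (√(ε / (2 * K)) * D)]

theorem Assumptions.exists_VeAt_decrease (H : P.Assumptions) (hρ : 0 < ρ) {σ : ℝ → ℝ}
    (hσ : P.IsModulus σ) : ∃ c₁ > 0, ∃ c₂, ∃ c₃ > 0, ∃ C > 0, c₃ < c₂ ∧
    (∀ T : Trajectory n nu ny nd nw nr, ∀ k, T.x k ∈ P.X → T.α k ∈ P.Ac → T.xh k ∈ P.X →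
      T.dh k ∈ P.D → c₁ * P.estErr T k ≤ P.VeAt T k ∧ P.VeAt T k ≤ c₂ * P.estErr T k) ∧
    ∀ ε > 0, ∃ δ > 0, ∀ T k, P.GoodAt ρ T k → ‖(T.α k).2‖ ≤ δ →
      P.VeAt T (k + 1) ≤ P.VeAt T k - c₃ * P.estErr T k + ε * ‖P.targetError T k‖ ^ 2 +
        C * drift σ T k ^ 2 := by
  obtain ⟨c₁, hc₁, c₂, c₃, hc₃, c₄, hc₄, hc, hb, hdec⟩ := H.exists_estimator_decrease
  refine ⟨c₁, hc₁, c₂, c₃ / 2, by positivity, 3 * c₄, by positivity, by linarith,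
    fun T k h1 h2 h3 h4 => hb _ h1 _ (H.ds_mem h2) _ h3 _ h4, fun ε hε => ?_⟩
  -- Two noise terms with weight `c₄` contribute; half of the original `c₃` absorbs their share of
  -- the estimate error.
  obtain ⟨δ, hδ, hd⟩ := H.exists_disturbance_bound hρ hσ (ε := min ε (c₃ / 2) / (2 * c₄))
    (by positivity)
  refine ⟨δ, hδ, fun T k hg hw => ?_⟩
  obtain ⟨δw, δα, hT⟩ := hg.loop
  obtain ⟨h1, h2⟩ := hd T k hg hw
  have h3 := hdec T δw δα hT (hg.alpha_mem 0) k hg.input_mem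
  have h4 : ‖P.ds (T.α (k + 1)) - P.ds (T.α k)‖ ^ 2 ≤ drift σ T k ^ 2 :=
    pow_le_pow_left₀ (norm_nonneg _) (hσ.2 _ (hg.alpha_mem (k + 1)) _ (hg.alpha_mem k)).2.1 2
  have h5 := mul_le_mul_of_nonneg_left (add_le_add (add_le_add h1 h4) h2) hc₄.le
  have hE : 0 ≤ P.estErr T k := estErr_nonneg T k
  have h6 : 2 * c₄ * (min ε (c₃ / 2) / (2 * c₄) * (‖P.targetError T k‖ ^ 2 + P.estErr T k)) ≤
      ε * ‖P.targetError T k‖ ^ 2 + c₃ / 2 * P.estErr T k := by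
    have e : 2 * c₄ * (min ε (c₃ / 2) / (2 * c₄) * (‖P.targetError T k‖ ^ 2 + P.estErr T k)) =
      min ε (c₃ / 2) * ‖P.targetError T k‖ ^ 2 + min ε (c₃ / 2) * P.estErr T k := by field_simp
    rw [e]
    exact add_le_add (mul_le_mul_of_nonneg_right (min_le_left _ _) (sq_nonneg _))
      (mul_le_mul_of_nonneg_right (min_le_right _ _) hE)
  change P.VeAt T (k + 1) ≤ P.VeAt T k - c₃ * P.estErr T k + _ at h3
  linarith
-- Change of the estimates in one step.
theorem GoodAt.estimate_succ_mem (hg : P.GoodAt ρ T k) (H : P.Assumptions) :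
    T.xh (k + 1) ∈ P.X ∧ T.dh (k + 1) ∈ P.D := by
  obtain ⟨_, _, hT⟩ := hg.loop
  exact H.estimate_mem hT (hg.alpha_mem 0) fun i hi => hg.input_mem i (by omega)

theorem GoodAt.dh_mem (hg : P.GoodAt ρ T k) (H : P.Assumptions) : T.dh k ∈ P.D :=
  snd_mem_D (H.mem_B hg.mem.2.1)

/-- A measure for the change of the estimates in one step, relative to the model prediction. -/
def stepSize (P : OffsetFreeMPC n nu ny nd nw nr nc) (σ : ℝ → ℝ)
    (T : Trajectory n nu ny nd nw nr) (k : ℕ) : ℝ :=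
  ‖T.x k - T.xh k‖ + ‖P.ds (T.α k) - T.dh k‖ +
    ‖T.x (k + 1) - T.xh (k + 1)‖ + ‖P.ds (T.α (k + 1)) - T.dh (k + 1)‖ +
    ‖T.x (k + 1) - P.f (T.x k) (P.input T k) (P.ds (T.α k))‖ + drift σ T k

/-- Insert the true state and disturbance: the prediction from the estimates differs from the new
estimate by errors before and after the step and the noise between. -/
theorem Assumptions.exists_step_le_stepSize (H : P.Assumptions) (hρ : 0 < ρ) {σ : ℝ → ℝ}
    (hσ : P.IsModulus σ) : ∃ L > 0, ∀ T k, P.GoodAt ρ T k →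
      ‖P.f (T.xh k) (P.input T k) (T.dh k) - T.xh (k + 1)‖ ≤ L * stepSize P σ T k ∧
      ‖betaHat T k - betaHat T (k + 1)‖ ≤ L * stepSize P σ T k := by
  obtain ⟨R, hR, hbd⟩ := H.exists_state_bound hρ
  obtain ⟨L, hL, hLip⟩ := H.exists_model_lipschitz H.diff.f_diff R
  refine ⟨L + 1, by positivity, fun T k hg => ?_⟩
  have n1 := norm_nonneg (T.x k - T.xh k)
  have n2 := norm_nonneg (P.ds (T.α k) - T.dh k)
  have n3 := norm_nonneg (T.x (k + 1) - T.xh (k + 1))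
  have n4 := norm_nonneg (P.ds (T.α (k + 1)) - T.dh (k + 1))
  have n5 := norm_nonneg (T.x (k + 1) - P.f (T.x k) (P.input T k) (P.ds (T.α k)))
  have n6 := hσ.drift_nonneg T k
  have n7 : 0 ≤ L * (‖T.x (k + 1) - T.xh (k + 1)‖ + ‖P.ds (T.α (k + 1)) - T.dh (k + 1)‖ +
    ‖T.x (k + 1) - P.f (T.x k) (P.input T k) (P.ds (T.α k))‖ + drift σ T k) := by positivity
  have n8 : 0 ≤ L * (‖T.x k - T.xh k‖ + ‖P.ds (T.α k) - T.dh k‖) := by positivity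
  obtain ⟨-, hb1, hb2⟩ := hbd T k hg
  have hu := hg.input_mem k le_rfl
  constructor
  · have h1 := hLip _ hg.mem.1.1 _ (hg.x_mem k) hb1 hb2 _ hu _ hu _ (hg.dh_mem H) _
      (H.ds_mem (hg.alpha_mem k))
    rw [sub_self, norm_zero, add_zero, norm_sub_rev (T.xh k), norm_sub_rev (T.dh k)] at h1
    have e : P.f (T.xh k) (P.input T k) (T.dh k) - T.xh (k + 1) =
        (P.f (T.xh k) (P.input T k) (T.dh k) - P.f (T.x k) (P.input T k) (P.ds (T.α k))) -
        (T.x (k + 1) - P.f (T.x k) (P.input T k) (P.ds (T.α k))) +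
        (T.x (k + 1) - T.xh (k + 1)) := by abel
    rw [e]
    refine (norm_add_le _ _).trans ((add_le_add_left (norm_sub_le _ _) _).trans ?_)
    unfold stepSize
    linarith
  · obtain ⟨-, h2, h3⟩ := hσ.2 _ (hg.alpha_mem (k + 1)) _ (hg.alpha_mem k)
    rw [betaHat, betaHat, Prod.mk_sub_mk, Prod.norm_def]
    rw [norm_sub_rev] at h3
    refine max_le (h3.trans ?_) ?_
    · change drift σ T k ≤ _
      unfold stepSize
      linarith
    · have e : T.dh k - T.dh (k + 1) = (P.ds (T.α (k + 1)) - T.dh (k + 1)) -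
          (P.ds (T.α (k + 1)) - P.ds (T.α k)) - (P.ds (T.α k) - T.dh k) := by abel
      have h4 := norm_sub_le ((P.ds (T.α (k + 1)) - T.dh (k + 1)) -
          (P.ds (T.α (k + 1)) - P.ds (T.α k))) (P.ds (T.α k) - T.dh k)
      have h5 := norm_sub_le (P.ds (T.α (k + 1)) - T.dh (k + 1))
          (P.ds (T.α (k + 1)) - P.ds (T.α k))
      change _ ≤ drift σ T k at h2
      rw [e]
      unfold stepSize
      linarith

theorem sq_sum_six_le (a b c d e f : ℝ) : (a + b + c + d + e + f) ^ 2 ≤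
    6 * (a ^ 2 + b ^ 2 + (c ^ 2 + d ^ 2) + e ^ 2 + f ^ 2) := by
  nlinarith [sq_nonneg (a - b), sq_nonneg (a - c), sq_nonneg (a - d), sq_nonneg (a - e),
    sq_nonneg (a - f), sq_nonneg (b - c), sq_nonneg (b - d), sq_nonneg (b - e), sq_nonneg (b - f),
    sq_nonneg (c - d), sq_nonneg (c - e), sq_nonneg (c - f), sq_nonneg (d - e), sq_nonneg (d - f),
    sq_nonneg (e - f)]

/-- The next estimate error is eliminated through the decrease of `V_e`. It matters that `B` is
fixed before `ε`, so the gain from the target error can be made small afterwards. -/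
theorem Assumptions.exists_stepSize_bound (H : P.Assumptions) (hρ : 0 < ρ) {σ : ℝ → ℝ}
    (hσ : P.IsModulus σ) : ∃ B > 0, ∀ ε > 0, ∃ δ > 0, ∀ T k, P.GoodAt ρ T k → ‖(T.α k).2‖ ≤ δ →
      stepSize P σ T k ^ 2 ≤ B * (P.estErr T k + drift σ T k ^ 2) +
        ε * ‖P.targetError T k‖ ^ 2 := by
  obtain ⟨c₁, hc₁, c₂, c₃, hc₃, C, hC, hc, hb, hdec⟩ := H.exists_VeAt_decrease hρ hσ
  have hc₂ : 0 < c₂ := hc₃.trans hc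
  refine ⟨6 * (c₂ / c₁ + C / c₁ + 4), by positivity, fun ε hε => ?_⟩
  set ε' := min 1 (ε / (6 * (1 / c₁ + 1))) with hε'
  have hε'0 : 0 < ε' := by positivity
  obtain ⟨δ₁, hδ₁, h₁⟩ := hdec ε' hε'0
  obtain ⟨δ₂, hδ₂, h₂⟩ := H.exists_disturbance_bound hρ hσ hε'0
  refine ⟨min δ₁ δ₂, by positivity, fun T k hg hw => ?_⟩
  have d1 := h₁ T k hg (hw.trans (min_le_left _ _))
  obtain ⟨d2, -⟩ := h₂ T k hg (hw.trans (min_le_right _ _))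
  have hs := hg.estimate_succ_mem H
  have b1 := (hb T k (hg.x_mem k) (hg.alpha_mem k) hg.mem.1.1 (hg.dh_mem H)).2
  have b2 := (hb T (k + 1) (hg.x_mem _) (hg.alpha_mem _) hs.1 hs.2).1
  have hE : 0 ≤ P.estErr T k := estErr_nonneg T k
  have hη := sq_nonneg ‖P.targetError T k‖
  have hd := sq_nonneg (drift σ T k)
  have hE' : P.estErr T (k + 1) ≤ c₂ / c₁ * P.estErr T k +
      ε' * (1 / c₁) * ‖P.targetError T k‖ ^ 2 + C / c₁ * drift σ T k ^ 2 := by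
    have e : c₂ / c₁ * P.estErr T k +
      ε' * (1 / c₁) * ‖P.targetError T k‖ ^ 2 + C / c₁ * drift σ T k ^ 2 =
      (c₂ * P.estErr T k + ε' * ‖P.targetError T k‖ ^ 2 + C * drift σ T k ^ 2) / c₁ := by
      field_simp
    rw [e, le_div_iff₀ hc₁, mul_comm]
    have := mul_nonneg hc₃.le hE
    linarith
  have hsq := sq_sum_six_le ‖T.x k - T.xh k‖ ‖P.ds (T.α k) - T.dh k‖
    ‖T.x (k + 1) - T.xh (k + 1)‖ ‖P.ds (T.α (k + 1)) - T.dh (k + 1)‖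
    ‖T.x (k + 1) - P.f (T.x k) (P.input T k) (P.ds (T.α k))‖ (drift σ T k)
  change stepSize P σ T k ^ 2 ≤ 6 * (P.estErr T k + P.estErr T (k + 1) + _ + _) at hsq
  have hε1 : ε' * P.estErr T k ≤ 1 * P.estErr T k :=
    mul_le_mul_of_nonneg_right (min_le_left _ _) hE
  have hε2 : ε' * (6 * (1 / c₁ + 1)) ≤ ε := by
    rw [← le_div_iff₀ (by positivity)]
    exact min_le_right _ _
  have hε3 := mul_le_mul_of_nonneg_right hε2 hη
  have q1 : 0 ≤ C / c₁ * P.estErr T k := by positivity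
  have q2 : 0 ≤ c₂ / c₁ * drift σ T k ^ 2 := by positivity
  linarith

/-! ### Decrease of the optimal value and setpoint tracking. -/

theorem Assumptions.exists_model_bound (H : P.Assumptions) (R : ℝ) :
    ∃ R' > 0, ∀ x ∈ P.X, ‖x‖ ≤ R → ∀ u ∈ P.U, ∀ d ∈ P.D, ‖P.f x u d‖ ≤ R' ∧ ‖P.h x u d‖ ≤ R' := by
  obtain ⟨R₁, hR₁, hU, hD⟩ := H.exists_input_bound
  obtain ⟨L₁, hL₁, h₁⟩ := H.exists_model_lipschitz H.diff.f_diff (max R 0)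
  obtain ⟨L₂, hL₂, h₂⟩ := H.exists_model_lipschitz H.diff.h_diff (max R 0)
  have h0 : (0 : ℝ) ≤ max R 0 := le_max_right _ _
  refine ⟨(L₁ + L₂) * (max R 0 + R₁ + R₁), by positivity, fun x hx hxR u hu d hd => ?_⟩
  have hxR' := hxR.trans (le_max_left R 0)
  have e₁ := h₁ x hx 0 H.cons.X_zero hxR' (by simp) u hu 0 H.cons.U_zero d hd 0 H.cons.D_zero
  have e₂ := h₂ x hx 0 H.cons.X_zero hxR' (by simp) u hu 0 H.cons.U_zero d hd 0 H.cons.D_zero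
  rw [H.cont.f_zero] at e₁
  rw [H.cont.h_zero] at e₂
  simp only [sub_zero] at e₁ e₂
  have hs : ‖x‖ + ‖u‖ + ‖d‖ ≤ max R 0 + R₁ + R₁ := by linarith [hU u hu, hD d hd]
  have g₁ := mul_le_mul_of_nonneg_left hs hL₁.le
  have g₂ := mul_le_mul_of_nonneg_left hs hL₂.le
  have k₁ : 0 ≤ L₁ * (max R 0 + R₁ + R₁) := by positivity
  have k₂ : 0 ≤ L₂ * (max R 0 + R₁ + R₁) := by positivity
  rw [add_mul]
  exact ⟨by linarith, by linarith⟩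

/-- The shifted sequence, feasible at the predicted state, stays feasible at the actual estimate
when the discrepancy is small, and its cost bounds the new optimal value. -/
theorem Assumptions.exists_value_decrease (H : P.Assumptions) (hρ : 0 < ρ) {σ : ℝ → ℝ}
    (hσ : P.IsModulus σ) : ∃ l > 0, ∃ C > 0, ∃ τ₀ > 0, ∃ δ > 0, ∃ s₀ > 0, ∀ T k, P.GoodAt ρ T k →
      P.VeAt T k ≤ τ₀ → P.VeAt T (k + 1) ≤ τ₀ → ‖(T.α k).2‖ ≤ δ → drift σ T k ≤ s₀ →
      betaHat T (k + 1) ∈ P.Bhat ∧ (T.xh (k + 1), betaHat T (k + 1)) ∈ P.SN ∧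
      P.VN0 (T.xh (k + 1)) (betaHat T (k + 1)) ≤ P.VN0 (T.xh k) (betaHat T k) -
        l * ‖P.targetError T k‖ ^ 2 + C * (P.estErr T k + drift σ T k ^ 2) := by
  obtain ⟨l, hl, C₂, hlC, hb⟩ := H.exists_VN0_bounds hρ
  have hC₂ : 0 < C₂ := hl.trans hlC
  obtain ⟨θ, hθ0, hθ1, hshift⟩ := H.exists_shift
  obtain ⟨R, hR, hbd⟩ := H.exists_state_bound hρ
  obtain ⟨R₁, hR₁, hfb⟩ := H.exists_model_bound R
  have hθ : 0 < 1 - θ := by linarith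
  have hcf := P.cf_pos
  -- The relative error may use half of the terminal margin and a quarter of the decrease `l
  -- |δx̂|²`.
  set e := min ((1 - θ) / 2) (l / (4 * C₂)) with he
  have he0 : 0 < e := by positivity
  have heθ : e * θ ≤ (1 - θ) / 2 := by
    nlinarith [min_le_left ((1 - θ) / 2) (l / (4 * C₂))]
  have heC : e * C₂ ≤ l / 4 := by
    have := mul_le_mul_of_nonneg_right (min_le_right ((1 - θ) / 2) (l / (4 * C₂))) hC₂.le
    have e2 : l / (4 * C₂) * C₂ = l / 4 := by field_simp
    linarith
  obtain ⟨p₀, hp₀, C₅, hC₅, hpert⟩ := H.exists_VN_perturbation (R₁ + 1) he0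
  obtain ⟨L, hL, hstep⟩ := H.exists_step_le_stepSize hρ hσ
  obtain ⟨B, hB, hsize⟩ := H.exists_stepSize_bound hρ hσ
  obtain ⟨c₁, hc₁, c₂, c₃, hc₃, C, hC, hc, hVe, -⟩ := H.exists_VeAt_decrease hρ hσ
  -- Bound for the squared discrepancy: the state stays in the ball of radius `R₁ + 1`, the
  -- perturbation lemma applies, and the other half of the terminal margin suffices.
  set μ := min 1 (min (p₀ ^ 2) (P.cf * (1 - θ) / (2 * C₅))) with hμ
  have hμ0 : 0 < μ := by positivity
  -- The target error contributes at most `μ / 2` to the squared discrepancy and at most another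
  -- quarter of the decrease.
  set ε := min (μ / (2 * L ^ 2 * R)) (l / (4 * C₅ * L ^ 2)) with hε
  have hε0 : 0 < ε := by positivity
  obtain ⟨δ, hδ, hsz⟩ := hsize ε hε0
  have hδ₀ := H.mis.δ₀_pos
  set t := μ / (4 * L ^ 2 * B) with ht
  have ht0 : 0 < t := by positivity
  refine ⟨l / 2, by positivity, C₅ * L ^ 2 * B, by positivity,
    -- The first entry keeps the next `d̂` within `δ₀` of `d_s(α)`; the second, with `√t` for the
    -- drift, bounds the remaining discrepancy by `μ / 2`.
    min (c₁ * P.δ₀ ^ 2) (c₁ * t), by positivity, δ, hδ, √t, by positivity,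
    fun T k hg hV hV' hw hs => ?_⟩
  have hxs := hg.estimate_succ_mem H
  have b1 := (hVe T k (hg.x_mem k) (hg.alpha_mem k) hg.mem.1.1 (hg.dh_mem H)).1
  have b2 := (hVe T (k + 1) (hg.x_mem _) (hg.alpha_mem _) hxs.1 hxs.2).1
  have hE : P.estErr T k ≤ t :=
    le_of_mul_le_mul_left (b1.trans (hV.trans (min_le_right _ _))) hc₁
  have hE' : P.estErr T (k + 1) ≤ P.δ₀ ^ 2 :=
    le_of_mul_le_mul_left (b2.trans (hV'.trans (min_le_left _ _))) hc₁
  have hd0 := hσ.drift_nonneg T k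
  have hdr : drift σ T k ^ 2 ≤ t := by
    have := pow_le_pow_left₀ hd0 hs 2
    rwa [Real.sq_sqrt ht0.le] at this
  obtain ⟨hη, hxh, -⟩ := hbd T k hg
  have hη0 := sq_nonneg ‖P.targetError T k‖
  have hEn := estErr_nonneg (P := P) T k
  have hβ := hg.mem.2.1
  have hβ' : betaHat T (k + 1) ∈ P.Bhat := by
    refine ⟨hxs.2, P.ds (T.α (k + 1)), H.mis.ds_mem _ (hg.alpha_mem _), ?_⟩
    apply le_of_sq_le_sq _ hδ₀.le
    have := sq_nonneg ‖T.x (k + 1) - T.xh (k + 1)‖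
    unfold estErr at hE'
    change ‖P.ds (T.α (k + 1)) - T.dh (k + 1)‖ ^ 2 ≤ _
    linarith
  have hsz' := hsz T k hg hw
  set p := L * stepSize P σ T k with hp
  have hp2 : p ^ 2 ≤ L ^ 2 * B * (P.estErr T k + drift σ T k ^ 2) +
      L ^ 2 * ε * ‖P.targetError T k‖ ^ 2 := by
    rw [hp, mul_pow]
    have := mul_le_mul_of_nonneg_left hsz' (sq_nonneg L)
    linarith
  have hpμ : p ^ 2 ≤ μ := by
    have g1 : L ^ 2 * B * (P.estErr T k + drift σ T k ^ 2) ≤ L ^ 2 * B * (t + t) :=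
      mul_le_mul_of_nonneg_left (add_le_add hE hdr) (by positivity)
    have g2 : L ^ 2 * B * (t + t) = μ / 2 := by rw [ht]; field_simp; ring
    have g3 : L ^ 2 * ε * ‖P.targetError T k‖ ^ 2 ≤ L ^ 2 * (μ / (2 * L ^ 2 * R)) * R := by
      gcongr
      exact min_le_left _ _
    have g4 : L ^ 2 * (μ / (2 * L ^ 2 * R)) * R = μ / 2 := by field_simp
    linarith
  obtain ⟨hs1, hs2⟩ := hstep T k hg
  have hpn : 0 ≤ p := (norm_nonneg _).trans hs1
  have hpp₀ : p ≤ p₀ :=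
    le_of_sq_le_sq (hpμ.trans ((min_le_right _ _).trans (min_le_left _ _))) hp₀.le
  have hp1 : p ≤ 1 := le_of_sq_le_sq (by
    rw [one_pow]
    exact hpμ.trans (min_le_left _ _)) zero_le_one
  have hpc : C₅ * p ^ 2 ≤ P.cf * (1 - θ) / 2 := by
    have g1 := hpμ.trans ((min_le_right _ _).trans (min_le_right _ _))
    have g2 := mul_le_mul_of_nonneg_left g1 hC₅.le
    have g3 : C₅ * (P.cf * (1 - θ) / (2 * C₅)) = P.cf * (1 - θ) / 2 := by field_simp
    linarith
  obtain ⟨u, huU, hu1, hu2⟩ := hshift _ _ hg.mem.1 hβ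
  have hκ : P.kappaN (T.xh k) (betaHat T k) = P.input T k := rfl
  have hdh : (betaHat T k).2 = T.dh k := rfl
  rw [hκ, hdh] at hu1 hu2
  have huk := hg.input_mem k le_rfl
  set x₁ := P.f (T.xh k) (P.input T k) (T.dh k) with hx₁
  have hx₁X : x₁ ∈ P.X := H.cont.f_mem _ hg.mem.1.1 _ huk _ (hg.dh_mem H)
  have hx₁R : ‖x₁‖ ≤ R₁ := (hfb _ hg.mem.1.1 hxh _ huk _ (hg.dh_mem H)).1
  have hxR : ‖T.xh (k + 1)‖ ≤ R₁ + 1 := by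
    have := norm_sub_le x₁ (x₁ - T.xh (k + 1))
    rw [sub_sub_cancel] at this
    linarith
  obtain ⟨q1, q2⟩ := hpert x₁ hx₁X _ hxs.1 (by linarith) hxR u huU _ hβ _ hβ' p hpp₀ hs1 hs2
  rw [hdh] at q1
  have hT : P.Vf (P.phi (T.xh (k + 1)) u (betaHat T (k + 1)).2 P.N) (betaHat T (k + 1)) ≤
      P.cf := by
    have g1 := mul_le_mul_of_nonneg_left hu2 (by positivity : 0 ≤ 1 + e)
    have g2 := mul_le_mul_of_nonneg_right heθ hcf.le
    linarith
  have hUN : u ∈ P.UN (T.xh (k + 1)) (betaHat T (k + 1)) :=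
    ⟨huU, H.phi_mem hxs.1 huU hxs.2 _, hT⟩
  have hSN : (T.xh (k + 1), betaHat T (k + 1)) ∈ P.SN := ⟨hxs.1, H.mem_B hβ', u, hUN⟩
  refine ⟨hβ', hSN, ?_⟩
  have hopt := (H.isLeast_VN0 hSN).2 u hUN
  obtain ⟨k1, -, k3⟩ := hb _ _ hg.mem
  rw [hκ] at k1
  change _ ≤ C₂ * ‖P.targetError T k‖ ^ 2 at k3
  change l * (‖P.targetError T k‖ ^ 2 + _) ≤ _ at k1
  have k4 : 0 ≤ l * ‖P.input T k - P.us (betaHat T k)‖ ^ 2 := by positivity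
  have k5 : 0 ≤ l * ‖P.targetError T k‖ ^ 2 := by positivity
  have k6 := mul_le_mul_of_nonneg_left hu1 (by positivity : 0 ≤ 1 + e)
  have k7 : e * P.VN0 (T.xh k) (betaHat T k) ≤ l / 4 * ‖P.targetError T k‖ ^ 2 := by
    have g1 := mul_le_mul_of_nonneg_left k3 he0.le
    have g2 := mul_le_mul_of_nonneg_right heC hη0
    linarith
  have k8 : 0 ≤ e * P.stage (T.xh k) (P.input T k) (betaHat T k) :=
    mul_nonneg he0.le (by linarith)
  have k9 : C₅ * (L ^ 2 * ε * ‖P.targetError T k‖ ^ 2) ≤ l / 4 * ‖P.targetError T k‖ ^ 2 := by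
    rw [← mul_assoc]
    refine mul_le_mul_of_nonneg_right ?_ hη0
    have g1 := mul_le_mul_of_nonneg_left (min_le_right (μ / (2 * L ^ 2 * R))
      (l / (4 * C₅ * L ^ 2))) (by positivity : 0 ≤ C₅ * L ^ 2)
    have g2 : C₅ * L ^ 2 * (l / (4 * C₅ * L ^ 2)) = l / 4 := by field_simp
    linarith
  have k10 := mul_le_mul_of_nonneg_left hp2 hC₅.le
  linarith

/-- The tracking error of the reference is bounded by target and estimate errors. -/
theorem Assumptions.exists_setpoint_bound (H : P.Assumptions) (hρ : 0 < ρ) :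
    ∃ K > 0, ∃ δ > 0, ∀ T k, P.GoodAt ρ T k → ‖(T.α k).2‖ ≤ δ →
      ‖P.setpointError T k‖ ^ 2 ≤ K * (‖P.targetError T k‖ ^ 2 + P.estErr T k) := by
  obtain ⟨K, hK, hdev⟩ := H.exists_deviation_bound hρ
  obtain ⟨R, hR, hbd⟩ := H.exists_state_bound hρ
  obtain ⟨R₂, hR₂, hxs⟩ := H.exists_target_bound
  obtain ⟨R₃, hR₃, hU, -⟩ := H.exists_input_bound
  obtain ⟨R₄, hR₄, hh⟩ := H.exists_model_bound R₂
  obtain ⟨L, hL, hLip⟩ := H.exists_model_lipschitz H.diff.h_diff (max R R₂)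
  obtain ⟨δ, hδ, hmis⟩ := H.exists_mismatch_bound R one_pos
  obtain ⟨G, hG, hGg⟩ := H.diff.g_diff
  set S := 1 + K * (R + 1) with hS
  have hS0 : 0 < S := by positivity
  obtain ⟨M, hM, hGL⟩ := exists_lipschitz_of_contDiff hG (max R₃ (R₄ + (1 + L) * S))
  refine ⟨(M * (1 + L)) ^ 2 * K, by positivity, δ, hδ, fun T k hg hw => ?_⟩
  have hα := hg.alpha_mem k
  have hβ := H.matched_mem_Bhat hα
  have hB := H.mem_B hβ
  have hu := hg.input_mem k le_rfl
  obtain ⟨hη, -, hxR⟩ := hbd T k hg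
  have hD := hdev T k hg
  have hv := (hmis _ hα hw _ (hg.x_mem k) hxR _ hu (hg.plant_mem k)).2
  -- Offset-freeness enters here: the setpoint is `g` at the target, so the tracking error is an
  -- increment of `g`.
  obtain ⟨hs1, hs2, -, ⟨-, hs4, -⟩, hs5⟩ := (H.target _ hB).1
  simp only at hs1 hs2 hs4 hs5
  have hl := hLip _ (hg.x_mem k) _ hs1 (hxR.trans (le_max_left _ _))
    ((hxs _ hβ).trans (le_max_right _ _)) _ hu _ hs2 _ (H.ds_mem hα) _ (H.ds_mem hα)
  have hys := (hh _ hs1 (hxs _ hβ) _ hs2 _ (H.ds_mem hα)).2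
  set β : Beta nr nu ny nd := ((T.α k).1, P.ds (T.α k)) with hβd
  set D := ‖T.x k - P.xs β‖ + ‖P.input T k - P.us β‖ with hDd
  have hD0 : 0 ≤ D := by positivity
  rw [sub_self, norm_zero, add_zero] at hl
  rw [one_mul] at hv
  set ys := P.h (P.xs β) (P.us β) (P.ds (T.α k)) with hysd
  have hyd : ‖P.output T k - ys‖ ≤ (1 + L) * D := by
    have e : P.output T k - ys =
        (P.output T k - P.h (T.x k) (P.input T k) (P.ds (T.α k))) +
        (P.h (T.x k) (P.input T k) (P.ds (T.α k)) - ys) := by abel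
    rw [e]
    have hv' : ‖P.output T k - P.h (T.x k) (P.input T k) (P.ds (T.α k))‖ ≤ D := hv
    exact (norm_add_le _ _).trans (by linarith)
  have hDS : D ≤ S := by
    have h1 : K * (‖P.targetError T k‖ ^ 2 + P.estErr T k) ≤ K * (R + 1) :=
      mul_le_mul_of_nonneg_left (add_le_add hη hg.err) hK.le
    nlinarith [sq_nonneg (D - 1)]
  have hDS' : (1 + L) * D ≤ (1 + L) * S := mul_le_mul_of_nonneg_left hDS (by positivity)
  have hS' : 0 ≤ (1 + L) * S := by positivity
  have hyR : ‖P.output T k‖ ≤ R₄ + (1 + L) * S := by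
    have := norm_add_le (P.output T k - ys) ys
    rw [sub_add_cancel] at this
    linarith
  have hY : P.output T k ∈ P.Y := by
    obtain ⟨_, _, hT⟩ := hg.loop
    exact H.output_mem hT (hg.alpha_mem 0) hu
  have hpair : ∀ (a : Vec nu) (b : Vec ny), ‖a‖ ≤ R₃ → ‖b‖ ≤ R₄ + (1 + L) * S →
      ‖(a, b)‖ ≤ max R₃ (R₄ + (1 + L) * S) := fun a b ha hb =>
    max_le (ha.trans (le_max_left _ _)) (hb.trans (le_max_right _ _))
  have hgl := hGL (P.input T k, P.output T k) (P.us β, ys) (hpair _ _ (hU _ hu) hyR)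
    (hpair _ _ (hU _ hs2) (by linarith))
  rw [hGg _ hu _ hY, hGg _ hs2 _ hs4, ← hs5, Prod.mk_sub_mk, Prod.norm_def] at hgl
  have hmax : max ‖P.input T k - P.us β‖ ‖P.output T k - ys‖ ≤ (1 + L) * D := by
    refine max_le ?_ hyd
    have := mul_nonneg hL.le hD0
    linarith [norm_nonneg (T.x k - P.xs β)]
  have hfin : ‖P.setpointError T k‖ ≤ M * (1 + L) * D := by
    refine hgl.trans ?_
    rw [mul_assoc]
    exact mul_le_mul_of_nonneg_left hmax hM.le
  refine (pow_le_pow_left₀ (norm_nonneg _) hfin 2).trans ?_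
  rw [mul_pow, mul_assoc]
  exact mul_le_mul_of_nonneg_left hD (sq_nonneg _)

/-! ### Invariance and robust exponential stability -/

/-- Invariance of `S_N^{ρ,τ}` together with a quadratic Lyapunov function of the closed loop. -/
theorem Assumptions.exists_lyapunov (H : P.Assumptions) (hρ : 0 < ρ) {σ : ℝ → ℝ}
    (hσ : P.IsModulus σ) {δ : ℝ} (hδ : 0 < δ) :
    ∃ τ > 0, ∃ δw > 0, ∃ δα > 0, ∃ a > 0, ∃ A > 0, ∃ γ ∈ Set.Ioo (0 : ℝ) 1, ∃ C > 0,
      ∃ V : Trajectory n nu ny nd nw nr → ℕ → ℝ, ∀ T, P.IsClosedLoop T δw δα →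
      initState T ∈ P.SNset ρ τ → ∀ k, stateAt T k ∈ P.SNset ρ τ ∧ P.GoodAt ρ T k ∧
        ‖(T.α k).2‖ ≤ δ ∧
        a * (‖P.targetError T k‖ ^ 2 + P.estErr T k) ≤ V T k ∧
        V T k ≤ A * (‖P.targetError T k‖ ^ 2 + P.estErr T k) ∧
        V T (k + 1) ≤ γ * V T k + C * drift σ T k ^ 2 := by
  obtain ⟨l, hl, C₂, hlC, hb⟩ := H.exists_VN0_bounds hρ
  have hC₂ : 0 < C₂ := hl.trans hlC
  obtain ⟨c₁, hc₁, c₂, c₃, hc₃, C₁, hC₁, hc, hVe, hVdec⟩ := H.exists_VeAt_decrease hρ hσ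
  have hc₂ : 0 < c₂ := hc₃.trans hc
  obtain ⟨m, hm, C₃, hC₃, τ₀, hτ₀, δ₁, hδ₁, s₁, hs₁, hval⟩ := H.exists_value_decrease hρ hσ
  set K := C₂ + m with hK
  have hK0 : 0 < K := by positivity
  -- With `M * c₃ = C₃ + 1` the decrease of `M V_e` outweighs the error term of the value function
  -- by one unit.
  set M := (C₃ + 1) / c₃ with hM
  have hM0 : 0 < M := by positivity
  -- The entries serve, in order, the value decrease, the error bound one in `GoodAt`, and half of
  -- the allowance `m / K * ρ` for staying below level `ρ`.
  set τ := min (min τ₀ c₁) (c₁ * (ρ * m / (2 * K * C₃))) with hτ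
  have hτ0 : 0 < τ := by positivity
  -- The first entry saves half of the decrease `m |δx̂|²`; the second keeps `V_e ≤ τ`, using
  -- `|δx̂|² ≤ ρ / l`.
  set ε := min (m / (2 * M)) (c₃ / c₂ * τ / 2 / (ρ / l)) with hε
  have hε0 : 0 < ε := by positivity
  obtain ⟨δ₂, hδ₂, hVd⟩ := hVdec ε hε0
  set s₂ := min (ρ * m / (2 * K * C₃)) (c₃ / c₂ * τ / 2 / C₁) with hs₂
  have hs₂0 : 0 < s₂ := by positivity
  obtain ⟨δ₃, hδ₃, hσs⟩ := hσ.1.exists_le (ε := min s₁ √s₂) (by positivity)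
  set δ' := min δ (min δ₁ δ₂) with hδ'
  have hδ'0 : 0 < δ' := by positivity
  set b := min (m / 2) 1 with hbdef
  have hb0 : 0 < b := by positivity
  set A := C₂ + M * c₂ + b with hA
  have hA0 : 0 < A := by positivity
  have hbA : b < A := by
    have := mul_pos hM0 hc₂
    linarith
  refine ⟨τ, hτ0, δ' / 2, by positivity, min δ₃ (δ' / 2), by positivity,
    min l (M * c₁), by positivity, A, hA0, 1 - b / A,
    ⟨by rw [sub_pos, div_lt_one hA0]; exact hbA, by linarith [div_pos hb0 hA0]⟩,
    C₃ + M * C₁, by positivity,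
    fun T k => P.VN0 (T.xh k) (betaHat T k) + M * P.VeAt T k, fun T hT h0 => ?_⟩
  have hα : ∀ i, T.α i ∈ P.Ac := hT.alpha_mem h0.2.1
  -- The initial `α` is only known to lie in `Ac`. Its `w_P` is small because that of `α 1` is at
  -- most `δ' / 2` and the first step is too, hence the halved radii.
  have hw : ∀ k, ‖(T.α k).2‖ ≤ δ' := by
    have h1 : ∀ k, ‖(T.α (k + 1)).2‖ ≤ δ' / 2 := fun k => (hT.α_mem k).2
    intro k
    have h2 : ‖(T.α (k + 1)).2 - (T.α k).2‖ ≤ δ' / 2 :=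
      (norm_snd_le (T.α (k + 1) - T.α k)).trans ((norm_le_alphaNorm _).trans
        ((hT.α_step k).trans (min_le_right _ _)))
    have h3 := norm_sub_le (T.α (k + 1)).2 ((T.α (k + 1)).2 - (T.α k).2)
    rw [sub_sub_cancel] at h3
    linarith [h1 k]
  have hdr : ∀ k, drift σ T k ≤ min s₁ √s₂ := fun k =>
    hσs _ (alphaNorm_nonneg _) ((hT.α_step k).trans (min_le_left _ _))
  have hdr2 : ∀ k, drift σ T k ^ 2 ≤ s₂ := fun k => by
    have := pow_le_pow_left₀ (hσ.drift_nonneg T k) ((hdr k).trans (min_le_right _ _)) 2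
    rwa [Real.sq_sqrt hs₂0.le] at this
  have hgood : ∀ k, (∀ i ≤ k, stateAt T i ∈ P.SNset ρ τ) → P.GoodAt ρ T k := fun k hk => by
    have hin : ∀ i ≤ k, P.input T i ∈ P.U := fun i hi => H.kappaN_mem (hk i hi).2.2.1.1
    have hmem : (T.xh k, betaHat T k) ∈ P.ShatN ρ := (hk k le_rfl).2.2.1
    refine ⟨⟨_, _, hT⟩, hα, hin, hmem, ?_⟩
    have h1 := (hVe T k (hT.x_mem k) (hα k) hmem.1.1 (snd_mem_D (H.mem_B hmem.2.1))).1
    have h2 : P.VeAt T k ≤ τ := (hk k le_rfl).2.2.2.2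
    have h3 : τ ≤ c₁ := (min_le_left _ _).trans (min_le_right _ _)
    exact le_of_mul_le_mul_left (by linarith) hc₁
  have hkey : ∀ k, P.GoodAt ρ T k → P.VeAt T k ≤ τ → P.VeAt T (k + 1) ≤ τ ∧
      betaHat T (k + 1) ∈ P.Bhat ∧ (T.xh (k + 1), betaHat T (k + 1)) ∈ P.SN ∧
      P.VeAt T (k + 1) ≤ P.VeAt T k - c₃ * P.estErr T k + ε * ‖P.targetError T k‖ ^ 2 +
        C₁ * drift σ T k ^ 2 ∧
      P.VN0 (T.xh (k + 1)) (betaHat T (k + 1)) ≤ P.VN0 (T.xh k) (betaHat T k) -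
        m * ‖P.targetError T k‖ ^ 2 + C₃ * (P.estErr T k + drift σ T k ^ 2) := by
    intro k hg hk
    have hτ₀' : τ ≤ τ₀ := (min_le_left _ _).trans (min_le_left _ _)
    have h1 := hVd T k hg ((hw k).trans ((min_le_right _ _).trans (min_le_right _ _)))
    have hk1 : P.VeAt T (k + 1) ≤ τ := by
      have h2 := (hVe T k (hT.x_mem k) (hα k) hg.mem.1.1 (hg.dh_mem H)).2
      have h3 : c₃ / c₂ * P.VeAt T k ≤ c₃ * P.estErr T k := by
        rw [div_mul_eq_mul_div, div_le_iff₀ hc₂]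
        nlinarith
      obtain ⟨g1, g2, -⟩ := hb _ _ hg.mem
      have g3 : P.VN0 (T.xh k) (betaHat T k) ≤ ρ := hg.mem.2.2
      have h4 : ‖P.targetError T k‖ ^ 2 ≤ ρ / l := by
        rw [le_div_iff₀ hl]
        have := mul_nonneg hl.le
          (sq_nonneg ‖P.kappaN (T.xh k) (betaHat T k) - P.us (betaHat T k)‖)
        change l * (‖P.targetError T k‖ ^ 2 + _) ≤ _ at g1
        linarith
      have h5 : ε * ‖P.targetError T k‖ ^ 2 ≤ c₃ / c₂ * τ / 2 := by
        have q := mul_le_mul (min_le_right (m / (2 * M)) (c₃ / c₂ * τ / 2 / (ρ / l))) h4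
          (sq_nonneg _) (by positivity)
        rwa [div_mul_cancel₀ _ (by positivity : ρ / l ≠ 0)] at q
      have h6 : C₁ * drift σ T k ^ 2 ≤ c₃ / c₂ * τ / 2 := by
        have := (hdr2 k).trans (min_le_right _ _)
        rwa [le_div_iff₀ hC₁, mul_comm] at this
      have h7 : c₃ / c₂ ≤ 1 := by rw [div_le_one hc₂]; exact hc.le
      have h8 : (1 - c₃ / c₂) * P.VeAt T k ≤ (1 - c₃ / c₂) * τ :=
        mul_le_mul_of_nonneg_left hk (by linarith)
      linarith
    obtain ⟨h2, h3, h4⟩ := hval T k hg (hk.trans hτ₀') (hk1.trans hτ₀')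
      ((hw k).trans ((min_le_right _ _).trans (min_le_left _ _))) ((hdr k).trans (min_le_left _ _))
    exact ⟨hk1, h2, h3, h1, h4⟩
  -- The whole past is carried along, since `GoodAt` needs admissible inputs up to time `k`.
  have hstay : ∀ k, ∀ i ≤ k, stateAt T i ∈ P.SNset ρ τ := by
    intro k
    induction k with
    | zero =>
      intro i hi
      obtain rfl := Nat.le_zero.1 hi
      obtain ⟨e1, e2⟩ := H.estimate_zero hT
      have : stateAt T 0 = initState T := by
        simp only [stateAt, initState, betaHat, e1, e2]
      rw [this]
      exact h0
    | succ k ih =>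
      intro i hi
      rcases Nat.le_succ_iff.1 hi with hi | rfl
      · exact ih i hi
      · have hg := hgood k ih
        have hVk : P.VeAt T k ≤ τ := (ih k le_rfl).2.2.2.2
        obtain ⟨h1, h2, h3, -, h5⟩ := hkey k hg hVk
        refine ⟨hT.x_mem _, hα _, ⟨h3, h2, ?_⟩, rfl, h1⟩
        have g0 := (hVe T k (hT.x_mem k) (hα k) hg.mem.1.1 (hg.dh_mem H)).1
        have g1 : P.estErr T k ≤ ρ * m / (2 * K * C₃) :=
          le_of_mul_le_mul_left (g0.trans (hVk.trans (min_le_right _ _))) hc₁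
        have g2 := (hdr2 k).trans (min_le_left _ _)
        have g3 := mul_le_mul_of_nonneg_left (add_le_add g1 g2) hC₃.le
        have g4 : C₃ * (ρ * m / (2 * K * C₃) + ρ * m / (2 * K * C₃)) = m / K * ρ := by
          field_simp
          ring
        obtain ⟨-, -, g5⟩ := hb _ _ hg.mem
        change _ ≤ C₂ * ‖P.targetError T k‖ ^ 2 at g5
        -- The upper bound on the value turns the decrease into a contraction by `1 - m / K`, so
        -- level `ρ` tolerates a disturbance of `m / K * ρ`.
        have g6 : m / K * P.VN0 (T.xh k) (betaHat T k) ≤ m * ‖P.targetError T k‖ ^ 2 := by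
          rw [div_mul_eq_mul_div, div_le_iff₀ hK0]
          have : 0 ≤ m * ‖P.targetError T k‖ ^ 2 * m := by positivity
          nlinarith
        have g7 : m / K ≤ 1 := by rw [div_le_one hK0]; linarith
        have g8 : P.VN0 (T.xh k) (betaHat T k) ≤ ρ := hg.mem.2.2
        have g9 := mul_le_mul_of_nonneg_left g8 (by linarith : 0 ≤ 1 - m / K)
        change P.VN0 (T.xh (k + 1)) (betaHat T (k + 1)) ≤ ρ
        linarith
  intro k
  have hg := hgood k (hstay k)
  have hVk : P.VeAt T k ≤ τ := (hstay k k le_rfl).2.2.2.2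
  refine ⟨hstay k k le_rfl, hg, (hw k).trans (min_le_left _ _), ?_⟩
  obtain ⟨v1, v2⟩ := hVe T k (hT.x_mem k) (hα k) hg.mem.1.1 (hg.dh_mem H)
  obtain ⟨g1, g2, g3⟩ := hb _ _ hg.mem
  change _ ≤ C₂ * ‖P.targetError T k‖ ^ 2 at g3
  change l * (‖P.targetError T k‖ ^ 2 + _) ≤ _ at g1
  have hE : 0 ≤ P.estErr T k := estErr_nonneg T k
  have hη := sq_nonneg ‖P.targetError T k‖
  have g4 := mul_nonneg hl.le (sq_nonneg ‖P.kappaN (T.xh k) (betaHat T k) - P.us (betaHat T k)‖)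
  have v2' := mul_le_mul_of_nonneg_left v2 hM0.le
  have hupper : P.VN0 (T.xh k) (betaHat T k) + M * P.VeAt T k ≤
      A * (‖P.targetError T k‖ ^ 2 + P.estErr T k) := by
    have q1 : 0 ≤ M * c₂ * ‖P.targetError T k‖ ^ 2 := by positivity
    have q2 : 0 ≤ b * (‖P.targetError T k‖ ^ 2 + P.estErr T k) := by positivity
    have q3 : 0 ≤ C₂ * P.estErr T k := by positivity
    rw [hA]
    linarith
  refine ⟨?_, hupper, ?_⟩
  · have q1 := mul_le_mul_of_nonneg_right (min_le_left l (M * c₁)) hη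
    have q2 := mul_le_mul_of_nonneg_right (min_le_right l (M * c₁)) hE
    have q3 := mul_le_mul_of_nonneg_left v1 hM0.le
    linarith
  · obtain ⟨-, -, -, h4, h5⟩ := hkey k hg hVk
    have h6 := mul_le_mul_of_nonneg_left h4 hM0.le
    have h7 : M * c₃ = C₃ + 1 := by rw [hM]; field_simp
    have h8 : M * ε ≤ m / 2 := by
      have q := mul_le_mul_of_nonneg_left
        (min_le_left (m / (2 * M)) (c₃ / c₂ * τ / 2 / (ρ / l))) hM0.le
      have e : M * (m / (2 * M)) = m / 2 := by field_simp
      rwa [e] at q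
    have h9 := mul_le_mul_of_nonneg_right h8 hη
    have h10 : M * c₃ * P.estErr T k = (C₃ + 1) * P.estErr T k := by rw [h7]
    have h11 := mul_le_mul_of_nonneg_right (min_le_left (m / 2) 1) hη
    have h12 := mul_le_mul_of_nonneg_right (min_le_right (m / 2) 1) hE
    have h13 : b / A * (P.VN0 (T.xh k) (betaHat T k) + M * P.VeAt T k) ≤
        b * (‖P.targetError T k‖ ^ 2 + P.estErr T k) := by
      rw [div_mul_eq_mul_div, div_le_iff₀ hA0, mul_assoc]
      refine mul_le_mul_of_nonneg_left ?_ hb0.le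
      rw [mul_comm _ A]
      exact hupper
    linarith

/-- Stated for an arbitrary output dominated quadratically by target and estimate errors, so that
one Lyapunov function serves both RES claims. -/
theorem IsModulus.isRES_of_lyapunov {σ : ℝ → ℝ} (hσ : P.IsModulus σ)
    (hest : ∀ T δw δα, P.IsClosedLoop T δw δα → T.xh 0 = T.xbar ∧ T.dh 0 = T.dbar)
    {δw δα a A γ C K : ℝ} {S : Set (JointState n nu ny nd nw nr)}
    {V : Trajectory n nu ny nd nw nr → ℕ → ℝ} (ha : 0 < a) (hA : 0 < A)
    (hγ : γ ∈ Set.Ioo (0 : ℝ) 1) (hC : 0 < C) (hK : 0 < K)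
    (hV : ∀ T, P.IsClosedLoop T δw δα → initState T ∈ S → ∀ k,
        a * (‖P.targetError T k‖ ^ 2 + P.estErr T k) ≤ V T k ∧
        V T k ≤ A * (‖P.targetError T k‖ ^ 2 + P.estErr T k) ∧
        V T (k + 1) ≤ γ * V T k + C * drift σ T k ^ 2)
    {q : ℕ} {ζ : Trajectory n nu ny nd nw nr → ℕ → Vec q}
    (hζ : ∀ T, P.IsClosedLoop T δw δα → initState T ∈ S → ∀ k,
        ‖ζ T k‖ ^ 2 ≤ K * (‖P.targetError T k‖ ^ 2 + P.estErr T k)) :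
    P.IsRES δw δα S ζ P.targetError := by
  have hγ0 : 0 < √γ := Real.sqrt_pos.2 hγ.1
  -- `K` accounts for the output, `1` for the estimate error listed beside it.
  set κ := √((K + 1) / a) with hκ
  have hκ0 : 0 < κ := Real.sqrt_pos.2 (by positivity)
  have hC0 : 0 < √C := Real.sqrt_pos.2 hC
  refine ⟨κ * √A, by positivity, √γ, ⟨hγ0, by
    rw [Real.sqrt_lt' one_pos, one_pow]; exact hγ.2⟩, fun t => κ * (√C / √γ) * σ t,
    hσ.1.const_mul (by positivity), fun T hT h0 k => ?_⟩
  obtain ⟨e1, e2⟩ := hest T _ _ hT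
  have hVT := hV T hT h0
  have hn : ∀ k, 0 ≤ ‖P.targetError T k‖ ^ 2 + P.estErr T k := fun k =>
    add_nonneg (sq_nonneg _) (estErr_nonneg T k)
  have hW : ∀ k, 0 ≤ V T k := fun k => (mul_nonneg ha.le (hn k)).trans (hVT k).1
  have hmain := sqrt_le_of_contraction (W := V T) (b := fun k => √C * drift σ T k) hγ.1 hW
    (fun k => mul_nonneg hC0.le (hσ.drift_nonneg T k))
    (fun k => by rw [mul_pow, Real.sq_sqrt hC.le]; exact (hVT k).2.2) k
  have hleft : √(‖ζ T k‖ ^ 2 + ‖T.x k - T.xh k‖ ^ 2 + ‖P.ds (T.α k) - T.dh k‖ ^ 2) ≤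
      κ * √(V T k) := by
    rw [hκ, ← Real.sqrt_mul (by positivity)]
    apply Real.sqrt_le_sqrt
    rw [add_assoc]
    change ‖ζ T k‖ ^ 2 + P.estErr T k ≤ _
    have h1 := hζ T hT h0 k
    have h2 := (hVT k).1
    have h3 : (K + 1) / a * (a * (‖P.targetError T k‖ ^ 2 + P.estErr T k)) ≤
      (K + 1) / a * V T k := mul_le_mul_of_nonneg_left h2 (by positivity)
    have h4 : (K + 1) / a * (a * (‖P.targetError T k‖ ^ 2 + P.estErr T k)) =
      (K + 1) * (‖P.targetError T k‖ ^ 2 + P.estErr T k) := by field_simp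
    linarith [sq_nonneg ‖P.targetError T k‖]
  have hinit : √(V T 0) ≤ √A * √(‖P.targetError T 0‖ ^ 2 + ‖T.x 0 - T.xbar‖ ^ 2 +
      ‖P.ds (T.α 0) - T.dbar‖ ^ 2) := by
    rw [← Real.sqrt_mul hA.le, ← e1, ← e2, add_assoc]
    exact Real.sqrt_le_sqrt (hVT 0).2.1
  have hsum : ∑ i ∈ Finset.range (k + 1), √γ ^ i *
      (κ * (√C / √γ) * σ (alphaNorm (T.α (k - i + 1) - T.α (k - i)))) =
      κ * ∑ i ∈ Finset.range (k + 1), √γ ^ i * (√C * drift σ T (k - i) / √γ) := by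
    rw [Finset.mul_sum]
    refine Finset.sum_congr rfl fun i _ => ?_
    rw [drift]
    ring
  rw [hsum]
  have h1 := mul_le_mul_of_nonneg_left hmain hκ0.le
  have h2 := mul_le_mul_of_nonneg_left hinit (by positivity : 0 ≤ κ * √γ ^ k)
  linarith

/-! ### Closedness -/

theorem continuousOn_extend (k : ℕ) (S : Set (Vec n × Beta nr nu ny nd × (Fin P.N → Vec nu))) :
    ContinuousOn (fun p : Vec n × Beta nr nu ny nd × (Fin P.N → Vec nu) =>
      extend (P := P) p.2.2 k) S := by
  unfold extend
  by_cases hk : k < P.N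
  · simp only [hk, dif_pos]
    fun_prop
  · simp only [hk, dif_neg, not_false_iff]
    exact continuousOn_const

theorem Assumptions.continuousOn_phi (H : P.Assumptions) (k : ℕ) :
    ContinuousOn (fun p : Vec n × Beta nr nu ny nd × (Fin P.N → Vec nu) =>
      P.phi p.1 p.2.2 p.2.1.2 k) (P.X ×ˢ P.Bhat ×ˢ {u | ∀ i, u i ∈ P.U}) := by
  induction k with
  | zero => exact continuousOn_fst
  | succ k ih =>
    refine H.cont.f_cont.comp (f := fun p : Vec n × Beta nr nu ny nd × (Fin P.N → Vec nu) =>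
      (P.phi p.1 p.2.2 p.2.1.2 k, extend p.2.2 k, p.2.1.2))
      (ih.prodMk ((continuousOn_extend k _).prodMk (by fun_prop))) fun p hp => ?_
    have hd := snd_mem_D (H.mem_B hp.2.1)
    exact ⟨H.phi_mem hp.1 hp.2.2 hd k, H.extend_mem hp.2.2 k, hd⟩

theorem Assumptions.continuousOn_stage (H : P.Assumptions) :
    ContinuousOn (fun p : Vec n × Vec nu × Beta nr nu ny nd => P.stage p.1 p.2.1 p.2.2)
      (P.X ×ˢ P.U ×ˢ P.Bhat) := by
  obtain ⟨Q, R, Pf, w, -, -, -, -, -, hst, -⟩ := H.quad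
  have hx : ContinuousOn (fun p : Vec n × Vec nu × Beta nr nu ny nd => P.xs p.2.2)
      (P.X ×ˢ P.U ×ˢ P.Bhat) :=
    H.continuousOn_target.1.comp (by fun_prop) fun p hp => hp.2.2
  have hu : ContinuousOn (fun p : Vec n × Vec nu × Beta nr nu ny nd => P.us p.2.2)
      (P.X ×ˢ P.U ×ˢ P.Bhat) :=
    H.continuousOn_target.2.comp (by fun_prop) fun p hp => hp.2.2
  have hc : ContinuousOn (fun p : Vec n × Vec nu × Beta nr nu ny nd =>
      P.cbar p.2.1 (P.h p.1 p.2.1 p.2.2.2)) (P.X ×ˢ P.U ×ˢ P.Bhat) :=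
    H.continuousOn_cbar_model.comp
      (f := fun p : Vec n × Vec nu × Beta nr nu ny nd => (p.1, p.2.1, p.2.2.2)) (by fun_prop)
      fun p hp => ⟨hp.1, hp.2.1, snd_mem_D (H.mem_B hp.2.2)⟩
  refine ContinuousOn.congr (f := fun p : Vec n × Vec nu × Beta nr nu ny nd =>
      wsq Q (p.1 - P.xs p.2.2) + wsq R (p.2.1 - P.us p.2.2) +
        ∑ i, w i * max 0 (P.cbar p.2.1 (P.h p.1 p.2.1 p.2.2.2) i)) ?_
    fun p hp => hst _ hp.1 _ hp.2.1 _ (H.mem_B hp.2.2)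
  refine ((continuousOn_wsq continuousOn_const (continuousOn_fst.sub hx)).add
    (continuousOn_wsq continuousOn_const (ContinuousOn.sub (by fun_prop) hu))).add ?_
  exact continuousOn_finsetSum _ fun i _ => continuousOn_const.mul
    ((continuous_const.max continuous_id).comp_continuousOn
      ((continuous_apply i).comp_continuousOn hc))

theorem Assumptions.continuousOn_Vf (H : P.Assumptions) :
    ContinuousOn (fun p : Vec n × Beta nr nu ny nd => P.Vf p.1 p.2) (P.X ×ˢ P.Bhat) := by
  obtain ⟨Q, R, Pf, w, -, -, -, hPf, -, -, hVf⟩ := H.quad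
  refine ContinuousOn.congr (f := fun p : Vec n × Beta nr nu ny nd =>
      wsq (Pf p.2) (p.1 - P.xs p.2)) ?_ fun p hp => hVf _ hp.1 _ (H.mem_B hp.2)
  exact continuousOn_wsq (hPf.comp continuousOn_snd fun p hp => hp.2)
    (continuousOn_fst.sub (H.continuousOn_target.1.comp continuousOn_snd fun p hp => hp.2))

theorem Assumptions.continuousOn_VN (H : P.Assumptions) :
    ContinuousOn (fun p : Vec n × Beta nr nu ny nd × (Fin P.N → Vec nu) =>
      P.Vf (P.phi p.1 p.2.2 p.2.1.2 P.N) p.2.1) (P.X ×ˢ P.Bhat ×ˢ {u | ∀ i, u i ∈ P.U}) ∧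
    ContinuousOn (fun p : Vec n × Beta nr nu ny nd × (Fin P.N → Vec nu) =>
      P.VN p.1 p.2.2 p.2.1) (P.X ×ˢ P.Bhat ×ˢ {u | ∀ i, u i ∈ P.U}) := by
  have h1 : ContinuousOn (fun p : Vec n × Beta nr nu ny nd × (Fin P.N → Vec nu) =>
      P.Vf (P.phi p.1 p.2.2 p.2.1.2 P.N) p.2.1) (P.X ×ˢ P.Bhat ×ˢ {u | ∀ i, u i ∈ P.U}) :=
    H.continuousOn_Vf.comp (f := fun p : Vec n × Beta nr nu ny nd × (Fin P.N → Vec nu) =>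
      (P.phi p.1 p.2.2 p.2.1.2 P.N, p.2.1)) ((H.continuousOn_phi _).prodMk (by fun_prop))
      fun p hp => ⟨H.phi_mem hp.1 hp.2.2 (snd_mem_D (H.mem_B hp.2.1)) _, hp.2.1⟩
  refine ⟨h1, ?_⟩
  simp only [VN_eq]
  refine h1.add (continuousOn_finsetSum _ fun k _ => ?_)
  exact H.continuousOn_stage.comp (f := fun p : Vec n × Beta nr nu ny nd × (Fin P.N → Vec nu) =>
      (P.phi p.1 p.2.2 p.2.1.2 k, extend p.2.2 k, p.2.1))
      ((H.continuousOn_phi _).prodMk ((continuousOn_extend k _).prodMk (by fun_prop)))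
      fun p hp => ⟨H.phi_mem hp.1 hp.2.2 (snd_mem_D (H.mem_B hp.2.1)) _,
        H.extend_mem hp.2.2 k, hp.2.1⟩

open Filter Topology in
-- Optimal inputs along a convergent sequence accumulate at a limit that is feasible with cost at
-- most `ρ`; it need not be the selected optimizer, but bounds the optimal value.
theorem Assumptions.isClosed_ShatN (H : P.Assumptions) (ρ : ℝ) : IsClosed (P.ShatN ρ) := by
  refine IsSeqClosed.isClosed fun q p hq hp => ?_
  have hx : p.1 ∈ P.X := H.cons.X_closed.mem_of_tendsto (continuous_fst.continuousAt.tendsto.comp hp)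
    (Eventually.of_forall fun j => (hq j).1.1)
  have hβ : p.2 ∈ P.Bhat := H.isCompact_Bhat.isClosed.mem_of_tendsto
    (continuous_snd.continuousAt.tendsto.comp hp) (Eventually.of_forall fun j => (hq j).2.1)
  have hcp : IsCompact {u : Fin P.N → Vec nu | ∀ i, u i ∈ P.U} := by
    have := isCompact_univ_pi (fun _ : Fin P.N => H.cons.U_compact)
    convert this using 1
    ext u
    simp
  have hu : ∀ j, P.u0 (q j).1 (q j).2 ∈ P.UN (q j).1 (q j).2 := fun j => (H.fhocp _ _ (hq j).1).1
  obtain ⟨u, huU, φ, hφ, hlim⟩ := hcp.tendsto_subseq fun j => (hu j).1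
  have hp' := hp.comp hφ.tendsto_atTop
  have hmem : (p.1, p.2, u) ∈ P.X ×ˢ P.Bhat ×ˢ {u : Fin P.N → Vec nu | ∀ i, u i ∈ P.U} :=
    ⟨hx, hβ, huU⟩
  have ht : Tendsto (fun j => ((q (φ j)).1, (q (φ j)).2, P.u0 (q (φ j)).1 (q (φ j)).2)) atTop
      (𝓝[P.X ×ˢ P.Bhat ×ˢ {u | ∀ i, u i ∈ P.U}] (p.1, p.2, u)) := by
    refine tendsto_nhdsWithin_iff.2 ⟨?_, Eventually.of_forall fun j =>
      ⟨(hq _).1.1, (hq _).2.1, (hu _).1⟩⟩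
    exact (continuous_fst.continuousAt.tendsto.comp hp').prodMk_nhds
      ((continuous_snd.continuousAt.tendsto.comp hp').prodMk_nhds hlim)
  have hT := le_of_tendsto ((H.continuousOn_VN.1 _ hmem).tendsto.comp ht)
    (Eventually.of_forall fun j => (hu (φ j)).2.2)
  have hV : P.VN p.1 u p.2 ≤ ρ := le_of_tendsto ((H.continuousOn_VN.2 _ hmem).tendsto.comp ht)
    (Eventually.of_forall fun j => by
      have h1 := (H.isLeast_VN0 (hq (φ j)).1).1
      have h2 : P.VN0 (q (φ j)).1 (q (φ j)).2 ≤ ρ := (hq (φ j)).2.2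
      rw [h1] at h2
      exact h2)
  have hUN : u ∈ P.UN p.1 p.2 :=
    ⟨huU, H.phi_mem hx huU (snd_mem_D (H.mem_B hβ)) _, hT⟩
  have hSN : (p.1, p.2) ∈ P.SN := ⟨hx, H.mem_B hβ, u, hUN⟩
  exact ⟨hSN, hβ, ((H.isLeast_VN0 hSN).2 u hUN).trans hV⟩

open Filter Topology in
theorem Assumptions.isClosed_SNset (H : P.Assumptions) (hlsc : P.VeLowerSemicontinuous)
    (ρ τ : ℝ) : IsClosed (P.SNset ρ τ) := by
  refine IsSeqClosed.isClosed fun q p hq hp => ?_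
  have t1 : Tendsto (fun j => (q j).1) atTop (𝓝 p.1) :=
    continuous_fst.continuousAt.tendsto.comp hp
  have t2 : Tendsto (fun j => (q j).2.1) atTop (𝓝 p.2.1) :=
    (continuous_fst.comp continuous_snd).continuousAt.tendsto.comp hp
  have t3 : Tendsto (fun j => (q j).2.2) atTop (𝓝 p.2.2) :=
    (continuous_snd.comp continuous_snd).continuousAt.tendsto.comp hp
  have t4 : Tendsto (fun j => (q j).2.2.1) atTop (𝓝 p.2.2.1) :=
    continuous_fst.continuousAt.tendsto.comp t3
  have t5 : Tendsto (fun j => (q j).2.2.2) atTop (𝓝 p.2.2.2) :=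
    continuous_snd.continuousAt.tendsto.comp t3
  have hx : p.1 ∈ P.X :=
    H.cons.X_closed.mem_of_tendsto t1 (Eventually.of_forall fun j => (hq j).1)
  have hα : p.2.1 ∈ P.Ac :=
    H.mis.Ac_compact.isClosed.mem_of_tendsto t2 (Eventually.of_forall fun j => (hq j).2.1)
  have hS : p.2.2 ∈ P.ShatN ρ :=
    (H.isClosed_ShatN ρ).mem_of_tendsto t3 (Eventually.of_forall fun j => (hq j).2.2.1)
  have hs : p.2.2.2.1 = p.2.1.1 := by
    refine tendsto_nhds_unique (continuous_fst.continuousAt.tendsto.comp t5) ?_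
    refine (continuous_fst.continuousAt.tendsto.comp t2).congr fun j => ?_
    exact (hq j).2.2.2.1.symm
  refine ⟨hx, hα, hS, hs, ?_⟩
  by_contra hlt
  have hD : ∀ {z : Vec n × Beta nr nu ny nd}, z ∈ P.ShatN ρ → z.2.2 ∈ P.D := fun hz =>
    snd_mem_D (H.mem_B hz.2.1)
  -- If the limit exceeded `τ`, lower semicontinuity would force nearby members of the sequence
  -- above `τ`.
  have hev := hlsc (p.1, P.ds p.2.1, p.2.2.1, p.2.2.2.2) ⟨hx, H.ds_mem hα, hS.1.1, hD hS⟩ τ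
    (not_le.1 hlt)
  have t6 : Tendsto (fun j => P.ds (q j).2.1) atTop (𝓝 (P.ds p.2.1)) :=
    (H.mis.ds_cont _ hα).tendsto.comp
      (tendsto_nhdsWithin_iff.2 ⟨t2, Eventually.of_forall fun j => (hq j).2.1⟩)
  have t7 : Tendsto (fun j => ((q j).1, P.ds (q j).2.1, (q j).2.2.1, (q j).2.2.2.2)) atTop
      (𝓝[P.X ×ˢ P.D ×ˢ P.X ×ˢ P.D] (p.1, P.ds p.2.1, p.2.2.1, p.2.2.2.2)) := by
    refine tendsto_nhdsWithin_iff.2 ⟨?_, Eventually.of_forall fun j =>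
      ⟨(hq j).1, H.ds_mem (hq j).2.1, (hq j).2.2.1.1.1, hD (hq j).2.2.1⟩⟩
    exact t1.prodMk_nhds (t6.prodMk_nhds (t4.prodMk_nhds
      (continuous_snd.continuousAt.tendsto.comp t5)))
  obtain ⟨j, hj⟩ := (t7.eventually hev).exists
  exact absurd (hq j).2.2.2.2 (not_le.2 hj)

end OffsetFreeMPC
end

/-! ### Assembly of the theorem. -/

theorem mainTheorem1 {n nu ny nd nw nr nc : ℕ} (P : OffsetFreeMPC n nu ny nd nw nr nc)
    (hcont : P.ContinuityAssumption) (hcons : P.ConstraintAssumption)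
    (hsstp : P.SSTPExistence) (hzs : P.IsSSTPSelection)
    (hterm : P.TerminalControlLaw) (hquad : P.QuadraticCosts) (hu0 : P.IsFHOCPSelection)
    (hest : P.EstimatorStability) (hmis : P.MismatchCorrections) (hdiff : P.Differentiability)
    (ρ : ℝ) (hρ : 0 < ρ) :
    ∃ τ > 0, ∃ δw > 0, ∃ δα > 0,
      P.StaysIn δw δα (P.SNset ρ τ) ∧
      (P.VeLowerSemicontinuous → P.IsRPI δw δα (P.SNset ρ τ)) ∧
      P.IsRES δw δα (P.SNset ρ τ) P.targetError P.targetError ∧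
      P.IsRES δw δα (P.SNset ρ τ) P.setpointError P.targetError := by
  have H : P.Assumptions := ⟨hcont, hcons, hzs, hterm, hquad, hu0, hest, hmis, hdiff⟩
  obtain ⟨σ, hσ⟩ : ∃ σ, P.IsModulus σ := H.exists_corrections_modulus
  obtain ⟨K, hK, δ, hδ, hset⟩ := H.exists_setpoint_bound hρ
  -- The radius `δ` of the setpoint bound is passed on, so that `|w_P| ≤ δ` holds along all
  -- trajectories and the same `τ`, `δw`, `δα` serve every claim.
  obtain ⟨τ, hτ, δw, hδw, δα, hδα, a, ha, A, hA, γ, hγ, C, hC, V, hV⟩ :=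
    H.exists_lyapunov hρ hσ hδ
  have hstay : P.StaysIn δw δα (P.SNset ρ τ) := fun T hT h0 k => (hV T hT h0 k).1
  have hest0 := fun T δw δα (hT : P.IsClosedLoop T δw δα) => H.estimate_zero hT
  refine ⟨τ, hτ, δw, hδw, δα, hδα, hstay, fun hlsc => ⟨H.isClosed_SNset hlsc ρ τ, hstay⟩, ?_, ?_⟩
  · refine hσ.isRES_of_lyapunov hest0 ha hA hγ hC one_pos
      (fun T hT h0 k => (hV T hT h0 k).2.2.2) fun T hT h0 k => ?_
    rw [one_mul]
    exact le_add_of_nonneg_right (OffsetFreeMPC.estErr_nonneg T k)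
  · exact hσ.isRES_of_lyapunov hest0 ha hA hγ hC hK
      (fun T hT h0 k => (hV T hT h0 k).2.2.2) fun T hT h0 k =>
        hset T k (hV T hT h0 k).2.1 (hV T hT h0 k).2.2.1
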